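/- **Setting.** Let $\mathcal S,\mathcal A$ be finite, $A=|\mathcal A|\ge 1$, $P$ a transition kernel, $r:\mathcal S\times\mathcal A\to[0,1]$ a reward, $\gamma\in[0,1)$. A policy is a $\pi\in\Delta_{\mathcal A}^{\mathcal S}$. For a start distribution $\mu$ put $V^\pi_\mu=\mathbb E\big[\sum_{t\ge0}\gamma^t r(s_t,a_t)\big]$ with $s_0\sim\mu$, $a_t\sim\pi(s_t)$, $s_{t+1}\sim P(\cdot|s_t,a_t)$; this extends to matrices $\pi\in\mathbb R^{\mathcal S\times\mathcal A}$ near the policies, and $\nabla V^\pi_\mu$ is the gradient in $\pi$. Let $\Pi$ be a non-empty set of policies and let $N(x)$ be the least number of policies such that each $\pi\in\Pi$ is within $x$ of one of them in $\|y\|_{\infty,1}=\max_s\sum_a|y(s,a)|$. An ERM oracle over $\Pi$ with tolerance $\varepsilon_{\mathrm{ERM}}$ maps each finite dataset $D=((s_i,l_i))_i$ in $\mathcal S\times\mathbb R^{\mathcal A}$ to a $\pi\in\Pi$ with $\sum_i l_i^\top\pi(s_i)\ge\sum_i l_i^\top\pi^*(s_i)-\varepsilon_{\mathrm{ERM}}\sum_i\|l_i\|_\infty$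 for all $\pi^*\in\Pi$. **Samplers.** *Q-sampler* at $\pi$: start at $s_0\sim\mu$; in each round stop with probability $1-\gamma$, else make one step of $\pi$; call the state at which this stops $s$. Take a uniformly random action $a$ in $s$. Starting at the pair $(s,a)$, in each round stop with probability $1-\gamma$, else move to a next state and draw the next action from $\pi$; if this stops at $(\tilde s,\tilde a)$, put $R=r(\tilde s,\tilde a)/(1-\gamma)$ and return $s$ and $\widehat Q(\cdot)=\mathbb 1[\cdot=a]\,A R$. *H-sampler* at $\pi$: obtain $s'$ and a uniform action $a'$ as in the first two steps, move to a next state drawn from $P(\cdot|s',a')$, run the first loop again from there until it stops in a state $s''$, take a uniform action $a''$ in $s''$, obtain $R$ from the pair $(s'',a'')$ as above, and return $s',s''$ and $\widehat H(a_1,a_2)=\mathbb 1[a_1=a',a_2=a'']\,A^2R$. The length of an episode is the number of actions taken in it (up to and including the action of the pair whose reward is recorded). **Algorithm** (variance-reduced conservative policy iteration, parameters $\eta,\lambda\in[0,1]$, $T\ge1$). Take $\pi_0=\pi_1\in\Pi$ arbitrary and $D_0$ empty. For $t=1,\dots,T$: run the Q-sampler at $\pi_t$ to get $(s_t,\widehat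 Q_t)$; draw $b$ uniformly from $[0,1]$ and run the H-sampler at $(1-b)\pi_t+b\pi_{t-1}$ to get $(s'_t,s''_t,\widehat H_t)$; obtain $D_t$ from $D_{t-1}$ by multiplying all loss vectors by $1-\lambda$ and appending $$\Big(s_t,\tfrac{\lambda}{1-\gamma}\widehat Q_t\Big),\quad \Big(s'_t,\tfrac{\gamma(1-\lambda)}{(1-\gamma)^2}\widehat H_t\big(\pi_t(s''_t)-\pi_{t-1}(s''_t)\big)\Big),\quad \Big(s''_t,\tfrac{\gamma(1-\lambda)}{(1-\gamma)^2}\widehat H_t^\top\big(\pi_t(s'_t)-\pi_{t-1}(s'_t)\big)\Big);$$ put $\pi'_t=\mathrm{ERM}(D_t)$, $\pi_{t+1}=(1-\eta)\pi_t+\eta\pi'_t$, $\widehat A_t=\sum_{(s,l)\in D_t}l^\top(\pi'_t(s)-\pi_t(s))$. Return $\bar\pi=\pi_{\bar t}$ with $\bar t$ a minimizer of $\widehat A_t$ over $T/2\le t\le T$ (ties broken in any way). **Theorem.** Let $\varepsilon>0$, $\delta\in(0,1)$, $\varepsilon_{\mathrm{cover}}=\frac{\varepsilon(1-\gamma)^2}{80A}$,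 $\varepsilon_{\mathrm{ERM}}=\frac{\varepsilon(1-\gamma)^2}{60A}$ and $C(T)=\frac{8A^{3/2}\sqrt{\gamma\log(2T\,N(\varepsilon_{\mathrm{cover}})/\delta)}}{(1-\gamma)^{5/2}}$. 1. If $\eta\in(0,1]$ and $T\ge1$ satisfy $$40\gamma\,\eta\le\varepsilon(1-\gamma)^3,\qquad 2\gamma A\,\eta T\ge(1-\gamma)\log\frac{20}{\varepsilon(1-\gamma)^2},\qquad \frac{2}{(1-\gamma)\eta T}+5\,C(T)\sqrt\eta\le\frac{3\varepsilon}{10},\qquad(*)$$ then the algorithm with these $\eta,T$, with $\lambda=\frac{4\eta A\gamma}{1-\gamma}$ and with any ERM oracle of tolerance $\varepsilon_{\mathrm{ERM}}$ returns, for every $P$, $r$, $\mu$ and $\pi_1$, with probability at least $1-\delta$ a policy $\bar\pi$ with $$\sup_{\pi'\in\Pi}\langle\nabla V^{\bar\pi}_\mu,\pi'-\bar\pi\rangle\le\varepsilon.\qquad(**)$$ 2. There are universal constants $C>0$ and $k\in\mathbb N$ such that, for all $\mathcal S,\mathcal A,\gamma,\Pi,\varepsilon,\delta$ as above, there are $\eta,\lambda\in[0,1]$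 and $T\ge 1$, not depending on $P,r,\mu$, the oracle or $\pi_1$, for which the algorithm (with any ERM oracle of tolerance $\varepsilon_{\mathrm{ERM}}$) returns with probability at least $1-\delta$ a $\bar\pi$ satisfying $(**)$, and for which the number $2T$ of episodes satisfies $$2T\le C\,\big(1+\log N(\varepsilon_{\mathrm{cover}})\big)\max\Big\{1,\frac{A^3}{(1-\gamma)^6\varepsilon^3}\Big\}\log^k\Big(2+\frac{A}{(1-\gamma)\delta}+\frac1\varepsilon\Big).$$ If $\gamma\ge\varepsilon^3$, these parameters can be taken to satisfy $(*)$ and $\lambda=\frac{4\eta A\gamma}{1-\gamma}$. If the covering numbers scale logarithmically, in the sense that $\log N(\varepsilon_{\mathrm{cover}})\le\kappa\,(1+\log N(\varepsilon))(1+\log(\varepsilon/\varepsilon_{\mathrm{cover}}))$ with some $\kappa\ge1$, then the same bound holds with $C\kappa(1+\log N(\varepsilon))$ in place of $C(1+\log N(\varepsilon_{\mathrm{cover}}))$. 3. For all parameters, a run of $T$ iterations draws exactly $2T$ episodes, each started from $\mu$ and of expected length at most $5/(1-\gamma)$. -/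

import Mathlib

open scoped ENNReal

noncomputable section

namespace VRCPI

/-- A finite Markov decision process: transition kernel and rewards in `[0, 1]`. The discount factor
is passed separately, as `γ : Set.Ico (0 : ℝ) 1`. -/
structure MDP (S A : Type*) where
  P : S → A → PMF S
  r : S → A → ℝ
  r_mem : ∀ s a, r s a ∈ Set.Icc (0 : ℝ) 1

/-- Stochastic policies, i.e. the product over the states of the simplices over the actions. -/
abbrev Policy (S A : Type*) [Fintype A] : Type _ :=
  {π : S → A → ℝ // ∀ s, π s ∈ stdSimplex ℝ A}

/-- The law of the action drawn by the policy in a state. -/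
def actionLaw {S A : Type*} [Fintype A] (π : Policy S A) (s : S) : PMF A :=
  PMF.ofFintype (fun a => ENNReal.ofReal (π.1 s a)) (by
    rw [← ENNReal.ofReal_sum_of_nonneg (fun a _ => (π.2 s).1 a), (π.2 s).2, ENNReal.ofReal_one])

/-- The policy `(1 - b) π + b π'`. -/
def mix {S A : Type*} [Fintype A] (b : unitInterval) (π π' : Policy S A) : Policy S A :=
  ⟨fun s => (1 - (b : ℝ)) • π.1 s + (b : ℝ) • π'.1 s, fun s =>
    (convex_stdSimplex ℝ A) (π.2 s) (π'.2 s) (sub_nonneg.2 b.2.2) b.2.1 (by ring)⟩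

/-! ### Value function, functional gradient, local optimality -/

/-- The law of `(s_t, a_t)` when `s_0 ∼ μ`, `a_t ∼ π(s_t)`, `s_{t+1} ∼ P(s_t, a_t)`, as a
polynomial expression in the entries of `π`; it makes sense for every matrix `π`. -/
def stateActionLaw {S A : Type*} [Fintype S] [Fintype A] (M : MDP S A) (μ : PMF S)
    (π : S → A → ℝ) : ℕ → S → A → ℝ
  | 0 => fun s a => (μ s).toReal * π s a
  | t + 1 => fun s' a' =>
      (∑ s, ∑ a, stateActionLaw M μ π t s a * (M.P s a s').toReal) * π s' a'

/-- The expected discounted return `E[∑ₜ γ ^ t r(s_t, a_t)]` with `s_0 ∼ μ`, as a function on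
matrices (the series converges in a neighbourhood of every policy). -/
def value {S A : Type*} [Fintype S] [Fintype A] (M : MDP S A) (γ : Set.Ico (0 : ℝ) 1) (μ : PMF S)
    (π : S → A → ℝ) : ℝ :=
  ∑' t : ℕ, (γ : ℝ) ^ t * ∑ s, ∑ a, stateActionLaw M μ π t s a * M.r s a

/-- `⟨∇ V_μ^π, π' - π⟩ ≤ ε` for every `π'` in the class, the gradient being that of the value as a
function of the matrix `π`. -/
def LocallyOptimal {S A : Type*} [Fintype S] [Fintype A] (M : MDP S A) (γ : Set.Ico (0 : ℝ) 1)
    (μ : PMF S) (Pol : Set (Policy S A)) (ε : ℝ) (π : Policy S A) : Prop :=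
  DifferentiableAt ℝ (value M γ μ) π.1 ∧
    ∀ π' ∈ Pol, fderiv ℝ (value M γ μ) π.1 (π'.1 - π.1) ≤ ε

/-! ### Covering numbers -/

/-- The norm `‖x‖_{∞,1} = max_s ∑_a |x(s, a)|`. -/
def normInfOne {S A : Type*} [Fintype A] (x : S → A → ℝ) : ℝ :=
  ⨆ s, ∑ a, |x s a|

/-- The minimal number of policies whose closed `ε`-balls in `‖·‖_{∞,1}` cover the class. -/
def coveringNumber {S A : Type*} [Fintype A] (Pol : Set (Policy S A)) (ε : ℝ) : ℕ :=
  sInf {n | ∃ F : Finset (Policy S A), F.card = n ∧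
    ∀ π ∈ Pol, ∃ π' ∈ F, normInfOne (π.1 - π'.1) ≤ ε}

/-! ### ERM oracle -/

/-- A dataset of pairs of a state and a linear loss vector. -/
abbrev Dataset (S A : Type*) : Type _ := List (S × (A → ℝ))

/-- `∑ᵢ lᵢᵀ π(sᵢ)`. -/
def empiricalLoss {S A : Type*} [Fintype A] (D : Dataset S A) (π : Policy S A) : ℝ :=
  (D.map fun x => ∑ a, x.2 a * π.1 x.1 a).sum

/-- An ERM oracle over the class with the given tolerance; `‖l‖` is the maximum norm. -/
def IsERMOracle {S A : Type*} [Fintype A] (Pol : Set (Policy S A)) (tol : ℝ)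
    (erm : Dataset S A → Policy S A) : Prop :=
  ∀ D, erm D ∈ Pol ∧ ∀ π ∈ Pol,
    empiricalLoss D π - tol * (D.map fun x => ‖x.2‖).sum ≤ empiricalLoss D (erm D)

/-! ### Samplers -/

/-- The number of rounds in which a loop that stops with probability `1 - γ` in each round does not
stop. -/
def loopLength (γ : Set.Ico (0 : ℝ) 1) : PMF ℕ :=
  ⟨fun k => ENNReal.ofReal ((γ : ℝ) ^ k * (1 - (γ : ℝ))), by
    have h0 : (0 : ℝ) ≤ 1 - (γ : ℝ) := sub_nonneg.2 γ.2.2.le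
    have h := (hasSum_geometric_of_lt_one γ.2.1 γ.2.2).mul_right (1 - (γ : ℝ))
    rw [inv_mul_cancel₀ (sub_pos.2 γ.2.2).ne'] at h
    have h' := ENNReal.summable.hasSum_iff.2
      (ENNReal.ofReal_tsum_of_nonneg (fun k => mul_nonneg (pow_nonneg γ.2.1 k) h0) h.summable).symm
    rwa [h.tsum_eq, ENNReal.ofReal_one] at h'⟩

/-- The state after `k` steps of the policy from a given state. -/
def walk {S A : Type*} [Fintype A] (M : MDP S A) (π : Policy S A) : ℕ → S → PMF S
  | 0, s => PMF.pure s
  | k + 1, s => (actionLaw π s).bind fun a => (M.P s a).bind fun s' => walk M π k s'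

/-- The state-action pair `k` steps after a given state-action pair, actions after the first one
being drawn from the policy. -/
def pairWalk {S A : Type*} [Fintype A] (M : MDP S A) (π : Policy S A) : ℕ → S → A → PMF (S × A)
  | 0, s, a => PMF.pure (s, a)
  | k + 1, s, a => (M.P s a).bind fun s' => (actionLaw π s').bind fun a' => pairWalk M π k s' a'

/-- What one call of the Q-sampler records: the state at which the first loop stops, the uniform
action taken there, the state-action pair whose reward is recorded, and the number of actions
taken in the episode. -/
structure QSample (S A : Type*) where
  state : S
  action : A
  endState : S
  endAction : A
  length : ℕ

/-- The Q-sampler: one episode started from `μ`. -/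
def qSampler {S A : Type*} [Fintype A] [Nonempty A] (M : MDP S A) (γ : Set.Ico (0 : ℝ) 1)
    (μ : PMF S) (π : Policy S A) : PMF (QSample S A) :=
  μ.bind fun s₀ =>
  (loopLength γ).bind fun k =>
  (walk M π k s₀).bind fun s =>
  (PMF.uniformOfFintype A).bind fun a =>
  (loopLength γ).bind fun k' =>
  (pairWalk M π k' s a).bind fun z =>
  PMF.pure ⟨s, a, z.1, z.2, k + 1 + k'⟩

open Classical in
/-- The vector `Q̂ = 1[· = a_t] |A| R` with `R` the recorded reward divided by `1 - γ`. -/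
def QSample.estimate {S A : Type*} [Fintype A] (M : MDP S A) (γ : Set.Ico (0 : ℝ) 1)
    (q : QSample S A) : A → ℝ := fun a =>
  if a = q.action then Fintype.card A * (M.r q.endState q.endAction / (1 - (γ : ℝ))) else 0

/-- What one call of the H-sampler records: the states at which the first two loops stop, the
uniform actions taken there, the state-action pair whose reward is recorded, and the number of
actions taken in the episode. -/
structure HSample (S A : Type*) where
  state₁ : S
  action₁ : A
  state₂ : S
  action₂ : A
  endState : S
  endAction : A
  length : ℕ

/-- The H-sampler: one episode started from `μ`. -/
def hSampler {S A : Type*} [Fintype A] [Nonempty A] (M : MDP S A) (γ : Set.Ico (0 : ℝ) 1)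
    (μ : PMF S) (π : Policy S A) : PMF (HSample S A) :=
  μ.bind fun s₀ =>
  (loopLength γ).bind fun k =>
  (walk M π k s₀).bind fun s =>
  (PMF.uniformOfFintype A).bind fun a =>
  (M.P s a).bind fun s₁ =>
  (loopLength γ).bind fun k' =>
  (walk M π k' s₁).bind fun s' =>
  (PMF.uniformOfFintype A).bind fun a' =>
  (loopLength γ).bind fun k'' =>
  (pairWalk M π k'' s' a').bind fun z =>
  PMF.pure ⟨s, a, s', a', z.1, z.2, k + 1 + k' + 1 + k''⟩

open Classical in
/-- The matrix `Ĥ = 1[· = a_t, · = a_t'] |A|² R` with `R` the recorded reward divided by `1 - γ`. -/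
def HSample.estimate {S A : Type*} [Fintype A] (M : MDP S A) (γ : Set.Ico (0 : ℝ) 1)
    (h : HSample S A) : A → A → ℝ := fun a₁ a₂ =>
  if a₁ = h.action₁ ∧ a₂ = h.action₂ then
    (Fintype.card A : ℝ) ^ 2 * (M.r h.endState h.endAction / (1 - (γ : ℝ))) else 0

/-! The H-sampler run at a policy that is mixed with a uniformly distributed weight. -/

theorem measurable_bind_apply {X α β : Type*} [MeasurableSpace X] [Countable α]
    {p : X → PMF α} {q : X → α → PMF β} (hp : ∀ a, Measurable fun x => p x a)
    (hq : ∀ a b, Measurable fun x => q x a b) (b : β) :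
    Measurable fun x => ((p x).bind (q x)) b := by
  simp only [PMF.bind_apply]
  exact Measurable.tsum fun a => (hp a).mul (hq a b)

theorem measurable_actionLaw_mix {S A : Type*} [Fintype A] (π π' : Policy S A) (s : S) (a : A) :
    Measurable fun b : unitInterval => actionLaw (mix b π π') s a := by
  simp only [actionLaw, PMF.ofFintype_apply, mix, Pi.add_apply, Pi.smul_apply, smul_eq_mul]
  fun_prop

theorem measurable_walk_mix {S A : Type*} [Finite S] [Fintype A] (M : MDP S A)
    (π π' : Policy S A) (k : ℕ) : ∀ s z : S,
    Measurable fun b : unitInterval => walk M (mix b π π') k s z := by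
  induction k with
  | zero => intro s z; exact measurable_const
  | succ k ih =>
    intro s z
    refine measurable_bind_apply (q := fun b a => (M.P s a).bind fun s' => walk M (mix b π π') k s')
      (fun a => measurable_actionLaw_mix π π' s a) (fun a z => ?_) z
    exact measurable_bind_apply (q := fun b s' => walk M (mix b π π') k s')
      (fun _ => measurable_const) (fun s' z => ih s' z) z

theorem measurable_pairWalk_mix {S A : Type*} [Finite S] [Fintype A] (M : MDP S A)
    (π π' : Policy S A) (k : ℕ) : ∀ (s : S) (a : A) (z : S × A),
    Measurable fun b : unitInterval => pairWalk M (mix b π π') k s a z := by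
  induction k with
  | zero => intro s a z; exact measurable_const
  | succ k ih =>
    intro s a z
    exact measurable_bind_apply (fun _ => measurable_const)
      (fun s' => measurable_bind_apply (fun a' => measurable_actionLaw_mix π π' s' a')
        fun a' z => ih s' a' z) z

theorem measurable_hSampler_mix {S A : Type*} [Finite S] [Fintype A] [Nonempty A] (M : MDP S A)
    (γ : Set.Ico (0 : ℝ) 1) (μ : PMF S) (π π' : Policy S A) (h : HSample S A) :
    Measurable fun b : unitInterval => hSampler M γ μ (mix b π π') h := by
  refine measurable_bind_apply (fun _ => measurable_const) (fun s₀ => ?_) h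
  refine measurable_bind_apply (fun _ => measurable_const) (fun k => ?_)
  refine measurable_bind_apply (fun s => measurable_walk_mix M π π' k s₀ s) (fun s => ?_)
  refine measurable_bind_apply (fun _ => measurable_const) (fun a => ?_)
  refine measurable_bind_apply (fun _ => measurable_const) (fun s₁ => ?_)
  refine measurable_bind_apply (fun _ => measurable_const) (fun k' => ?_)
  refine measurable_bind_apply (fun s' => measurable_walk_mix M π π' k' s₁ s') (fun s' => ?_)
  refine measurable_bind_apply (fun _ => measurable_const) (fun a' => ?_)
  refine measurable_bind_apply (fun _ => measurable_const) (fun k'' => ?_)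
  exact measurable_bind_apply (fun z => measurable_pairWalk_mix M π π' k'' s' a' z)
    (fun _ _ => measurable_const)

instance {S A : Type*} [Countable S] [Countable A] : Countable (HSample S A) :=
  Function.Injective.countable
    (f := fun h : HSample S A => (h.state₁, h.action₁, h.state₂, h.action₂, h.endState,
      h.endAction, h.length))
    (by rintro ⟨⟩ ⟨⟩ h; simp at h; simp [h])

/-- The H-sampler run at the policy `(1 - b) π + b π'` with `b` uniform on `[0, 1]`. -/
def hSamplerMixed {S A : Type*} [Finite S] [Fintype A] [Nonempty A] (M : MDP S A)
    (γ : Set.Ico (0 : ℝ) 1) (μ : PMF S) (π π' : Policy S A) : PMF (HSample S A) :=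
  ⟨fun h => ∫⁻ b : unitInterval, hSampler M γ μ (mix b π π') h, by
    refine ENNReal.summable.hasSum_iff.2 ?_
    rw [← MeasureTheory.lintegral_tsum
      (fun h => (measurable_hSampler_mix M γ μ π π' h).aemeasurable)]
    simp [PMF.tsum_coe]⟩

/-! ### Variance-reduced conservative policy iteration -/

/-- The samples drawn in one iteration. -/
abbrev Sample (S A : Type*) : Type _ := QSample S A × HSample S A

/-- The state of the algorithm at the start of iteration `t`: the policies `π_{t-1}` and `π_t`, the
dataset `D_{t-1}`, and the triples `(i, π_i, Â_i)` for the past iterations `i < t`. -/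
structure State (S A : Type*) [Fintype A] where
  t : ℕ
  prev : Policy S A
  cur : Policy S A
  data : Dataset S A
  log : List (ℕ × Policy S A × ℝ)

/-- The state at the start of the first iteration: `π_0 = π_1` and the empty dataset. -/
def initialState {S A : Type*} [Fintype A] (π₁ : Policy S A) : State S A :=
  ⟨1, π₁, π₁, [], []⟩

/-- The dataset `D_t`: the loss vectors in `D_{t-1}` are multiplied by `1 - lam`, and three new pairs
are appended. -/
def newData {S A : Type*} [Fintype A] (M : MDP S A) (γ : Set.Ico (0 : ℝ) 1) (lam : ℝ)
    (st : State S A) (o : Sample S A) : Dataset S A :=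
  (st.data.map fun x => (x.1, (1 - lam) • x.2)) ++
    [(o.1.state, (lam / (1 - (γ : ℝ))) • o.1.estimate M γ),
     (o.2.state₁, fun a₁ => ((γ : ℝ) * (1 - lam) / (1 - (γ : ℝ)) ^ 2) *
        ∑ a₂, o.2.estimate M γ a₁ a₂ * (st.cur.1 o.2.state₂ a₂ - st.prev.1 o.2.state₂ a₂)),
     (o.2.state₂, fun a₂ => ((γ : ℝ) * (1 - lam) / (1 - (γ : ℝ)) ^ 2) *
        ∑ a₁, o.2.estimate M γ a₁ a₂ * (st.cur.1 o.2.state₁ a₁ - st.prev.1 o.2.state₁ a₁))]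

/-- One iteration, given the samples: `π'_t = erm D_t`, `π_{t+1} = (1 - η) π_t + η π'_t`, and
`Â_t = ∑_{(s, l) ∈ D_t} lᵀ (π'_t(s) - π_t(s))` is recorded. -/
def update {S A : Type*} [Fintype A] (M : MDP S A) (γ : Set.Ico (0 : ℝ) 1) (η : unitInterval)
    (lam : ℝ) (erm : Dataset S A → Policy S A) (st : State S A) (o : Sample S A) : State S A :=
  let D := newData M γ lam st o
  ⟨st.t + 1, st.cur, mix η st.cur (erm D), D,
    (st.t, st.cur, empiricalLoss D (erm D) - empiricalLoss D st.cur) :: st.log⟩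

/-- The state of the algorithm after given samples (listed with the most recent one first). -/
def stateAfter {S A : Type*} [Fintype A] (M : MDP S A) (γ : Set.Ico (0 : ℝ) 1) (η : unitInterval)
    (lam : ℝ) (erm : Dataset S A → Policy S A) (π₁ : Policy S A) : List (Sample S A) → State S A
  | [] => initialState π₁
  | o :: h => update M γ η lam erm (stateAfter M γ η lam erm π₁ h) o

/-- The joint law of the samples drawn in the first `T` iterations (the most recent one first): in
each iteration the Q-sampler is run at `π_t`, and then the H-sampler at `(1 - b) π_t + b π_{t-1}` with
`b` uniform on `[0, 1]`. -/
def runLaw {S A : Type*} [Finite S] [Fintype A] [Nonempty A] (M : MDP S A)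
    (γ : Set.Ico (0 : ℝ) 1) (μ : PMF S) (η : unitInterval) (lam : ℝ)
    (erm : Dataset S A → Policy S A) (π₁ : Policy S A) : ℕ → PMF (List (Sample S A))
  | 0 => PMF.pure []
  | T + 1 =>
    (runLaw M γ μ η lam erm π₁ T).bind fun h =>
    (qSampler M γ μ (stateAfter M γ η lam erm π₁ h).cur).bind fun q =>
    (hSamplerMixed M γ μ (stateAfter M γ η lam erm π₁ h).cur
      (stateAfter M γ η lam erm π₁ h).prev).bind fun x =>
    PMF.pure ((q, x) :: h)

/-- `π` is a possible output of a run of `T` iterations with the given log: it is `π_t` for a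
minimizer `t` of `Â_t` over `T / 2 ≤ t ≤ T` (ties may be broken in any way). -/
def IsOutput {S A : Type*} [Fintype A] (T : ℕ) (log : List (ℕ × Policy S A × ℝ))
    (π : Policy S A) : Prop :=
  ∃ x ∈ log, x.2.1 = π ∧ T ≤ 2 * x.1 ∧ ∀ y ∈ log, T ≤ 2 * y.1 → x.2.2 ≤ y.2.2

/-- With probability at least `1 - δ` over the samples, the policy returned by the algorithm after
`T` iterations is an `ε`-approximate local optimum in function space. -/
def Succeeds {S A : Type*} [Fintype S] [Fintype A] [Nonempty A] (M : MDP S A)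
    (γ : Set.Ico (0 : ℝ) 1) (μ : PMF S) (Pol : Set (Policy S A)) (η : unitInterval) (lam : ℝ)
    (T : ℕ) (erm : Dataset S A → Policy S A) (π₁ : Policy S A) (ε δ : ℝ) : Prop :=
  ENNReal.ofReal (1 - δ) ≤ (runLaw M γ μ η lam erm π₁ T).toOuterMeasure
    {h | (∃ π, IsOutput T (stateAfter M γ η lam erm π₁ h).log π) ∧
      ∀ π, IsOutput T (stateAfter M γ η lam erm π₁ h).log π → LocallyOptimal M γ μ Pol ε π}

/-- The lengths of the episodes drawn in a run. -/
def episodeLengths {S A : Type*} (h : List (Sample S A)) : List ℕ :=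
  h.flatMap fun o => [o.1.length, o.2.length]

/-! ### Parameters -/

/-- The scale `ε (1 - γ)² / (80 |A|)` at which the class is covered. -/
def coverScale (A : Type*) [Fintype A] (γ : Set.Ico (0 : ℝ) 1) (ε : ℝ) : ℝ :=
  ε * (1 - (γ : ℝ)) ^ 2 / (80 * Fintype.card A)

/-- The tolerance `ε (1 - γ)² / (60 |A|)` of the ERM oracle. -/
def ermTolerance (A : Type*) [Fintype A] (γ : Set.Ico (0 : ℝ) 1) (ε : ℝ) : ℝ :=
  ε * (1 - (γ : ℝ)) ^ 2 / (60 * Fintype.card A)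

/-- The momentum parameter `4 η |A| γ / (1 - γ)`. -/
def momentum (A : Type*) [Fintype A] (γ : Set.Ico (0 : ℝ) 1) (η : unitInterval) : ℝ :=
  4 * (η : ℝ) * Fintype.card A * (γ : ℝ) / (1 - (γ : ℝ))

/-- `C(T) = 8 |A|^{3/2} √(γ log (2 T N / δ)) / (1 - γ)^{5/2}`, with `N` the covering number. -/
def noiseConst {S A : Type*} [Fintype A] (γ : Set.Ico (0 : ℝ) 1) (Pol : Set (Policy S A))
    (ε δ : ℝ) (T : ℕ) : ℝ :=
  8 * (Fintype.card A : ℝ) ^ (3 / 2 : ℝ) *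
    √((γ : ℝ) * Real.log (2 * T * coveringNumber Pol (coverScale A γ ε) / δ)) /
    (1 - (γ : ℝ)) ^ (5 / 2 : ℝ)

/-- The conditions on the step size and on the number of iterations. The first two are cleared of the
denominator `γ`, so that nothing is divided by zero. -/
structure ParamConditions {S A : Type*} [Fintype A] (γ : Set.Ico (0 : ℝ) 1)
    (Pol : Set (Policy S A)) (ε δ : ℝ) (η : unitInterval) (T : ℕ) : Prop where
  eta_pos : 0 < (η : ℝ)
  T_pos : 1 ≤ T
  step : 40 * (γ : ℝ) * η ≤ ε * (1 - (γ : ℝ)) ^ 3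
  burnIn : (1 - (γ : ℝ)) * Real.log (20 / (ε * (1 - (γ : ℝ)) ^ 2)) ≤
    2 * (γ : ℝ) * Fintype.card A * (η * T)
  noise : 2 / ((1 - (γ : ℝ)) * (η * T)) + 5 * noiseConst γ Pol ε δ T * √(η : ℝ) ≤ 3 * ε / 10

/-- The leading factor `|A|³ (1 - γ)⁻⁶ ε⁻³` of the sample complexity, and at least `1`. -/
def leadingRate (A : Type*) [Fintype A] (γ : Set.Ico (0 : ℝ) 1) (ε : ℝ) : ℝ :=
  max 1 ((Fintype.card A : ℝ) ^ 3 / ((1 - (γ : ℝ)) ^ 6 * ε ^ 3))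

/-- The logarithm whose powers are hidden in `Õ`. -/
def logFactor (A : Type*) [Fintype A] (γ : Set.Ico (0 : ℝ) 1) (ε δ : ℝ) : ℝ :=
  Real.log (2 + Fintype.card A / ((1 - (γ : ℝ)) * δ) + 1 / ε)

end VRCPI

end

/-! The dataset `D_t` encodes a linear functional that estimates the gradient of the value at `π_t`
by recursive momentum. A loop with geometric stopping samples the resolvent `(1 - γ P_π)⁻¹` up to
the factor `1 - γ`, so the Q-sampler gives an unbiased gradient estimate (`expect_qSampler`) and the
H-sampler an unbiased Hessian estimate (`expect_hSampler`). The uniform mixing weight averages the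
Hessian over the segment between `π_t` and `π_{t-1}`, and by the fundamental theorem of calculus
this average is exactly the difference of the two gradients (`gradient_sub_gradient`,
`expect_hSamplerMixed_pairing`). Hence the error obeys `e_t = (1 - λ) e_{t-1} + noise` with
conditionally centred noise and no drift term (`errorMartingale_cons`). Consecutive policies differ
by at most `η` in each entry. If `4 γ A η ≤ λ (1 - γ)`, a single noise term is therefore of order `λ
A / (1 - γ)²`, and the accumulated error is sub-Gaussian with variance proxy of order `λ A² / (1 -
γ)⁴`. Hoeffding's lemma, a Chernoff bound and a union bound over times and a minimal cover control
all errors at once (`lexpect_largeDeviation_le`). The rest of the class is reached by Lipschitz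
bounds, and the iterates as convex combinations of class members (`abs_cur_le`). What remains is
deterministic (`gradient_output_le`). By the quadratic lower bound `value_ge`, each late step raises
the value by about `η` times the recorded gap. Since the value lies in `[0, 1 / (1 - γ)]`, the
smallest recorded gap is small, and the oracle property turns a small recorded gap into
near-optimality against the whole class. With `ρ = A / ((1 - γ)² ε)`, the noise requires `λ ≲ ρ⁻²`
and the ascent requires `T ≳ ρ / λ`, whence the rate `ρ³` up to logarithms (`exists_parameters`). If
`ε (1 - γ)² ≥ 1`, every policy is already locally optimal. -/

noncomputable section

namespace VRCPI

/-! ### Expectations of functions under discrete laws -/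

section Expectation

variable {α β : Type*}

/-- The expectation of a real function under a discrete law. -/
def expect (p : PMF α) (f : α → ℝ) : ℝ := ∑' a, (p a).toReal * f a

theorem hasSum_toReal (p : PMF α) : HasSum (fun a => (p a).toReal) 1 := by
  have h : Summable fun a => (p a).toReal := ENNReal.summable_toReal (by simp [p.tsum_coe])
  have h' := ENNReal.tsum_toReal_eq (f := p) p.apply_ne_top
  rw [p.tsum_coe, ENNReal.toReal_one] at h'
  exact h' ▸ h.hasSum

theorem summable_expect (p : PMF α) {f : α → ℝ} {B : ℝ} (hf : ∀ a, |f a| ≤ B) :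
    Summable fun a => (p a).toReal * f a := by
  refine Summable.of_norm_bounded ((hasSum_toReal p).summable.mul_right B) fun a => ?_
  rw [norm_mul, Real.norm_eq_abs, Real.norm_eq_abs, abs_of_nonneg ENNReal.toReal_nonneg]
  exact mul_le_mul_of_nonneg_left (hf a) ENNReal.toReal_nonneg

theorem expect_const (p : PMF α) (c : ℝ) : expect p (fun _ => c) = c := by
  rw [expect, tsum_mul_right, (hasSum_toReal p).tsum_eq, one_mul]

theorem expect_const_mul (p : PMF α) (c : ℝ) (f : α → ℝ) :
    expect p (fun a => c * f a) = c * expect p f := by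
  rw [expect, expect, ← tsum_mul_left]
  exact tsum_congr fun a => by ring

theorem expect_add (p : PMF α) {f g : α → ℝ} {B B' : ℝ} (hf : ∀ a, |f a| ≤ B)
    (hg : ∀ a, |g a| ≤ B') : expect p (fun a => f a + g a) = expect p f + expect p g := by
  rw [expect, expect, expect, ← (summable_expect p hf).tsum_add (summable_expect p hg)]
  exact tsum_congr fun a => by ring

theorem expect_mono (p : PMF α) {f g : α → ℝ} {B B' : ℝ} (hf : ∀ a, |f a| ≤ B)
    (hg : ∀ a, |g a| ≤ B') (h : ∀ a, f a ≤ g a) : expect p f ≤ expect p g :=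
  (summable_expect p hf).tsum_le_tsum
    (fun a => mul_le_mul_of_nonneg_left (h a) ENNReal.toReal_nonneg) (summable_expect p hg)

theorem expect_sub_const (p : PMF α) {f : α → ℝ} {B : ℝ} (hf : ∀ a, |f a| ≤ B) (c : ℝ) :
    expect p (fun a => f a - c) = expect p f - c := by
  have h := expect_add p hf (g := fun _ => -c) (fun _ => le_rfl)
  rw [expect_const] at h
  simpa only [sub_eq_add_neg] using h

theorem abs_expect_le (p : PMF α) {f : α → ℝ} {B : ℝ} (hf : ∀ a, |f a| ≤ B) :
    |expect p f| ≤ B := by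
  have hB : ∀ a : α, |(fun _ : α => B) a| ≤ |B| := fun _ => le_rfl
  have hB' : ∀ a : α, |(fun _ : α => -B) a| ≤ |B| := fun _ => (abs_neg B).le
  refine abs_le.2 ⟨?_, ?_⟩
  · exact (expect_const p (-B)).symm.le.trans
      (expect_mono p hB' hf fun a => (abs_le.1 (hf a)).1)
  · exact (expect_mono p hf hB fun a => (abs_le.1 (hf a)).2).trans (expect_const p B).le

theorem expect_pure (a : α) (f : α → ℝ) : expect (PMF.pure a) f = f a := by
  classical
  rw [expect, tsum_eq_single a fun b hb => by simp [PMF.pure_apply, hb]]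
  simp [PMF.pure_apply]

theorem expect_fintype [Fintype α] (p : PMF α) (f : α → ℝ) :
    expect p f = ∑ a, (p a).toReal * f a := tsum_fintype _

/-- Fubini: the joint weights have total mass one, so the bound on `f` dominates the double series.
-/
theorem expect_bind (p : PMF α) (q : α → PMF β) {f : β → ℝ} {B : ℝ} (hf : ∀ b, |f b| ≤ B) :
    expect (p.bind q) f = expect p fun a => expect (q a) f := by
  have key : Summable (Function.uncurry fun a b => (p a).toReal * ((q a b).toReal * f b)) := by
    have h0 : Summable (fun x : α × β => (p x.1).toReal * (q x.1 x.2).toReal) := by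
      have hn : 0 ≤ fun x : α × β => (p x.1).toReal * (q x.1 x.2).toReal :=
        fun x => mul_nonneg ENNReal.toReal_nonneg ENNReal.toReal_nonneg
      rw [summable_prod_of_nonneg hn]
      have h1 : ∀ a, Summable fun b => (p a).toReal * (q a b).toReal :=
        fun a => (hasSum_toReal (q a)).summable.mul_left ((p a).toReal)
      have h2 : ∀ a, ∑' b, (p a).toReal * (q a b).toReal = (p a).toReal := fun a => by
        rw [tsum_mul_left, (hasSum_toReal (q a)).tsum_eq, mul_one]
      refine ⟨h1, ?_⟩
      simp only [h2]
      exact (hasSum_toReal p).summable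
    refine Summable.of_norm_bounded (h0.mul_right B) fun x => ?_
    simp only [Function.uncurry, ← mul_assoc]
    rw [norm_mul, Real.norm_eq_abs, Real.norm_eq_abs,
      abs_of_nonneg (mul_nonneg ENNReal.toReal_nonneg ENNReal.toReal_nonneg)]
    exact mul_le_mul_of_nonneg_left (hf _) (by positivity)
  have h1 : ∀ b, ((p.bind q) b).toReal * f b =
      ∑' a, (p a).toReal * ((q a b).toReal * f b) := fun b => by
    rw [PMF.bind_apply, ENNReal.tsum_toReal_eq
      (fun a => ENNReal.mul_ne_top (p.apply_ne_top a) ((q a).apply_ne_top b)), ← tsum_mul_right]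
    exact tsum_congr fun a => by rw [ENNReal.toReal_mul, mul_assoc]
  simp only [expect, h1, ← tsum_mul_left]
  exact key.tsum_comm

theorem expect_finset_sum {ι : Type*} (s : Finset ι) (p : PMF α) {f : ι → α → ℝ} {B : ℝ}
    (hf : ∀ i a, |f i a| ≤ B) :
    expect p (fun a => ∑ i ∈ s, f i a) = ∑ i ∈ s, expect p (f i) := by
  simp only [expect, Finset.mul_sum]
  exact Summable.tsum_finsetSum fun i _ => summable_expect p (hf i)

/-- Hoeffding's lemma for discrete laws. -/
theorem expect_exp_le (p : PMF α) {f : α → ℝ} {c : ℝ} (hc : 0 ≤ c) (hf : ∀ a, |f a| ≤ c)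
    (h0 : expect p f = 0) (θ : ℝ) :
    expect p (fun a => Real.exp (θ * f a)) ≤ Real.exp (θ ^ 2 * c ^ 2 / 2) := by
  -- The chord below divides by `c`, so `c = 0` is separate.
  rcases hc.eq_or_lt with rfl | hc
  · have : ∀ a, f a = 0 := fun a => abs_nonpos_iff.1 (hf a)
    simp [this, expect_const]
  -- On `[-c, c]` the exponential lies below its chord. The linear term of the chord has mean zero,
  -- and the constant term is `cosh (θ c)`.
  have hle : ∀ a, Real.exp (θ * f a) ≤
      Real.cosh (θ * c) + Real.sinh (θ * c) / c * f a := by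
    intro a
    obtain ⟨h1, h2⟩ := abs_le.1 (hf a)
    have hconv := convexOn_exp.2 (Set.mem_univ (θ * c)) (Set.mem_univ (-(θ * c)))
      (show (0:ℝ) ≤ (c + f a) / (2 * c) from
        div_nonneg (by linarith) (by linarith))
      (show (0:ℝ) ≤ (c - f a) / (2 * c) from div_nonneg (by linarith) (by linarith))
      (by field_simp; ring)
    have e1 : ((c + f a) / (2 * c)) • (θ * c) + ((c - f a) / (2 * c)) • (-(θ * c)) = θ * f a := by
      simp only [smul_eq_mul]; field_simp; ring
    rw [e1] at hconv
    refine hconv.trans_eq ?_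
    rw [Real.cosh_eq, Real.sinh_eq]
    simp only [smul_eq_mul]
    field_simp
    ring
  have hb : ∀ a, |Real.exp (θ * f a)| ≤ Real.exp (|θ| * c) := fun a => by
    rw [abs_of_pos (Real.exp_pos _)]
    refine Real.exp_le_exp.2 ((le_abs_self _).trans ?_)
    rw [abs_mul]
    exact mul_le_mul_of_nonneg_left (hf a) (abs_nonneg θ)
  have hs : ∀ a, |Real.sinh (θ * c) / c * f a| ≤ |Real.sinh (θ * c) / c| * c := fun a => by
    rw [abs_mul]
    exact mul_le_mul_of_nonneg_left (hf a) (abs_nonneg _)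
  have hadd : ∀ a, |Real.cosh (θ * c) + Real.sinh (θ * c) / c * f a| ≤
      |Real.cosh (θ * c)| + |Real.sinh (θ * c) / c| * c :=
    fun a => (abs_add_le _ _).trans (by linarith [hs a])
  calc expect p (fun a => Real.exp (θ * f a))
      ≤ expect p (fun a => Real.cosh (θ * c) + Real.sinh (θ * c) / c * f a) :=
        expect_mono p hb hadd hle
    _ = Real.cosh (θ * c) := by
        rw [expect_add p (f := fun _ => Real.cosh (θ * c)) (fun _ => le_rfl) hs, expect_const,
          expect_const_mul, h0, mul_zero, add_zero]
    _ ≤ Real.exp ((θ * c) ^ 2 / 2) := Real.cosh_le_exp_half_sq _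
    _ = _ := by rw [mul_pow]

/-- The expectation of an extended nonnegative function under a discrete law. -/
def lexpect (p : PMF α) (f : α → ℝ≥0∞) : ℝ≥0∞ := ∑' a, p a * f a

theorem lexpect_bind (p : PMF α) (q : α → PMF β) (f : β → ℝ≥0∞) :
    lexpect (p.bind q) f = lexpect p fun a => lexpect (q a) f := by
  simp only [lexpect, PMF.bind_apply, ← ENNReal.tsum_mul_left, ← ENNReal.tsum_mul_right]
  rw [ENNReal.tsum_comm]
  exact tsum_congr fun a => tsum_congr fun b => mul_assoc _ _ _

theorem lexpect_pure (a : α) (f : α → ℝ≥0∞) : lexpect (PMF.pure a) f = f a := by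
  classical
  rw [lexpect, tsum_eq_single a fun b hb => by simp [PMF.pure_apply, hb]]
  simp [PMF.pure_apply]

theorem lexpect_const (p : PMF α) (c : ℝ≥0∞) : lexpect p (fun _ => c) = c := by
  rw [lexpect, ENNReal.tsum_mul_right, p.tsum_coe, one_mul]

theorem lexpect_mono (p : PMF α) {f g : α → ℝ≥0∞} (h : ∀ a, f a ≤ g a) :
    lexpect p f ≤ lexpect p g :=
  ENNReal.tsum_le_tsum fun a => mul_le_mul_right (h a) _

theorem lexpect_const_mul (p : PMF α) (c : ℝ≥0∞) (f : α → ℝ≥0∞) :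
    lexpect p (fun a => c * f a) = c * lexpect p f := by
  rw [lexpect, lexpect, ← ENNReal.tsum_mul_left]
  exact tsum_congr fun a => by ring

theorem lexpect_add (p : PMF α) (f g : α → ℝ≥0∞) :
    lexpect p (fun a => f a + g a) = lexpect p f + lexpect p g := by
  simp only [lexpect, mul_add, ENNReal.tsum_add]

theorem lexpect_ofReal (p : PMF α) {f : α → ℝ} {B : ℝ} (hf : ∀ a, |f a| ≤ B) (h0 : ∀ a, 0 ≤ f a) :
    lexpect p (fun a => ENNReal.ofReal (f a)) = ENNReal.ofReal (expect p f) := by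
  rw [expect, ENNReal.ofReal_tsum_of_nonneg
    (fun a => mul_nonneg ENNReal.toReal_nonneg (h0 a)) (summable_expect p hf)]
  exact tsum_congr fun a => by
    rw [ENNReal.ofReal_mul ENNReal.toReal_nonneg, ENNReal.ofReal_toReal (p.apply_ne_top a)]

theorem toOuterMeasure_eq_lexpect (p : PMF α) (s : Set α) :
    p.toOuterMeasure s = lexpect p (s.indicator 1) := by
  classical
  rw [PMF.toOuterMeasure_apply, lexpect]
  exact tsum_congr fun a => by by_cases h : a ∈ s <;> simp [h]

end Expectation

/-! ### Resolvent calculus for the value function -/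

section Calculus

variable {S A : Type*} [Fintype S] [Fintype A]

/-- The vector `s ↦ ∑ₐ u(s, a) q(s, a)`. -/
def dotAct (u q : S → A → ℝ) : S → ℝ := fun s => ∑ a, u s a * q s a

/-- The expected value at the next state, as a function of state and action. -/
def nextVal (M : MDP S A) (g : S → ℝ) : S → A → ℝ := fun s a => ∑ s', (M.P s a s').toReal * g s'

/-- The transition operator of a matrix, as a linear function of the matrix. -/
def stepOp (M : MDP S A) : (S → A → ℝ) →L[ℝ] ((S → ℝ) →L[ℝ] (S → ℝ)) :=
  LinearMap.toContinuousLinearMap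
    { toFun := fun u => LinearMap.toContinuousLinearMap
        { toFun := fun g => dotAct u (nextVal M g)
          map_add' := fun g g' => by
            ext s; simp [dotAct, nextVal, mul_add, Finset.sum_add_distrib]
          map_smul' := fun c g => by
            ext s
            simp only [dotAct, nextVal, Pi.smul_apply, smul_eq_mul, RingHom.id_apply,
              Finset.mul_sum]
            exact Finset.sum_congr rfl fun a _ => Finset.sum_congr rfl fun s' _ => by ring }
      map_add' := fun u u' => by
        ext g s; simp [dotAct, add_mul, Finset.sum_add_distrib]
      map_smul' := fun c u => by
        ext g s; simp [dotAct, Finset.mul_sum, mul_assoc] }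

theorem stepOp_apply (M : MDP S A) (u : S → A → ℝ) (g : S → ℝ) :
    stepOp M u g = dotAct u (nextVal M g) := rfl

/-- The expected one-step reward of a matrix. -/
def rewardOp (M : MDP S A) : (S → A → ℝ) →L[ℝ] (S → ℝ) :=
  LinearMap.toContinuousLinearMap
    { toFun := fun u => dotAct u M.r
      map_add' := fun u u' => by
        ext s; simp [dotAct, add_mul, Finset.sum_add_distrib]
      map_smul' := fun c u => by
        ext s; simp [dotAct, Finset.mul_sum, mul_assoc] }

theorem rewardOp_apply (M : MDP S A) (u : S → A → ℝ) : rewardOp M u = dotAct u M.r := rfl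

/-- The expectation of a function of the start state. -/
def startExp (μ : PMF S) : (S → ℝ) →L[ℝ] ℝ :=
  LinearMap.toContinuousLinearMap
    { toFun := fun g => ∑ s, (μ s).toReal * g s
      map_add' := fun g g' => by simp [mul_add, Finset.sum_add_distrib]
      map_smul' := fun c g => by
        simp only [Pi.smul_apply, smul_eq_mul, RingHom.id_apply, Finset.mul_sum]
        exact Finset.sum_congr rfl fun s _ => by ring }

theorem startExp_apply (μ : PMF S) (g : S → ℝ) : startExp μ g = ∑ s, (μ s).toReal * g s := rfl

theorem startExp_eq_expect (μ : PMF S) (g : S → ℝ) : startExp μ g = expect μ g :=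
  (expect_fintype μ g).symm

theorem startExp_pure (s : S) (g : S → ℝ) : startExp (PMF.pure s) g = g s := by
  rw [startExp_eq_expect, expect_pure]

theorem abs_startExp_le (μ : PMF S) (g : S → ℝ) : |startExp μ g| ≤ ‖g‖ := by
  rw [startExp_eq_expect]
  exact abs_expect_le μ fun s => norm_le_pi_norm g s

/-- The resolvent `(1 - γ P_u)⁻¹`. -/
def resolvent (M : MDP S A) (γ : Set.Ico (0 : ℝ) 1) (u : S → A → ℝ) : (S → ℝ) →L[ℝ] (S → ℝ) :=
  Ring.inverse (1 - (γ : ℝ) • stepOp M u)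

/-- The value of each start state. -/
def stateValue (M : MDP S A) (γ : Set.Ico (0 : ℝ) 1) (u : S → A → ℝ) : S → ℝ :=
  resolvent M γ u (rewardOp M u)

/-- The value of each pair of a start state and a first action. -/
def actionValue (M : MDP S A) (γ : Set.Ico (0 : ℝ) 1) (u : S → A → ℝ) : S → A → ℝ :=
  fun s a => M.r s a + (γ : ℝ) * nextVal M (stateValue M γ u) s a

/-- The directional derivative of the value. -/
def gradient (M : MDP S A) (γ : Set.Ico (0 : ℝ) 1) (μ : PMF S) (u v : S → A → ℝ) : ℝ :=
  startExp μ (resolvent M γ u (dotAct v (actionValue M γ u)))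

/-- The second directional derivative of the value. -/
def hessian (M : MDP S A) (γ : Set.Ico (0 : ℝ) 1) (μ : PMF S) (w u v : S → A → ℝ) : ℝ :=
  (γ : ℝ) * startExp μ (resolvent M γ w
    (stepOp M v (resolvent M γ w (dotAct u (actionValue M γ w))) +
      stepOp M u (resolvent M γ w (dotAct v (actionValue M γ w)))))

variable (M : MDP S A) (γ : Set.Ico (0 : ℝ) 1) (μ : PMF S)

/-- This form shows linearity in the direction and confines the dependence on `u` to the state
value, which is how the gradient is differentiated later. -/
theorem dotAct_actionValue (u v : S → A → ℝ) :
    dotAct v (actionValue M γ u) =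
      rewardOp M v + (γ : ℝ) • stepOp M v (stateValue M γ u) := by
  ext s
  simp only [dotAct, actionValue, rewardOp_apply, stepOp_apply, Pi.add_apply, Pi.smul_apply,
    smul_eq_mul, mul_add, Finset.sum_add_distrib, Finset.mul_sum]
  congr 1
  exact Finset.sum_congr rfl fun a _ => by ring

theorem gradient_add (u v v' : S → A → ℝ) :
    gradient M γ μ u (v + v') = gradient M γ μ u v + gradient M γ μ u v' := by
  simp only [gradient, dotAct_actionValue, map_add, add_apply, smul_add]
  ring

theorem gradient_smul (u v : S → A → ℝ) (c : ℝ) :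
    gradient M γ μ u (c • v) = c * gradient M γ μ u v := by
  simp only [gradient, dotAct_actionValue, map_smul, smul_apply, map_add,
    smul_eq_mul]
  ring

theorem gradient_sub (u v v' : S → A → ℝ) :
    gradient M γ μ u (v - v') = gradient M γ μ u v - gradient M γ μ u v' := by
  have h := gradient_add M γ μ u v ((-1 : ℝ) • v')
  rw [gradient_smul, neg_one_smul, ← sub_eq_add_neg] at h
  linarith

/-! #### Resolvents of contractions -/

omit [Fintype A] in
theorem abs_nextVal_le (g : S → ℝ) (s : S) (a : A) : |nextVal M g s a| ≤ ‖g‖ := by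
  rw [nextVal, ← expect_fintype]
  exact abs_expect_le _ fun s => norm_le_pi_norm g s

theorem sum_abs_le_normInfOne (v : S → A → ℝ) (s : S) : ∑ a, |v s a| ≤ normInfOne v :=
  le_ciSup (f := fun s => ∑ a, |v s a|) (Set.finite_range _).bddAbove s

omit [Fintype S] in
theorem normInfOne_nonneg (v : S → A → ℝ) : 0 ≤ normInfOne v :=
  Real.iSup_nonneg fun _ => Finset.sum_nonneg fun _ _ => abs_nonneg _

omit [Fintype S] in
theorem normInfOne_le {v : S → A → ℝ} {c : ℝ} (hc : 0 ≤ c) (h : ∀ s, ∑ a, |v s a| ≤ c) :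
    normInfOne v ≤ c := Real.iSup_le h hc

omit [Fintype S] in
theorem normInfOne_policy (π : Policy S A) : normInfOne π.1 ≤ 1 :=
  normInfOne_le zero_le_one fun s => by
    rw [Finset.sum_congr rfl fun a _ => abs_of_nonneg ((π.2 s).1 a), (π.2 s).2]

theorem norm_dotAct_le (v q : S → A → ℝ) {B : ℝ} (hB : 0 ≤ B) (hq : ∀ s a, |q s a| ≤ B) :
    ‖dotAct v q‖ ≤ normInfOne v * B := by
  refine (pi_norm_le_iff_of_nonneg (mul_nonneg (normInfOne_nonneg v) hB)).2 fun s => ?_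
  calc ‖dotAct v q s‖ ≤ ∑ a, |v s a * q s a| := Finset.abs_sum_le_sum_abs _ _
    _ ≤ ∑ a, |v s a| * B := Finset.sum_le_sum fun a _ => by
        rw [abs_mul]; exact mul_le_mul_of_nonneg_left (hq s a) (abs_nonneg _)
    _ = (∑ a, |v s a|) * B := (Finset.sum_mul _ _ _).symm
    _ ≤ normInfOne v * B := mul_le_mul_of_nonneg_right (sum_abs_le_normInfOne v s) hB

theorem norm_stepOp_apply_le (v : S → A → ℝ) (g : S → ℝ) :
    ‖stepOp M v g‖ ≤ normInfOne v * ‖g‖ :=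
  norm_dotAct_le v _ (norm_nonneg g) fun s a => abs_nextVal_le M g s a

theorem norm_discounted_stepOp_lt_one (π : Policy S A) : ‖(γ : ℝ) • stepOp M π.1‖ < 1 := by
  have h : ‖stepOp M π.1‖ ≤ 1 := ContinuousLinearMap.opNorm_le_bound _ zero_le_one fun g =>
    (norm_stepOp_apply_le M π.1 g).trans
      (mul_le_mul_of_nonneg_right (normInfOne_policy π) (norm_nonneg g))
  rw [norm_smul, Real.norm_eq_abs, abs_of_nonneg γ.2.1]
  exact (mul_le_of_le_one_right γ.2.1 h).trans_lt γ.2.2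

variable {M γ}

theorem isUnit_one_sub_stepOp {u : S → A → ℝ} (h : ‖(γ : ℝ) • stepOp M u‖ < 1) :
    IsUnit (1 - (γ : ℝ) • stepOp M u) := isUnit_one_sub_of_norm_lt_one h

/-- Uniqueness for the Bellman-type fixed point equation. It is the common tool behind the
performance difference lemma and the expectations of the samplers. -/
theorem resolvent_eq_of_eq {u : S → A → ℝ} (h : ‖(γ : ℝ) • stepOp M u‖ < 1) {x g : S → ℝ}
    (hx : x = g + (γ : ℝ) • stepOp M u x) : x = resolvent M γ u g := by
  have hg : g = (1 - (γ : ℝ) • stepOp M u) x := by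
    simp only [sub_apply, one_apply_eq_self,
      smul_apply]
    exact eq_sub_of_add_eq hx.symm
  rw [hg, resolvent, ← mul_apply_eq_comp,
    Ring.inverse_mul_cancel _ (isUnit_one_sub_stepOp h), one_apply_eq_self]

theorem resolvent_eq {u : S → A → ℝ} (h : ‖(γ : ℝ) • stepOp M u‖ < 1) (g : S → ℝ) :
    resolvent M γ u g = g + (γ : ℝ) • stepOp M u (resolvent M γ u g) := by
  have e : (1 - (γ : ℝ) • stepOp M u) (resolvent M γ u g) = g := by
    rw [resolvent, ← mul_apply_eq_comp,
      Ring.mul_inverse_cancel _ (isUnit_one_sub_stepOp h), one_apply_eq_self]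
  simp only [sub_apply, one_apply_eq_self,
    smul_apply] at e
  exact sub_eq_iff_eq_add.1 e

theorem norm_resolvent_le (π : Policy S A) (g : S → ℝ) :
    ‖resolvent M γ π.1 g‖ ≤ ‖g‖ / (1 - (γ : ℝ)) := by
  have h1 := resolvent_eq (norm_discounted_stepOp_lt_one M γ π) g
  have h2 : ‖resolvent M γ π.1 g‖ ≤ ‖g‖ + (γ : ℝ) * ‖resolvent M γ π.1 g‖ := by
    conv_lhs => rw [h1]
    refine (norm_add_le _ _).trans (add_le_add le_rfl ?_)
    rw [norm_smul, Real.norm_eq_abs, abs_of_nonneg γ.2.1]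
    refine mul_le_mul_of_nonneg_left ((norm_stepOp_apply_le M π.1 _).trans ?_) γ.2.1
    exact mul_le_of_le_one_left (norm_nonneg _) (normInfOne_policy π)
  rw [le_div_iff₀ (sub_pos.2 γ.2.2)]
  linarith

/-! #### The value function -/

/-- Duality between pushing the law forward and pulling functions back. The induction runs over all
`q`, because the last transition is moved onto `q`. -/
theorem sum_stateActionLaw (u : S → A → ℝ) (t : ℕ) (q : S → A → ℝ) :
    ∑ s, ∑ a, stateActionLaw M μ u t s a * q s a =
      startExp μ ((stepOp M u ^ t) (dotAct u q)) := by
  induction t generalizing q with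
  | zero =>
    simp only [stateActionLaw, pow_zero, one_apply_eq_self, startExp_apply, dotAct,
      Finset.mul_sum, mul_assoc]
  | succ t ih =>
    rw [pow_succ, mul_apply_eq_comp, stepOp_apply, ← ih]
    calc ∑ s', ∑ a', stateActionLaw M μ u (t + 1) s' a' * q s' a'
        = ∑ s', ∑ s, ∑ a, stateActionLaw M μ u t s a * ((M.P s a s').toReal * dotAct u q s') := by
          refine Finset.sum_congr rfl fun s' _ => ?_
          simp only [stateActionLaw, mul_assoc, ← Finset.mul_sum]
          change _ * dotAct u q s' = _
          simp only [Finset.sum_mul, mul_assoc]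
      _ = ∑ s, ∑ a, stateActionLaw M μ u t s a * nextVal M (dotAct u q) s a := by
          rw [Finset.sum_comm]
          refine Finset.sum_congr rfl fun s _ => ?_
          rw [Finset.sum_comm]
          exact Finset.sum_congr rfl fun a _ => by rw [nextVal, Finset.mul_sum]

variable (M γ)

/-- Neumann series for the resolvent, evaluated at the one-step reward. -/
theorem value_eq {u : S → A → ℝ} (h : ‖(γ : ℝ) • stepOp M u‖ < 1) :
    value M γ μ u = startExp μ (stateValue M γ u) := by
  have hs : HasSum (fun n => ((γ : ℝ) • stepOp M u) ^ n) (resolvent M γ u) := by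
    have h1 := (HasSummableGeomSeries.summable_geometric_of_norm_lt_one _ h).hasSum
    rwa [geom_series_eq_inverse _ h] at h1
  have h2 := (startExp μ).hasSum
    ((ContinuousLinearMap.apply ℝ (S → ℝ) (rewardOp M u)).hasSum hs)
  rw [stateValue, value]
  refine Eq.trans (tsum_congr fun t => ?_) h2.tsum_eq
  rw [sum_stateActionLaw]
  simp only [ContinuousLinearMap.apply_apply, smul_pow, map_smul,
    smul_eq_mul, rewardOp_apply]

theorem value_nonneg (π : Policy S A) : 0 ≤ value M γ μ π.1 := by
  have h : ∀ t s a, 0 ≤ stateActionLaw M μ π.1 t s a := by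
    intro t
    induction t with
    | zero => exact fun s a => mul_nonneg ENNReal.toReal_nonneg ((π.2 s).1 a)
    | succ t ih =>
      exact fun s' a' => mul_nonneg (Finset.sum_nonneg fun s _ => Finset.sum_nonneg fun a _ =>
        mul_nonneg (ih s a) ENNReal.toReal_nonneg) ((π.2 s').1 a')
  exact tsum_nonneg fun t => mul_nonneg (pow_nonneg γ.2.1 t) (Finset.sum_nonneg fun s _ =>
    Finset.sum_nonneg fun a _ => mul_nonneg (h t s a) (M.r_mem s a).1)

theorem stateValue_nonneg (π : Policy S A) (s : S) : 0 ≤ stateValue M γ π.1 s := by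
  have h := value_nonneg M γ (PMF.pure s) π
  rwa [value_eq M γ _ (norm_discounted_stepOp_lt_one M γ π), startExp_pure] at h

theorem norm_stateValue_le (π : Policy S A) : ‖stateValue M γ π.1‖ ≤ 1 / (1 - (γ : ℝ)) := by
  refine (norm_resolvent_le π _).trans (div_le_div_of_nonneg_right ?_ (sub_nonneg.2 γ.2.2.le))
  refine (norm_dotAct_le π.1 M.r zero_le_one fun s a => ?_).trans ?_
  · rw [abs_of_nonneg (M.r_mem s a).1]; exact (M.r_mem s a).2
  · rw [mul_one]; exact normInfOne_policy π

theorem value_le (π : Policy S A) : value M γ μ π.1 ≤ 1 / (1 - (γ : ℝ)) := by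
  rw [value_eq M γ _ (norm_discounted_stepOp_lt_one M γ π)]
  exact (le_abs_self _).trans ((abs_startExp_le _ _).trans (norm_stateValue_le M γ π))

theorem actionValue_nonneg (π : Policy S A) (s : S) (a : A) : 0 ≤ actionValue M γ π.1 s a :=
  add_nonneg (M.r_mem s a).1 (mul_nonneg γ.2.1 (Finset.sum_nonneg fun s' _ =>
    mul_nonneg ENNReal.toReal_nonneg (stateValue_nonneg M γ π s')))

theorem actionValue_le (π : Policy S A) (s : S) (a : A) :
    actionValue M γ π.1 s a ≤ 1 / (1 - (γ : ℝ)) := by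
  have h0 : 0 < 1 - (γ : ℝ) := sub_pos.2 γ.2.2
  have h1 : nextVal M (stateValue M γ π.1) s a ≤ 1 / (1 - (γ : ℝ)) :=
    (le_abs_self _).trans ((abs_nextVal_le M _ s a).trans (norm_stateValue_le M γ π))
  have h2 : (γ : ℝ) * nextVal M (stateValue M γ π.1) s a ≤ γ * (1 / (1 - (γ : ℝ))) :=
    mul_le_mul_of_nonneg_left h1 γ.2.1
  have h3 : 1 + (γ : ℝ) * (1 / (1 - (γ : ℝ))) = 1 / (1 - (γ : ℝ)) := by field_simp; ring
  rw [actionValue]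
  linarith [(M.r_mem s a).2]

theorem abs_actionValue_le (π : Policy S A) (s : S) (a : A) :
    |actionValue M γ π.1 s a| ≤ 1 / (1 - (γ : ℝ)) := by
  rw [abs_of_nonneg (actionValue_nonneg M γ π s a)]
  exact actionValue_le M γ π s a

theorem abs_gradient_le (π : Policy S A) (v : S → A → ℝ) :
    |gradient M γ μ π.1 v| ≤ normInfOne v / (1 - (γ : ℝ)) ^ 2 := by
  have h0 : 0 < 1 - (γ : ℝ) := sub_pos.2 γ.2.2
  refine (abs_startExp_le _ _).trans ((norm_resolvent_le π _).trans ?_)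
  rw [pow_two, ← div_div]
  refine div_le_div_of_nonneg_right ?_ h0.le
  rw [div_eq_mul_one_div]
  exact norm_dotAct_le v _ (by positivity) (abs_actionValue_le M γ π)

/-- Both policy averages of the action value lie in `[0, 1 / (1 - γ)]`, so their difference does too
in absolute value; this saves the factor 2 of the general norm bound. It settles the regime `ε (1 -
γ)² ≥ 1`. -/
theorem gradient_sub_policy_le (π π' : Policy S A) :
    gradient M γ μ π.1 (π'.1 - π.1) ≤ 1 / (1 - (γ : ℝ)) ^ 2 := by
  have h0 : 0 < 1 - (γ : ℝ) := sub_pos.2 γ.2.2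
  refine (le_abs_self _).trans ((abs_startExp_le _ _).trans ((norm_resolvent_le π _).trans ?_))
  rw [pow_two, ← div_div]
  refine div_le_div_of_nonneg_right ?_ h0.le
  have h : ∀ (σ : Policy S A) s, ∑ a, σ.1 s a * actionValue M γ π.1 s a ∈
      Set.Icc 0 (1 / (1 - (γ : ℝ))) := fun σ s => by
    refine ⟨Finset.sum_nonneg fun a _ => mul_nonneg ((σ.2 s).1 a) (actionValue_nonneg M γ π s a),
      ?_⟩
    calc ∑ a, σ.1 s a * actionValue M γ π.1 s a ≤ ∑ a, σ.1 s a * (1 / (1 - (γ : ℝ))) :=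
          Finset.sum_le_sum fun a _ =>
            mul_le_mul_of_nonneg_left (actionValue_le M γ π s a) ((σ.2 s).1 a)
      _ = _ := by rw [← Finset.sum_mul, (σ.2 s).2, one_mul]
  refine (pi_norm_le_iff_of_nonneg (by positivity)).2 fun s => ?_
  have h1 := h π s
  have h2 := h π' s
  have e : dotAct (π'.1 - π.1) (actionValue M γ π.1) s =
      ∑ a, π'.1 s a * actionValue M γ π.1 s a - ∑ a, π.1 s a * actionValue M γ π.1 s a := by
    simp [dotAct, sub_mul]
  rw [e, Real.norm_eq_abs, abs_le]
  exact ⟨by linarith [h1.2, h2.1], by linarith [h1.1, h2.2]⟩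

/-! #### Derivatives -/

/-- Chain rule for inversion in a Banach algebra: the two minus signs, from the inverse and from `1
- γ P_u`, cancel. -/
theorem hasFDerivAt_resolvent {u : S → A → ℝ} (h : ‖(γ : ℝ) • stepOp M u‖ < 1) :
    ∃ L : (S → A → ℝ) →L[ℝ] ((S → ℝ) →L[ℝ] (S → ℝ)), HasFDerivAt (resolvent M γ) L u ∧
      ∀ v, L v = resolvent M γ u * ((γ : ℝ) • stepOp M v) * resolvent M γ u := by
  obtain ⟨x, hx⟩ := isUnit_one_sub_stepOp h
  have h1 : HasFDerivAt (fun u => 1 - (γ : ℝ) • stepOp M u) (-((γ : ℝ) • stepOp M)) u :=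
    (((stepOp M).hasFDerivAt (x := u)).const_smul (γ : ℝ)).const_sub 1
  have h2 := hasFDerivAt_ringInverse (𝕜 := ℝ) x
  rw [hx] at h2
  refine ⟨_, h2.comp u h1, fun v => ?_⟩
  have h3 : (↑x⁻¹ : (S → ℝ) →L[ℝ] (S → ℝ)) = resolvent M γ u := by
    rw [resolvent, ← hx, Ring.inverse_unit]
  simp [h3, ContinuousLinearMap.mulLeftRight_apply]

theorem hasFDerivAt_stateValue {u : S → A → ℝ} (h : ‖(γ : ℝ) • stepOp M u‖ < 1) :
    ∃ L : (S → A → ℝ) →L[ℝ] (S → ℝ), HasFDerivAt (stateValue M γ) L u ∧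
      ∀ v, L v = resolvent M γ u (dotAct v (actionValue M γ u)) := by
  obtain ⟨L, hL, hL'⟩ := hasFDerivAt_resolvent M γ h
  refine ⟨_, hL.clm_apply (rewardOp M).hasFDerivAt, fun v => ?_⟩
  simp [hL', dotAct_actionValue, stateValue]

theorem eventually_norm_lt {u : S → A → ℝ} (h : ‖(γ : ℝ) • stepOp M u‖ < 1) :
    ∀ᶠ w in nhds u, ‖(γ : ℝ) • stepOp M w‖ < 1 :=
  (continuous_norm.comp ((stepOp M).continuous.const_smul (γ : ℝ))).continuousAt.eventually_lt
    continuousAt_const h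

theorem hasFDerivAt_value {u : S → A → ℝ} (h : ‖(γ : ℝ) • stepOp M u‖ < 1) :
    ∃ L : (S → A → ℝ) →L[ℝ] ℝ, HasFDerivAt (value M γ μ) L u ∧ ∀ v, L v = gradient M γ μ u v := by
  obtain ⟨L, hL, hL'⟩ := hasFDerivAt_stateValue M γ h
  have h1 := ((startExp μ).hasFDerivAt (x := stateValue M γ u)).comp u hL
  refine ⟨_, h1.congr_of_eventuallyEq ?_, fun v => ?_⟩
  -- The closed form of the value is available only where the series converges, which is a
  -- neighbourhood of `u`.
  · filter_upwards [eventually_norm_lt M γ h] with w hw using value_eq M γ μ hw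
  · simp [hL', gradient]

theorem differentiableAt_value (π : Policy S A) : DifferentiableAt ℝ (value M γ μ) π.1 :=
  let ⟨_, hL, _⟩ := hasFDerivAt_value M γ μ (norm_discounted_stepOp_lt_one M γ π)
  hL.differentiableAt

theorem fderiv_value (π : Policy S A) (v : S → A → ℝ) :
    fderiv ℝ (value M γ μ) π.1 v = gradient M γ μ π.1 v := by
  obtain ⟨L, hL, hL'⟩ := hasFDerivAt_value M γ μ (norm_discounted_stepOp_lt_one M γ π)
  rw [hL.fderiv, hL']

theorem hasFDerivAt_gradient {w : S → A → ℝ} (h : ‖(γ : ℝ) • stepOp M w‖ < 1) (v : S → A → ℝ) :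
    ∃ L : (S → A → ℝ) →L[ℝ] ℝ, HasFDerivAt (fun w => gradient M γ μ w v) L w ∧
      ∀ u, L u = hessian M γ μ w u v := by
  obtain ⟨L, hL, hL'⟩ := hasFDerivAt_resolvent M γ h
  obtain ⟨K, hK, hK'⟩ := hasFDerivAt_stateValue M γ h
  have h1 : HasFDerivAt (fun w => rewardOp M v + (γ : ℝ) • stepOp M v (stateValue M γ w))
      ((γ : ℝ) • (stepOp M v).comp K) w :=
    ((((stepOp M v).hasFDerivAt (x := stateValue M γ w)).comp w hK).const_smul (γ : ℝ)).const_add _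
  have h2 := ((startExp μ).hasFDerivAt).comp w (hL.clm_apply h1)
  refine ⟨_, h2.congr_of_eventuallyEq ?_, fun u => ?_⟩
  · exact Filter.Eventually.of_forall fun w => by simp [gradient, dotAct_actionValue]
  · simp only [hessian, dotAct_actionValue M γ w v]
    simp [hL', hK']
    ring

theorem continuousAt_hessian {w : S → A → ℝ} (h : ‖(γ : ℝ) • stepOp M w‖ < 1)
    (u v : S → A → ℝ) : ContinuousAt (fun w => hessian M γ μ w u v) w := by
  obtain ⟨L, hL, -⟩ := hasFDerivAt_resolvent M γ h
  obtain ⟨K, hK, -⟩ := hasFDerivAt_stateValue M γ h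
  have hR := hL.continuousAt
  have hV := hK.continuousAt
  have hq : ∀ v, ContinuousAt (fun w => resolvent M γ w (dotAct v (actionValue M γ w))) w := by
    intro v
    simp only [dotAct_actionValue]
    exact hR.clm_apply (continuousAt_const.add
      (((stepOp M v).continuous.continuousAt.comp hV).const_smul (γ : ℝ)))
  exact continuousAt_const.mul ((startExp μ).continuous.continuousAt.comp (hR.clm_apply
    (((stepOp M v).continuous.continuousAt.comp (hq u)).add
      ((stepOp M u).continuous.continuousAt.comp (hq v)))))

/-- The difference of two gradients is the integral of the Hessian along the segment. -/
theorem gradient_sub_gradient (π π' : Policy S A) (v : S → A → ℝ) :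
    gradient M γ μ π.1 v - gradient M γ μ π'.1 v =
      ∫ b : unitInterval, hessian M γ μ (mix b π π').1 (π.1 - π'.1) v := by
  have hline : ∀ b : unitInterval, (mix b π π').1 = π.1 + (b : ℝ) • (π'.1 - π.1) := fun b => by
    ext s a
    simp only [mix, Pi.add_apply, Pi.smul_apply, Pi.sub_apply, smul_eq_mul]
    ring
  have hn : ∀ x ∈ Set.Icc (0 : ℝ) 1, ‖(γ : ℝ) • stepOp M (π.1 + x • (π'.1 - π.1))‖ < 1 := by
    intro x hx
    have := norm_discounted_stepOp_lt_one M γ (mix ⟨x, hx⟩ π π')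
    rwa [hline] at this
  -- The segment runs from `π` to `π'` while the Hessian is taken in the direction `π - π'`, hence
  -- the antiderivative is minus the gradient.
  have hd : ∀ x ∈ Set.uIcc (0 : ℝ) 1,
      HasDerivAt (fun x : ℝ => -gradient M γ μ (π.1 + x • (π'.1 - π.1)) v)
        (hessian M γ μ (π.1 + x • (π'.1 - π.1)) (π.1 - π'.1) v) x := by
    intro x hx
    rw [Set.uIcc_of_le zero_le_one] at hx
    obtain ⟨L, hL, hL'⟩ := hasFDerivAt_gradient M γ μ (hn x hx) v
    have h1 : HasDerivAt (fun x : ℝ => π.1 + x • (π'.1 - π.1)) (π'.1 - π.1) x := by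
      simpa using ((hasDerivAt_id x).smul_const (π'.1 - π.1)).const_add π.1
    have h2 := (hL.comp_hasDerivAt x h1).neg
    rwa [← map_neg, neg_sub, hL'] at h2
  have hc : ContinuousOn (fun x : ℝ => hessian M γ μ (π.1 + x • (π'.1 - π.1)) (π.1 - π'.1) v)
      (Set.uIcc (0 : ℝ) 1) := by
    intro x hx
    rw [Set.uIcc_of_le zero_le_one] at hx
    refine ContinuousAt.continuousWithinAt ?_
    exact ContinuousAt.comp (f := fun x : ℝ => π.1 + x • (π'.1 - π.1))
      (continuousAt_hessian M γ μ (hn x hx) (π.1 - π'.1) v) (by fun_prop)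
  have h3 := intervalIntegral.integral_eq_sub_of_hasDerivAt hd hc.intervalIntegrable
  simp only [hline]
  rw [MeasureTheory.integral_subtype measurableSet_Icc
    (fun x : ℝ => hessian M γ μ (π.1 + x • (π'.1 - π.1)) (π.1 - π'.1) v),
    MeasureTheory.integral_Icc_eq_integral_Ioc, ← intervalIntegral.integral_of_le zero_le_one, h3]
  simp only [one_smul, zero_smul, add_zero, add_sub_cancel]
  ring

/-- The performance difference lemma. -/
theorem stateValue_sub (π π' : Policy S A) :
    stateValue M γ π'.1 - stateValue M γ π.1 =
      resolvent M γ π'.1 (dotAct (π'.1 - π.1) (actionValue M γ π.1)) := by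
  have h1 := resolvent_eq (norm_discounted_stepOp_lt_one M γ π) (rewardOp M π.1)
  have h2 := resolvent_eq (norm_discounted_stepOp_lt_one M γ π') (rewardOp M π'.1)
  refine resolvent_eq_of_eq (norm_discounted_stepOp_lt_one M γ π') ?_
  rw [dotAct_actionValue]
  change stateValue M γ π.1 = _ + (γ : ℝ) • stepOp M π.1 (stateValue M γ π.1) at h1
  change stateValue M γ π'.1 = _ + (γ : ℝ) • stepOp M π'.1 (stateValue M γ π'.1) at h2
  simp only [map_sub, sub_apply, smul_sub]
  conv_lhs => rw [h1, h2]
  abel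

/-- The second resolvent identity, obtained from uniqueness of the fixed point. -/
theorem resolvent_sub (π π' : Policy S A) (g : S → ℝ) :
    resolvent M γ π'.1 g - resolvent M γ π.1 g =
      resolvent M γ π'.1 ((γ : ℝ) • stepOp M (π'.1 - π.1) (resolvent M γ π.1 g)) := by
  have h1 := resolvent_eq (norm_discounted_stepOp_lt_one M γ π) g
  have h2 := resolvent_eq (norm_discounted_stepOp_lt_one M γ π') g
  refine resolvent_eq_of_eq (norm_discounted_stepOp_lt_one M γ π') ?_
  simp only [map_sub, sub_apply, smul_sub]
  conv_lhs => rw [h1, h2]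
  abel

/-- The performance difference lemma is the first-order term with the resolvent of `π'` in place of
that of `π`. Exchanging the resolvents produces a second factor `π' - π`, so the remainder is exact
and quadratic, without a Taylor expansion. -/
theorem value_ge (π π' : Policy S A) :
    value M γ μ π.1 + gradient M γ μ π.1 (π'.1 - π.1) -
        (γ : ℝ) * normInfOne (π'.1 - π.1) ^ 2 / (1 - (γ : ℝ)) ^ 3 ≤ value M γ μ π'.1 := by
  have h0 : 0 < 1 - (γ : ℝ) := sub_pos.2 γ.2.2
  set u := π'.1 - π.1 with hu
  set q := dotAct u (actionValue M γ π.1) with hq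
  have h1 : value M γ μ π'.1 - value M γ μ π.1 - gradient M γ μ π.1 u =
      startExp μ (resolvent M γ π'.1 ((γ : ℝ) • stepOp M u (resolvent M γ π.1 q))) := by
    rw [value_eq M γ _ (norm_discounted_stepOp_lt_one M γ π),
      value_eq M γ _ (norm_discounted_stepOp_lt_one M γ π'), ← map_sub, stateValue_sub,
      gradient, ← map_sub, resolvent_sub]
  have hn := normInfOne_nonneg u
  have hq1 : ‖q‖ ≤ normInfOne u * (1 / (1 - (γ : ℝ))) :=
    norm_dotAct_le u _ (by positivity) (abs_actionValue_le M γ π)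
  have h2 : |startExp μ (resolvent M γ π'.1 ((γ : ℝ) • stepOp M u (resolvent M γ π.1 q)))| ≤
      (γ : ℝ) * normInfOne u ^ 2 / (1 - (γ : ℝ)) ^ 3 := by
    refine (abs_startExp_le _ _).trans ((norm_resolvent_le π' _).trans ?_)
    rw [norm_smul, Real.norm_eq_abs, abs_of_nonneg γ.2.1]
    calc (γ : ℝ) * ‖stepOp M u (resolvent M γ π.1 q)‖ / (1 - (γ : ℝ))
        ≤ (γ : ℝ) * (normInfOne u * ((normInfOne u * (1 / (1 - (γ : ℝ)))) / (1 - (γ : ℝ)))) /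
          (1 - (γ : ℝ)) := by
          refine div_le_div_of_nonneg_right (mul_le_mul_of_nonneg_left ?_ γ.2.1) h0.le
          refine (norm_stepOp_apply_le M u _).trans (mul_le_mul_of_nonneg_left ?_ hn)
          exact (norm_resolvent_le π q).trans (div_le_div_of_nonneg_right hq1 h0.le)
      _ = _ := by field_simp
  linarith [(abs_le.1 h2).1]

end Calculus

/-! ### Expectations under the samplers -/

section Samplers

variable {S A : Type*} [Fintype S] [Fintype A]

omit [Fintype S] in
theorem actionLaw_toReal (π : Policy S A) (s : S) (a : A) :
    (actionLaw π s a).toReal = π.1 s a := by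
  rw [actionLaw, PMF.ofFintype_apply, ENNReal.toReal_ofReal ((π.2 s).1 a)]

omit [Fintype S] in
theorem expect_actionLaw (π : Policy S A) (s : S) (f : A → ℝ) :
    expect (actionLaw π s) f = ∑ a, π.1 s a * f a := by
  simp only [expect_fintype, actionLaw_toReal]

theorem expect_uniform [Nonempty A] (f : A → ℝ) :
    expect (PMF.uniformOfFintype A) f = (∑ a, f a) / Fintype.card A := by
  simp [expect_fintype, div_eq_inv_mul, Finset.mul_sum]

theorem expect_comm {α β : Type*} [Fintype β] (p : PMF α) (q : PMF β) {f : α → β → ℝ} {B : ℝ}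
    (hf : ∀ a b, |f a b| ≤ B) :
    expect p (fun a => expect q (f a)) = expect q fun b => expect p fun a => f a b := by
  simp only [expect_fintype, ← expect_const_mul]
  refine expect_finset_sum Finset.univ p (B := B) fun b a => ?_
  rw [abs_mul, abs_of_nonneg ENNReal.toReal_nonneg]
  refine (mul_le_of_le_one_left (abs_nonneg _) ?_).trans (hf a b)
  exact ENNReal.toReal_le_of_le_ofReal zero_le_one (by simpa using q.coe_le_one b)

theorem expect_actionLaw_transition (M : MDP S A) (π : Policy S A) (s : S) (g : S → ℝ) :
    expect (actionLaw π s) (fun a => expect (M.P s a) g) = stepOp M π.1 g s := by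
  rw [expect_actionLaw]
  simp only [expect_fintype]
  rfl

omit [Fintype A] in
theorem expect_transition (M : MDP S A) (s : S) (a : A) (g : S → ℝ) :
    expect (M.P s a) g = nextVal M g s a := expect_fintype _ _

theorem expect_loopLength_succ (γ : Set.Ico (0 : ℝ) 1) {f : ℕ → ℝ} {B : ℝ}
    (hf : ∀ k, |f k| ≤ B) :
    expect (loopLength γ) f =
      (1 - (γ : ℝ)) * f 0 + (γ : ℝ) * expect (loopLength γ) fun k => f (k + 1) := by
  have h : ∀ k, (loopLength γ k).toReal = (γ : ℝ) ^ k * (1 - (γ : ℝ)) := fun k =>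
    ENNReal.toReal_ofReal (mul_nonneg (pow_nonneg γ.2.1 k) (sub_nonneg.2 γ.2.2.le))
  rw [expect, (summable_expect (loopLength γ) hf).tsum_eq_zero_add, expect, ← tsum_mul_left]
  simp only [h]
  congr 1
  · ring
  · exact tsum_congr fun k => by ring

variable (M : MDP S A) (γ : Set.Ico (0 : ℝ) 1) (μ : PMF S) (π : Policy S A)

/-- Conditioning on whether the loop stops in its first round gives the fixed point equation of the
resolvent with source `(1 - γ) g`. -/
theorem expect_loop_walk (g : S → ℝ) (s : S) :
    expect (loopLength γ) (fun k => expect (walk M π k s) g) =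
      (1 - (γ : ℝ)) * resolvent M γ π.1 g s := by
  have hg : ∀ s, |g s| ≤ ‖g‖ := fun s => norm_le_pi_norm g s
  set x : S → ℝ := fun s => expect (loopLength γ) (fun k => expect (walk M π k s) g) with hx
  have hfix : x = (1 - (γ : ℝ)) • g + (γ : ℝ) • stepOp M π.1 x := by
    ext s
    have h1 : x s = _ := expect_loopLength_succ γ (fun k => abs_expect_le (walk M π k s) hg)
    rw [h1]
    simp only [Pi.add_apply, Pi.smul_apply, smul_eq_mul]
    congr 2
    · rw [walk, expect_pure]
    · simp only [walk, expect_bind _ _ hg]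
      rw [expect_comm _ _ (fun k a => abs_expect_le _ fun s' => abs_expect_le _ hg),
        ← expect_actionLaw_transition]
      congr 1
      funext a
      exact expect_comm _ _ fun k s' => abs_expect_le _ hg
  have := resolvent_eq_of_eq (norm_discounted_stepOp_lt_one M γ π) hfix
  rw [map_smul] at this
  exact congrFun this s

theorem expect_loop_pairWalk (s : S) (a : A) :
    expect (loopLength γ) (fun k => expect (pairWalk M π k s a) fun z => M.r z.1 z.2) =
      (1 - (γ : ℝ)) * actionValue M γ π.1 s a := by
  have hr : ∀ z : S × A, |M.r z.1 z.2| ≤ 1 := fun z => by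
    rw [abs_of_nonneg (M.r_mem _ _).1]; exact (M.r_mem _ _).2
  set x : S → A → ℝ := fun s a =>
    expect (loopLength γ) fun k => expect (pairWalk M π k s a) fun z => M.r z.1 z.2 with hx
  have hstep : ∀ s a, x s a =
      (1 - (γ : ℝ)) * M.r s a + (γ : ℝ) * nextVal M (dotAct π.1 x) s a := by
    intro s a
    have h1 : x s a = _ :=
      expect_loopLength_succ γ (fun k => abs_expect_le (pairWalk M π k s a) hr)
    rw [h1]
    congr 2
    · rw [pairWalk, expect_pure]
    · simp only [pairWalk, expect_bind _ _ hr]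
      rw [expect_comm _ _ (fun k s' => abs_expect_le _ fun a' => abs_expect_le _ hr),
        expect_transition]
      congr 1
      funext s'
      rw [expect_comm _ _ (fun k a' => abs_expect_le _ hr), expect_actionLaw]
      rfl
  -- The recursion for `x` involves `x` only through its average over the policy's action, and this
  -- average solves a closed equation on states.
  have hy : dotAct π.1 x =
      (1 - (γ : ℝ)) • rewardOp M π.1 + (γ : ℝ) • stepOp M π.1 (dotAct π.1 x) := by
    ext s
    simp only [stepOp_apply, rewardOp_apply, Pi.add_apply, Pi.smul_apply, smul_eq_mul]
    conv_lhs => rw [dotAct]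
    simp only [hstep s]
    simp only [dotAct, Finset.mul_sum, ← Finset.sum_add_distrib]
    exact Finset.sum_congr rfl fun a _ => by ring
  have hV := resolvent_eq_of_eq (norm_discounted_stepOp_lt_one M γ π) hy
  rw [map_smul] at hV
  change x s a = _
  rw [hstep, hV, actionValue, nextVal, nextVal, mul_add, Finset.mul_sum, Finset.mul_sum,
    Finset.mul_sum]
  congr 1
  exact Finset.sum_congr rfl fun s' _ => by
    simp only [stateValue, Pi.smul_apply, smul_eq_mul]; ring

omit [Fintype S] [Fintype A] in
theorem abs_reward_div_le (s : S) (a : A) :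
    |M.r s a / (1 - (γ : ℝ))| ≤ 1 / (1 - (γ : ℝ)) := by
  have h0 : 0 < 1 - (γ : ℝ) := sub_pos.2 γ.2.2
  rw [abs_of_nonneg (div_nonneg (M.r_mem _ _).1 h0.le)]
  exact div_le_div_of_nonneg_right (M.r_mem _ _).2 h0.le

theorem expect_loop_pairWalk_div (s : S) (a : A) :
    expect (loopLength γ) (fun k => expect (pairWalk M π k s a) fun z =>
      M.r z.1 z.2 / (1 - (γ : ℝ))) = actionValue M γ π.1 s a := by
  have h0 : 1 - (γ : ℝ) ≠ 0 := (sub_pos.2 γ.2.2).ne'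
  simp only [div_eq_inv_mul, expect_const_mul, expect_loop_pairWalk]
  rw [← mul_assoc, inv_mul_cancel₀ h0, one_mul]

-- Importance weighting: the factor `|A|` compensates for the uniform choice of the action.
omit [Fintype S] in
theorem expect_uniform_card_mul [Nonempty A] (y q : S → A → ℝ) (s : S) :
    expect (PMF.uniformOfFintype A) (fun a => y s a * (Fintype.card A * q s a)) =
      dotAct y q s := by
  have hA : (Fintype.card A : ℝ) ≠ 0 := Nat.cast_ne_zero.2 Fintype.card_ne_zero
  rw [expect_uniform, div_eq_iff hA, dotAct, Finset.sum_mul]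
  exact Finset.sum_congr rfl fun a _ => by ring

/-- The pairing of the estimate of the Q-sampler with a matrix. -/
def QSample.pairing (q : QSample S A) (v : S → A → ℝ) : ℝ :=
  v q.state q.action * (Fintype.card A * (M.r q.endState q.endAction / (1 - (γ : ℝ))))

/-- The symmetrized pairing of the estimate of the H-sampler with two matrices. -/
def HSample.pairing (h : HSample S A) (u v : S → A → ℝ) : ℝ :=
  (v h.state₁ h.action₁ * u h.state₂ h.action₂ + u h.state₁ h.action₁ * v h.state₂ h.action₂) *
    ((Fintype.card A : ℝ) ^ 2 * (M.r h.endState h.endAction / (1 - (γ : ℝ))))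

theorem abs_apply_le_norm (v : S → A → ℝ) (s : S) (a : A) : |v s a| ≤ ‖v‖ :=
  (norm_le_pi_norm (v s) a).trans (norm_le_pi_norm v s)

variable {M γ} in
omit [Fintype S] in
theorem QSample.abs_pairing_le (q : QSample S A) {v : S → A → ℝ} {c : ℝ}
    (hv : ∀ s a, |v s a| ≤ c) :
    |q.pairing M γ v| ≤ c * (Fintype.card A * (1 / (1 - (γ : ℝ)))) := by
  rw [QSample.pairing, abs_mul, abs_mul, Nat.abs_cast]
  gcongr
  · exact (abs_nonneg _).trans (hv q.state q.action)
  · exact hv _ _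
  · exact abs_reward_div_le M γ _ _

variable {M γ} in
omit [Fintype S] in
theorem HSample.abs_pairing_le (h : HSample S A) {u v : S → A → ℝ} {c d : ℝ}
    (hu : ∀ s a, |u s a| ≤ c) (hv : ∀ s a, |v s a| ≤ d) :
    |h.pairing M γ u v| ≤ 2 * c * d * ((Fintype.card A : ℝ) ^ 2 * (1 / (1 - (γ : ℝ)))) := by
  have hc := (abs_nonneg _).trans (hu h.state₁ h.action₁)
  have hd := (abs_nonneg _).trans (hv h.state₁ h.action₁)
  rw [HSample.pairing, abs_mul, abs_mul, abs_pow, Nat.abs_cast]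
  have h1 : |v h.state₁ h.action₁ * u h.state₂ h.action₂ +
      u h.state₁ h.action₁ * v h.state₂ h.action₂| ≤ 2 * c * d := by
    refine (abs_add_le _ _).trans ?_
    rw [abs_mul, abs_mul]
    have e1 := mul_le_mul (hv h.state₁ h.action₁) (hu h.state₂ h.action₂) (abs_nonneg _) hd
    have e2 := mul_le_mul (hu h.state₁ h.action₁) (hv h.state₂ h.action₂) (abs_nonneg _) hc
    linarith
  gcongr
  exact abs_reward_div_le M γ _ _

/-- The first loop contributes `1 - γ`, the second loop's `1 - γ` cancels with the division of the
reward; the weight `λ / (1 - γ)` in the dataset removes the remaining factor. -/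
theorem expect_qSampler [Nonempty A] (v : S → A → ℝ) :
    expect (qSampler M γ μ π) (fun q => q.pairing M γ v) =
      (1 - (γ : ℝ)) * gradient M γ μ π.1 v := by
  have hb := fun q : QSample S A => q.abs_pairing_le (M := M) (γ := γ) (abs_apply_le_norm v)
  simp only [qSampler, expect_bind _ _ hb, expect_pure]
  simp only [QSample.pairing, expect_const_mul, expect_loop_pairWalk_div,
    expect_uniform_card_mul, expect_loop_walk]
  rw [gradient, startExp_eq_expect]

/-- The expectations are evaluated from the innermost loop outwards; each of the two state loops
yields one resolvent and one factor `1 - γ`. Symmetrizing in the two directions then gives the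
Hessian up to its factor `γ`. -/
theorem expect_hSampler_mul [Nonempty A] (x y : S → A → ℝ) :
    expect (hSampler M γ μ π) (fun h => x h.state₁ h.action₁ * y h.state₂ h.action₂ *
        ((Fintype.card A : ℝ) ^ 2 * (M.r h.endState h.endAction / (1 - (γ : ℝ))))) =
      (1 - (γ : ℝ)) ^ 2 * startExp μ (resolvent M γ π.1 (stepOp M x
        (resolvent M γ π.1 (dotAct y (actionValue M γ π.1))))) := by
  have hb : ∀ h : HSample S A, |x h.state₁ h.action₁ * y h.state₂ h.action₂ *
      ((Fintype.card A : ℝ) ^ 2 * (M.r h.endState h.endAction / (1 - (γ : ℝ))))| ≤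
      ‖x‖ * ‖y‖ * ((Fintype.card A : ℝ) ^ 2 * (1 / (1 - (γ : ℝ)))) := fun h => by
    rw [abs_mul, abs_mul, abs_mul, abs_pow, Nat.abs_cast]
    gcongr
    · exact abs_apply_le_norm x _ _
    · exact abs_apply_le_norm y _ _
    · exact abs_reward_div_le M γ _ _
  simp only [hSampler, expect_bind _ _ hb, expect_pure]
  have e : ∀ s a s' a' (z : S × A), x s a * y s' a' *
      ((Fintype.card A : ℝ) ^ 2 * (M.r z.1 z.2 / (1 - (γ : ℝ)))) =
      x s a * (Fintype.card A * (y s' a' *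
        (Fintype.card A * (M.r z.1 z.2 / (1 - (γ : ℝ)))))) :=
    fun s a s' a' z => by ring
  simp only [e, expect_const_mul, expect_loop_pairWalk_div, expect_transition,
    expect_uniform_card_mul, expect_loop_walk]
  set g := resolvent M γ π.1 (dotAct y (actionValue M γ π.1)) with hg
  have e2 : ∀ s a, x s a * (Fintype.card A * ((1 - (γ : ℝ)) * nextVal M g s a)) =
      (1 - (γ : ℝ)) * (x s a * (Fintype.card A * nextVal M g s a)) := fun s a => by ring
  simp only [e2, expect_const_mul, expect_uniform_card_mul, ← stepOp_apply]
  have e3 : (fun s => (1 - (γ : ℝ)) * stepOp M x g s) = (1 - (γ : ℝ)) • stepOp M x g := rfl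
  rw [e3, map_smul, ← startExp_eq_expect, map_smul, smul_eq_mul]
  ring

theorem expect_hSampler [Nonempty A] (u v : S → A → ℝ) :
    (γ : ℝ) * expect (hSampler M γ μ π) (fun h => h.pairing M γ u v) =
      (1 - (γ : ℝ)) ^ 2 * hessian M γ μ π.1 u v := by
  have hb : ∀ x y : S → A → ℝ, ∀ h : HSample S A, |x h.state₁ h.action₁ * y h.state₂ h.action₂ *
      ((Fintype.card A : ℝ) ^ 2 * (M.r h.endState h.endAction / (1 - (γ : ℝ))))| ≤
      ‖x‖ * ‖y‖ * ((Fintype.card A : ℝ) ^ 2 * (1 / (1 - (γ : ℝ)))) := fun x y h => by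
    rw [abs_mul, abs_mul, abs_mul, abs_pow, Nat.abs_cast]
    gcongr
    · exact abs_apply_le_norm x _ _
    · exact abs_apply_le_norm y _ _
    · exact abs_reward_div_le M γ _ _
  simp only [HSample.pairing, add_mul]
  rw [expect_add _ (hb v u) (hb u v), expect_hSampler_mul, expect_hSampler_mul, hessian, map_add,
    map_add]
  ring

/-- Series and integral may be exchanged because the mixed law has total mass one, so the absolute
integrals sum to at most `B`. -/
theorem expect_hSamplerMixed [Nonempty A] (π' : Policy S A) {f : HSample S A → ℝ} {B : ℝ}
    (hf : ∀ h, |f h| ≤ B) :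
    expect (hSamplerMixed M γ μ π π') f =
      ∫ b : unitInterval, expect (hSampler M γ μ (mix b π π')) f := by
  have hm := measurable_hSampler_mix M γ μ π π'
  have h1 : ∀ h, (hSamplerMixed M γ μ π π' h).toReal * f h =
      ∫ b : unitInterval, (hSampler M γ μ (mix b π π') h).toReal * f h := fun h => by
    rw [MeasureTheory.integral_mul_const, MeasureTheory.integral_toReal (hm h).aemeasurable
      (Filter.Eventually.of_forall fun b => (PMF.apply_lt_top _ h))]
    rfl
  simp only [expect, h1]
  refine (MeasureTheory.integral_tsum
    (fun h => ((hm h).ennreal_toReal.mul_const _).aestronglyMeasurable) ?_).symm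
  have h2 : ∀ h, ∫⁻ b : unitInterval, ‖(hSampler M γ μ (mix b π π') h).toReal * f h‖ₑ ≤
      (hSamplerMixed M γ μ π π' h) * ENNReal.ofReal B := fun h => by
    have e : (hSamplerMixed M γ μ π π' h) =
      ∫⁻ b : unitInterval, hSampler M γ μ (mix b π π') h := rfl
    rw [e, ← MeasureTheory.lintegral_mul_const _ (hm h)]
    refine MeasureTheory.lintegral_mono fun b => ?_
    rw [enorm_mul, Real.enorm_eq_ofReal ENNReal.toReal_nonneg,
      ENNReal.ofReal_toReal (PMF.apply_ne_top _ _), Real.enorm_eq_ofReal_abs]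
    gcongr
    exact hf h
  refine ne_top_of_le_ne_top ?_ (ENNReal.tsum_le_tsum h2)
  rw [ENNReal.tsum_mul_right, PMF.tsum_coe, one_mul]
  exact ENNReal.ofReal_ne_top

theorem expect_hSamplerMixed_pairing [Nonempty A] (π' : Policy S A) (v : S → A → ℝ) :
    (γ : ℝ) * expect (hSamplerMixed M γ μ π π') (fun h => h.pairing M γ (π.1 - π'.1) v) =
      (1 - (γ : ℝ)) ^ 2 * (gradient M γ μ π.1 v - gradient M γ μ π'.1 v) := by
  rw [expect_hSamplerMixed M γ μ π π' fun h => h.abs_pairing_le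
    (abs_apply_le_norm (π.1 - π'.1)) (abs_apply_le_norm v),
    gradient_sub_gradient, ← MeasureTheory.integral_const_mul, ← MeasureTheory.integral_const_mul]
  simp only [expect_hSampler]

end Samplers

/-! ### The gradient estimates encoded by the datasets -/

section Algorithm

variable {S A : Type*} [Fintype S] [Fintype A]

/-- The linear functional encoded by a dataset. -/
def pairData (D : Dataset S A) (v : S → A → ℝ) : ℝ := (D.map fun x => ∑ a, x.2 a * v x.1 a).sum

/-- The sum of the norms of the loss vectors of a dataset. -/
def lossNorm (D : Dataset S A) : ℝ := (D.map fun x => ‖x.2‖).sum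

omit [Fintype S] in
theorem empiricalLoss_eq (D : Dataset S A) (π : Policy S A) :
    empiricalLoss D π = pairData D π.1 := rfl

omit [Fintype S] in
theorem pairData_combine (D : Dataset S A) (a b : ℝ) (u v : S → A → ℝ) :
    pairData D (a • u + b • v) = a * pairData D u + b * pairData D v := by
  induction D with
  | nil => simp [pairData]
  | cons x D ih =>
    simp only [pairData, List.map_cons, List.sum_cons] at ih ⊢
    rw [ih]
    simp only [Pi.add_apply, Pi.smul_apply, smul_eq_mul, mul_add, Finset.sum_add_distrib,
      Finset.mul_sum, mul_left_comm]
    ring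

theorem abs_pairData_le (D : Dataset S A) (v : S → A → ℝ) :
    |pairData D v| ≤ lossNorm D * normInfOne v := by
  induction D with
  | nil => simp [pairData, lossNorm]
  | cons x D ih =>
    simp only [pairData, lossNorm, List.map_cons, List.sum_cons] at ih ⊢
    rw [add_mul]
    refine (abs_add_le _ _).trans (add_le_add ?_ ih)
    calc |∑ a, x.2 a * v x.1 a| ≤ ∑ a, |x.2 a * v x.1 a| := Finset.abs_sum_le_sum_abs _ _
      _ ≤ ∑ a, ‖x.2‖ * |v x.1 a| := Finset.sum_le_sum fun a _ => by
          rw [abs_mul]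
          exact mul_le_mul_of_nonneg_right (norm_le_pi_norm x.2 a) (abs_nonneg _)
      _ = ‖x.2‖ * ∑ a, |v x.1 a| := (Finset.mul_sum _ _ _).symm
      _ ≤ _ := mul_le_mul_of_nonneg_left (sum_abs_le_normInfOne v _) (norm_nonneg _)

variable (M : MDP S A) (γ : Set.Ico (0 : ℝ) 1) (lam : ℝ)

omit [Fintype S] in
theorem QSample.sum_estimate_mul (q : QSample S A) (f : A → ℝ) :
    ∑ a, q.estimate M γ a * f a =
      f q.action * (Fintype.card A * (M.r q.endState q.endAction / (1 - (γ : ℝ)))) := by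
  classical
  rw [Finset.sum_eq_single q.action (fun a _ ha => by simp [QSample.estimate, ha]) (by simp)]
  simp only [QSample.estimate, if_true]
  ring

omit [Fintype S] in
theorem HSample.sum_estimate_mul_right (h : HSample S A) (f : A → ℝ) (a₁ : A)
    [Decidable (a₁ = h.action₁)] :
    ∑ a₂, h.estimate M γ a₁ a₂ * f a₂ = if a₁ = h.action₁ then f h.action₂ *
      ((Fintype.card A : ℝ) ^ 2 * (M.r h.endState h.endAction / (1 - (γ : ℝ)))) else 0 := by
  classical
  rw [Finset.sum_eq_single h.action₂ (fun a _ ha => by simp [HSample.estimate, ha]) (by simp)]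
  by_cases h1 : a₁ = h.action₁
  · simp only [HSample.estimate, h1, true_and, if_true]; ring
  · simp [HSample.estimate, h1]

omit [Fintype S] in
theorem HSample.sum_estimate_mul_left (h : HSample S A) (f : A → ℝ) (a₂ : A)
    [Decidable (a₂ = h.action₂)] :
    ∑ a₁, h.estimate M γ a₁ a₂ * f a₁ = if a₂ = h.action₂ then f h.action₁ *
      ((Fintype.card A : ℝ) ^ 2 * (M.r h.endState h.endAction / (1 - (γ : ℝ)))) else 0 := by
  classical
  rw [Finset.sum_eq_single h.action₁ (fun a _ ha => by simp [HSample.estimate, ha]) (by simp)]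
  by_cases h1 : a₂ = h.action₂
  · simp only [HSample.estimate, h1, and_true, if_true]; ring
  · simp [HSample.estimate, h1]

/-- The gradient estimate made from the samples of one iteration. -/
def increment (st : State S A) (o : Sample S A) (v : S → A → ℝ) : ℝ :=
  lam / (1 - (γ : ℝ)) * o.1.pairing M γ v +
    (γ : ℝ) * (1 - lam) / (1 - (γ : ℝ)) ^ 2 * o.2.pairing M γ (st.cur.1 - st.prev.1) v

-- The momentum recursion: the two H-entries of the dataset add up to the symmetrized pairing, since
-- either may carry the test direction.
omit [Fintype S] in
theorem pairData_newData (st : State S A) (o : Sample S A) (v : S → A → ℝ) :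
    pairData (newData M γ lam st o) v =
      (1 - lam) * pairData st.data v + increment M γ lam st o v := by
  classical
  have h1 : ∀ D : Dataset S A, pairData (D.map fun x => (x.1, (1 - lam) • x.2)) v =
      (1 - lam) * pairData D v := fun D => by
    induction D with
    | nil => simp [pairData]
    | cons x D ih =>
      simp only [pairData, List.map_cons, List.sum_cons] at ih ⊢
      rw [ih]
      simp only [Pi.smul_apply, smul_eq_mul, mul_assoc, ← Finset.mul_sum]
      ring
  have h2 : ∀ D D' : Dataset S A, pairData (D ++ D') v = pairData D v + pairData D' v :=
    fun D D' => by simp [pairData]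
  rw [newData, h2, h1]
  congr 1
  simp only [pairData, List.map_cons, List.map_nil, List.sum_cons, List.sum_nil, Pi.smul_apply,
    smul_eq_mul, mul_assoc, ← Finset.mul_sum, QSample.sum_estimate_mul]
  simp only [HSample.sum_estimate_mul_right M γ o.2
      (fun a => st.cur.1 o.2.state₂ a - st.prev.1 o.2.state₂ a),
    HSample.sum_estimate_mul_left M γ o.2
      (fun a => st.cur.1 o.2.state₁ a - st.prev.1 o.2.state₁ a),
    ite_mul, zero_mul, Finset.sum_ite_eq', Finset.mem_univ, if_true]
  simp only [increment, QSample.pairing, HSample.pairing, Pi.sub_apply]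
  ring

omit [Fintype S] in
theorem lossNorm_newData_le {η : ℝ} (hl : lam ∈ Set.Icc (0 : ℝ) 1) (st : State S A)
    (hst : ∀ s a, |st.cur.1 s a - st.prev.1 s a| ≤ η) (o : Sample S A) :
    lossNorm (newData M γ lam st o) ≤ (1 - lam) * lossNorm st.data +
      (lam * (Fintype.card A / (1 - (γ : ℝ)) ^ 2) +
        2 * ((γ : ℝ) * η * (Fintype.card A : ℝ) ^ 2 / (1 - (γ : ℝ)) ^ 3)) := by
  classical
  have h0 : 0 < 1 - (γ : ℝ) := sub_pos.2 γ.2.2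
  have hγ := γ.2.1
  have h1 : ∀ D : Dataset S A, lossNorm (D.map fun x => (x.1, (1 - lam) • x.2)) =
      (1 - lam) * lossNorm D := fun D => by
    induction D with
    | nil => simp [lossNorm]
    | cons x D ih =>
      simp only [lossNorm, List.map_cons, List.sum_cons] at ih ⊢
      rw [ih, norm_smul, Real.norm_eq_abs, abs_of_nonneg (sub_nonneg.2 hl.2)]
      ring
  have h2 : ∀ D D' : Dataset S A, lossNorm (D ++ D') = lossNorm D + lossNorm D' :=
    fun D D' => by simp [lossNorm]
  have hη : 0 ≤ η := (abs_nonneg _).trans (hst o.2.state₁ o.2.action₁)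
  have hl1 : 0 ≤ 1 - lam := sub_nonneg.2 hl.2
  rw [newData, h2, h1]
  have hc : (γ : ℝ) * (1 - lam) / (1 - (γ : ℝ)) ^ 2 ≤ (γ : ℝ) / (1 - (γ : ℝ)) ^ 2 := by
    gcongr
    exact mul_le_of_le_one_right hγ (by linarith [hl.1])
  have hc0 : 0 ≤ (γ : ℝ) * (1 - lam) / (1 - (γ : ℝ)) ^ 2 := by positivity
  have hH : ∀ x y : ℝ, |x| ≤ η → |(γ : ℝ) * (1 - lam) / (1 - (γ : ℝ)) ^ 2 *
      (x * ((Fintype.card A : ℝ) ^ 2 * (M.r o.2.endState o.2.endAction / (1 - (γ : ℝ)))))| ≤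
      (γ : ℝ) * η * (Fintype.card A : ℝ) ^ 2 / (1 - (γ : ℝ)) ^ 3 := fun x y hx => by
    rw [abs_mul, abs_mul, abs_mul, abs_pow, Nat.abs_cast, abs_of_nonneg hc0]
    calc _ ≤ (γ : ℝ) / (1 - (γ : ℝ)) ^ 2 *
          (η * ((Fintype.card A : ℝ) ^ 2 * (1 / (1 - (γ : ℝ))))) := by
          gcongr
          exact abs_reward_div_le M γ _ _
      _ = _ := by field_simp
  have hH0 : 0 ≤ (γ : ℝ) * η * (Fintype.card A : ℝ) ^ 2 / (1 - (γ : ℝ)) ^ 3 := by positivity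
  have e1 : ‖(lam / (1 - (γ : ℝ))) • o.1.estimate M γ‖ ≤
      lam * (Fintype.card A / (1 - (γ : ℝ)) ^ 2) := by
    have hl0 := hl.1
    refine (pi_norm_le_iff_of_nonneg (by positivity)).2 fun a => ?_
    rw [Pi.smul_apply, smul_eq_mul, QSample.estimate, Real.norm_eq_abs, abs_mul,
      abs_of_nonneg (div_nonneg hl0 h0.le)]
    split_ifs
    · rw [abs_mul, Nat.abs_cast]
      calc _ ≤ lam / (1 - (γ : ℝ)) * (Fintype.card A * (1 / (1 - (γ : ℝ)))) := by
            gcongr; exact abs_reward_div_le M γ _ _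
        _ = _ := by field_simp
    · rw [abs_zero, mul_zero]; positivity
  have e2 : ‖fun a₁ => (γ : ℝ) * (1 - lam) / (1 - (γ : ℝ)) ^ 2 * ∑ a₂, o.2.estimate M γ a₁ a₂ *
      (st.cur.1 o.2.state₂ a₂ - st.prev.1 o.2.state₂ a₂)‖ ≤
      (γ : ℝ) * η * (Fintype.card A : ℝ) ^ 2 / (1 - (γ : ℝ)) ^ 3 := by
    refine (pi_norm_le_iff_of_nonneg hH0).2 fun a => ?_
    rw [Real.norm_eq_abs, HSample.sum_estimate_mul_right M γ o.2
      (fun a => st.cur.1 o.2.state₂ a - st.prev.1 o.2.state₂ a)]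
    split_ifs
    · exact hH _ 0 (hst _ _)
    · rwa [mul_zero, abs_zero]
  have e3 : ‖fun a₂ => (γ : ℝ) * (1 - lam) / (1 - (γ : ℝ)) ^ 2 * ∑ a₁, o.2.estimate M γ a₁ a₂ *
      (st.cur.1 o.2.state₁ a₁ - st.prev.1 o.2.state₁ a₁)‖ ≤
      (γ : ℝ) * η * (Fintype.card A : ℝ) ^ 2 / (1 - (γ : ℝ)) ^ 3 := by
    refine (pi_norm_le_iff_of_nonneg hH0).2 fun a => ?_
    rw [Real.norm_eq_abs, HSample.sum_estimate_mul_left M γ o.2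
      (fun a => st.cur.1 o.2.state₁ a - st.prev.1 o.2.state₁ a)]
    split_ifs
    · exact hH _ 0 (hst _ _)
    · rwa [mul_zero, abs_zero]
  have e4 : ∀ x y z : S × (A → ℝ), lossNorm [x, y, z] = ‖x.2‖ + (‖y.2‖ + ‖z.2‖) := fun x y z => by
    simp [lossNorm]
  rw [e4]
  dsimp only
  linarith

/-! ### The states of the algorithm -/

variable (μ : PMF S) (η : unitInterval) (erm : Dataset S A → Policy S A) (π₁ : Policy S A)

omit [Fintype S] in
theorem stateAfter_t (h : List (Sample S A)) :
    (stateAfter M γ η lam erm π₁ h).t = h.length + 1 := by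
  induction h with
  | nil => rfl
  | cons o h ih => rw [stateAfter, update, List.length_cons, ih]

omit [Fintype S] in
theorem mix_apply (b : unitInterval) (π π' : Policy S A) :
    (mix b π π').1 = (1 - (b : ℝ)) • π.1 + (b : ℝ) • π'.1 := rfl

omit [Fintype S] in
theorem abs_policy_sub_le (π π' : Policy S A) (s : S) (a : A) : |π.1 s a - π'.1 s a| ≤ 1 := by
  have h1 := mem_Icc_of_mem_stdSimplex (π.2 s) a
  have h2 := mem_Icc_of_mem_stdSimplex (π'.2 s) a
  exact abs_le.2 ⟨by linarith [h1.1, h2.2], by linarith [h1.2, h2.1]⟩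

omit [Fintype S] in
theorem abs_policy_le (π : Policy S A) (s : S) (a : A) : |π.1 s a| ≤ 1 := by
  have h1 := mem_Icc_of_mem_stdSimplex (π.2 s) a
  exact abs_le.2 ⟨by linarith [h1.1], h1.2⟩

omit [Fintype S] in
theorem normInfOne_sub_le (π π' : Policy S A) : normInfOne (π.1 - π'.1) ≤ 2 :=
  normInfOne_le zero_le_two fun s => by
    calc ∑ a, |(π.1 - π'.1) s a| ≤ ∑ a, (π.1 s a + π'.1 s a) :=
          Finset.sum_le_sum fun a _ => by
            rw [Pi.sub_apply, Pi.sub_apply]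
            exact (abs_sub _ _).trans
              (by rw [abs_of_nonneg ((π.2 s).1 a), abs_of_nonneg ((π'.2 s).1 a)])
      _ = 2 := by rw [Finset.sum_add_distrib, (π.2 s).2, (π'.2 s).2]; norm_num

omit [Fintype S] in
theorem abs_cur_sub_prev_le (h : List (Sample S A)) (s : S) (a : A) :
    |(stateAfter M γ η lam erm π₁ h).cur.1 s a - (stateAfter M γ η lam erm π₁ h).prev.1 s a| ≤
      (η : ℝ) := by
  cases h with
  | nil => simpa [stateAfter, initialState] using η.2.1
  | cons o h =>
    simp only [stateAfter, update, mix, Pi.add_apply, Pi.smul_apply, smul_eq_mul]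
    set π := (stateAfter M γ η lam erm π₁ h).cur
    set π' := erm (newData M γ lam (stateAfter M γ η lam erm π₁ h) o)
    have e : (1 - (η : ℝ)) * π.1 s a + η * π'.1 s a - π.1 s a = η * (π'.1 s a - π.1 s a) := by ring
    rw [e, abs_mul, abs_of_nonneg η.2.1]
    exact mul_le_of_le_one_right η.2.1 (abs_policy_sub_le π' π s a)

-- The iterates are convex combinations of class members and need not lie in the class; linear
-- functionals still satisfy on them every bound that holds on the class. Thus a cover of the class
-- suffices.
omit [Fintype S] in
theorem abs_cur_le {Pol : Set (Policy S A)} (herm : ∀ D, erm D ∈ Pol) (hπ₁ : π₁ ∈ Pol)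
    {f : (S → A → ℝ) → ℝ} (hf : ∀ (a b : ℝ) u v, f (a • u + b • v) = a * f u + b * f v) {B : ℝ}
    (hB : ∀ π ∈ Pol, |f π.1| ≤ B) (h : List (Sample S A)) :
    |f (stateAfter M γ η lam erm π₁ h).cur.1| ≤ B := by
  induction h with
  | nil => exact hB _ hπ₁
  | cons o h ih =>
    rw [stateAfter, update]
    dsimp only
    rw [mix_apply, hf]
    have h1 := hB _ (herm (newData M γ lam (stateAfter M γ η lam erm π₁ h) o))
    have e0 := η.2.1
    have e1 : 0 ≤ 1 - (η : ℝ) := sub_nonneg.2 η.2.2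
    refine (abs_add_le _ _).trans ?_
    rw [abs_mul, abs_mul, abs_of_nonneg e0, abs_of_nonneg e1]
    have h2 := mul_le_mul_of_nonneg_left ih e1
    have h3 := mul_le_mul_of_nonneg_left h1 e0
    linarith

-- The bound is invariant under `w ↦ (1 - λ) w + λ (1 + 1/4 + 1/4) A / (1 - γ)²`. The step size
-- condition makes each of the two H-entries at most a quarter of the Q-entry's bound.
omit [Fintype S] in
theorem lossNorm_data_le (hl : lam ∈ Set.Icc (0 : ℝ) 1)
    (hm : 4 * (γ : ℝ) * Fintype.card A * η ≤ lam * (1 - (γ : ℝ))) (h : List (Sample S A)) :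
    lossNorm (stateAfter M γ η lam erm π₁ h).data ≤
      3 / 2 * (Fintype.card A / (1 - (γ : ℝ)) ^ 2) := by
  have h0 : 0 < 1 - (γ : ℝ) := sub_pos.2 γ.2.2
  induction h with
  | nil => simp only [stateAfter, initialState, lossNorm, List.map_nil, List.sum_nil]; positivity
  | cons o h ih =>
    have h1 := lossNorm_newData_le M γ lam hl _ (abs_cur_sub_prev_le M γ lam η erm π₁ h) o
    have h2 : (γ : ℝ) * η * (Fintype.card A : ℝ) ^ 2 / (1 - (γ : ℝ)) ^ 3 ≤
        lam / 4 * (Fintype.card A / (1 - (γ : ℝ)) ^ 2) := by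
      rw [div_le_iff₀ (by positivity)]
      calc (γ : ℝ) * η * (Fintype.card A : ℝ) ^ 2
          = (4 * (γ : ℝ) * Fintype.card A * η) * (Fintype.card A / 4) := by ring
        _ ≤ (lam * (1 - (γ : ℝ))) * (Fintype.card A / 4) := by gcongr
        _ = _ := by field_simp
    have h3 := mul_le_mul_of_nonneg_left ih (sub_nonneg.2 hl.2)
    rw [stateAfter, update]
    dsimp only
    linarith

-- Samples are listed most recent first, so suffixes are earlier histories. Here `k` is the history
-- before iteration `k.length + 1`, and `o` is the sample drawn in it.
omit [Fintype S] in
theorem mem_log_iff (h : List (Sample S A)) (x : ℕ × Policy S A × ℝ) :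
    x ∈ (stateAfter M γ η lam erm π₁ h).log ↔ ∃ o k, (o :: k) <:+ h ∧
      x = (k.length + 1, (stateAfter M γ η lam erm π₁ k).cur,
        empiricalLoss (stateAfter M γ η lam erm π₁ (o :: k)).data
          (erm (stateAfter M γ η lam erm π₁ (o :: k)).data) -
        empiricalLoss (stateAfter M γ η lam erm π₁ (o :: k)).data
          (stateAfter M γ η lam erm π₁ k).cur) := by
  induction h with
  | nil => simp [stateAfter, initialState]
  | cons o h ih =>
    have e : (stateAfter M γ η lam erm π₁ (o :: h)).log =
        (h.length + 1, (stateAfter M γ η lam erm π₁ h).cur,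
        empiricalLoss (stateAfter M γ η lam erm π₁ (o :: h)).data
          (erm (stateAfter M γ η lam erm π₁ (o :: h)).data) -
        empiricalLoss (stateAfter M γ η lam erm π₁ (o :: h)).data
          (stateAfter M γ η lam erm π₁ h).cur) :: (stateAfter M γ η lam erm π₁ h).log := by
      rw [← stateAfter_t M γ lam η erm π₁ h]; rfl
    rw [e, List.mem_cons, ih]
    constructor
    · rintro (rfl | ⟨o', k, hk, rfl⟩)
      · exact ⟨o, h, List.suffix_rfl, rfl⟩
      · exact ⟨o', k, hk.trans (List.suffix_cons o h), rfl⟩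
    · rintro ⟨o', k, hk, rfl⟩
      rcases List.suffix_cons_iff.1 hk with hk | hk
      · obtain ⟨rfl, rfl⟩ := List.cons.inj hk
        exact Or.inl rfl
      · exact Or.inr ⟨o', k, hk, rfl⟩

/-- The last iteration always lies in the window, so the minimum is over a nonempty finite set. -/
theorem exists_isOutput (h : List (Sample S A)) (hT : 1 ≤ h.length) :
    ∃ π, IsOutput h.length (stateAfter M γ η lam erm π₁ h).log π := by
  classical
  set L := (stateAfter M γ η lam erm π₁ h).log
  have hne : (L.toFinset.filter fun x => h.length ≤ 2 * x.1).Nonempty := by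
    cases h with
    | nil => simp at hT
    | cons o h =>
      refine ⟨_, Finset.mem_filter.2 ⟨List.mem_toFinset.2 ((mem_log_iff M γ lam η erm π₁ _ _).2
        ⟨o, h, List.suffix_rfl, rfl⟩), ?_⟩⟩
      simp only [List.length_cons]
      omega
  obtain ⟨x, hx, hmin⟩ := Finset.exists_min_image _ (fun x => x.2.2) hne
  rw [Finset.mem_filter, List.mem_toFinset] at hx
  exact ⟨x.2.1, x, hx.1, rfl, hx.2, fun y hy hy' =>
    hmin y (Finset.mem_filter.2 ⟨List.mem_toFinset.2 hy, hy'⟩)⟩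

/-! ### Gradient error and the ascent argument -/

/-- The error of the gradient estimate encoded by the current dataset. -/
def gradError (h : List (Sample S A)) (v : S → A → ℝ) : ℝ :=
  pairData (stateAfter M γ η lam erm π₁ h).data v -
    gradient M γ μ (stateAfter M γ η lam erm π₁ h).prev.1 v

theorem gradError_combine (h : List (Sample S A)) (a b : ℝ) (u v : S → A → ℝ) :
    gradError M γ lam μ η erm π₁ h (a • u + b • v) =
      a * gradError M γ lam μ η erm π₁ h u + b * gradError M γ lam μ η erm π₁ h v := by
  simp only [gradError, pairData_combine, gradient_add, gradient_smul]
  ring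

/-- Outputs of a run whose gradient errors are uniformly small are almost locally optimal. -/
theorem gradient_output_le {Pol : Set (Policy S A)} {tol ε B W : ℝ} (htol : 0 ≤ tol)
    (herm : IsERMOracle Pol tol erm) (hπ₁ : π₁ ∈ Pol) (hη : 0 < (η : ℝ))
    (hstep : 40 * (γ : ℝ) * η ≤ ε * (1 - (γ : ℝ)) ^ 3) (h : List (Sample S A))
    (hT : 1 ≤ h.length)
    (hW : ∀ k, lossNorm (stateAfter M γ η lam erm π₁ k).data ≤ W)
    (hB : ∀ k, k <:+ h → h.length ≤ 2 * k.length → ∀ π ∈ Pol,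
      |gradError M γ lam μ η erm π₁ k π.1| ≤ B)
    {π : Policy S A} (hπ : IsOutput h.length (stateAfter M γ η lam erm π₁ h).log π)
    {π' : Policy S A} (hπ' : π' ∈ Pol) :
    gradient M γ μ π.1 (π'.1 - π.1) ≤
      2 / ((1 - (γ : ℝ)) * (η * h.length)) + ε / 10 + 4 * B + tol * W := by
  have h0 : 0 < 1 - (γ : ℝ) := sub_pos.2 γ.2.2
  obtain ⟨x, hx, rfl, hxT, hmin⟩ := hπ
  obtain ⟨o, k, hk, rfl⟩ := (mem_log_iff M γ lam η erm π₁ h x).1 hx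
  dsimp only at hxT hmin ⊢
  set st := stateAfter M γ η lam erm π₁ with hst
  set gap : Sample S A → List (Sample S A) → ℝ := fun o k =>
    empiricalLoss (st (o :: k)).data (erm (st (o :: k)).data) -
      empiricalLoss (st (o :: k)).data (st k).cur with hgap
  have hpol : ∀ D, erm D ∈ Pol := fun D => (herm D).1
  -- Empirical and true gaps differ by one error at `σ` and one at the current iterate, each at most
  -- `B`.
  have hsplit : ∀ o k (σ : Policy S A), σ ∈ Pol → (o :: k) <:+ h →
      h.length ≤ 2 * (k.length + 1) →
      |empiricalLoss (st (o :: k)).data σ - empiricalLoss (st (o :: k)).data (st k).cur -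
        gradient M γ μ (st k).cur.1 (σ.1 - (st k).cur.1)| ≤ 2 * B := by
    intro o k σ hσ hk hkT
    have e1 := hB (o :: k) hk (by simpa using hkT) σ hσ
    have e2 := abs_cur_le M γ lam η erm π₁ hpol hπ₁ (gradError_combine M γ lam μ η erm π₁ (o :: k))
      (hB (o :: k) hk (by simpa using hkT)) k
    have e3 : ∀ v, gradError M γ lam μ η erm π₁ (o :: k) v =
        pairData (st (o :: k)).data v - gradient M γ μ (st k).cur.1 v := fun v => rfl
    rw [e3] at e1 e2
    rw [empiricalLoss_eq, empiricalLoss_eq, gradient_sub]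
    obtain ⟨e1, e1'⟩ := abs_le.1 e1
    obtain ⟨e2, e2'⟩ := abs_le.1 e2
    exact abs_le.2 ⟨by linarith, by linarith⟩
  -- The output minimizes the recorded gap, so every step of the window ascends at least as steeply,
  -- up to `2 B`.
  have hlow : ∀ o' k', (o' :: k') <:+ h → h.length ≤ 2 * (k'.length + 1) →
      gap o k - 2 * B ≤ gradient M γ μ (st k').cur.1
        ((erm (st (o' :: k')).data).1 - (st k').cur.1) := by
    intro o' k' hk' hkT'
    have e1 := hmin _ ((mem_log_iff M γ lam η erm π₁ h _).2 ⟨o', k', hk', rfl⟩) hkT'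
    have e2 := (abs_le.1 (hsplit o' k' (erm (st (o' :: k')).data) (hpol _) hk' hkT')).2
    linarith
  set c := gap o k - 2 * B - ε / 10 with hc
  have hgain : ∀ o' k', (o' :: k') <:+ h → h.length ≤ 2 * (k'.length + 1) →
      value M γ μ (st k').cur.1 + η * c ≤ value M γ μ (st (o' :: k')).cur.1 := by
    intro o' k' hk' hkT'
    have e1 := hlow o' k' hk' hkT'
    set σ := erm (st (o' :: k')).data with hσ
    have e2 : (st (o' :: k')).cur = mix η (st k').cur σ := rfl
    have e3 : (mix η (st k').cur σ).1 - (st k').cur.1 = (η : ℝ) • (σ.1 - (st k').cur.1) := by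
      rw [mix_apply, sub_smul, one_smul, smul_sub]; abel
    have e4 := value_ge M γ μ (st k').cur (mix η (st k').cur σ)
    have e5 : normInfOne ((η : ℝ) • (σ.1 - (st k').cur.1)) ≤ 2 * η := by
      refine normInfOne_le (by positivity) fun s => ?_
      have := (sum_abs_le_normInfOne (σ.1 - (st k').cur.1) s).trans (normInfOne_sub_le _ _)
      simp only [Pi.smul_apply, smul_eq_mul, abs_mul, ← Finset.mul_sum, abs_of_pos hη]
      rw [mul_comm]
      exact mul_le_mul_of_nonneg_right this hη.le
    rw [e3, gradient_smul] at e4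
    -- The step size condition makes the second-order loss at most a tenth of `η ε`; this is the `ε
    -- / 10` subtracted in `c`.
    have e6 : (γ : ℝ) * normInfOne ((η : ℝ) • (σ.1 - (st k').cur.1)) ^ 2 / (1 - (γ : ℝ)) ^ 3 ≤
        η * (ε / 10) := by
      rw [div_le_iff₀ (by positivity)]
      calc (γ : ℝ) * normInfOne ((η : ℝ) • (σ.1 - (st k').cur.1)) ^ 2
          ≤ γ * (2 * η) ^ 2 := by
            have := γ.2.1
            have := normInfOne_nonneg ((η : ℝ) • (σ.1 - (st k').cur.1))
            gcongr
        _ = η / 10 * (40 * (γ : ℝ) * η) := by ring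
        _ ≤ η / 10 * (ε * (1 - (γ : ℝ)) ^ 3) := by gcongr
        _ = _ := by ring
    have e7 := mul_le_mul_of_nonneg_left e1 hη.le
    rw [e2]
    have e8 : (η : ℝ) * c = η * (gap o k - 2 * B) - η * (ε / 10) := by rw [hc]; ring
    linarith
  have hc_le : c ≤ 2 / ((1 - (γ : ℝ)) * (η * h.length)) := by
    rcases le_or_gt c 0 with hc0 | hc0
    · exact hc0.trans (by positivity)
    -- Telescoping over the window. With offset `(T - 1) / 2` the left side is nonpositive before
    -- the window, where nonnegativity of the value suffices; at the end `(T + 1) / 2` gains have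
    -- accumulated.
    have key : ∀ k', k' <:+ h →
        ((k'.length : ℝ) - ((h.length : ℝ) - 1) / 2) * (η * c) ≤ value M γ μ (st k').cur.1 := by
      intro k'
      have hneg : ∀ l : List (Sample S A), 2 * l.length < h.length →
          ((l.length : ℝ) - ((h.length : ℝ) - 1) / 2) * (η * c) ≤ value M γ μ (st l).cur.1 := by
        intro l hl
        refine le_trans (mul_nonpos_of_nonpos_of_nonneg ?_ (by positivity))
          (value_nonneg M γ μ _)
        have : (2 * l.length + 1 : ℝ) ≤ h.length := by exact_mod_cast hl
        linarith
      induction k' with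
      | nil => exact fun _ => hneg [] (by simp only [List.length_nil]; omega)
      | cons o' k' ih =>
        intro hk'
        rcases lt_or_ge (2 * (o' :: k').length) h.length with hlt | hge
        · exact hneg _ hlt
        · have e1 := hgain o' k' hk' hge
          have e2 := ih ((List.suffix_cons o' k').trans hk')
          simp only [List.length_cons, Nat.cast_add, Nat.cast_one]
          linarith
    have e1 := (key h List.suffix_rfl).trans (value_le M γ μ _)
    have hTpos : (0 : ℝ) < h.length := by exact_mod_cast hT
    rw [le_div_iff₀ (by positivity)]
    rw [le_div_iff₀ h0] at e1
    have e2 : 0 ≤ η * c * (1 - (γ : ℝ)) := by positivity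
    nlinarith
  -- The comparator's empirical gap exceeds the recorded one by at most the oracle error; passing
  -- back to the true gradient costs another `2 B`.
  have e1 := (abs_le.1 (hsplit o k π' hπ' hk hxT)).1
  have e2 := (herm (st (o :: k)).data).2 π' hπ'
  have e3 : tol * lossNorm (st (o :: k)).data ≤ tol * W :=
    mul_le_mul_of_nonneg_left (hW _) htol
  have e4 : gap o k = empiricalLoss (st (o :: k)).data (erm (st (o :: k)).data) -
      empiricalLoss (st (o :: k)).data (st k).cur := rfl
  rw [lossNorm] at e3
  linarith

end Algorithm

/-! ### Concentration of the gradient errors -/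

section Concentration

variable {S A : Type*} [Fintype S] [Fintype A] [Nonempty A]

theorem lexpect_finset_sum {ι α : Type*} (s : Finset ι) (p : PMF α) (f : ι → α → ℝ≥0∞) :
    lexpect p (fun a => ∑ i ∈ s, f i a) = ∑ i ∈ s, lexpect p (f i) := by
  simp only [lexpect, Finset.mul_sum]
  exact Summable.tsum_finsetSum fun _ _ => ENNReal.summable

/-- The joint law of the samples drawn in one iteration. -/
def stepLaw (M : MDP S A) (γ : Set.Ico (0 : ℝ) 1) (μ : PMF S) (st : State S A) :
    PMF (Sample S A) :=
  (qSampler M γ μ st.cur).bind fun q =>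
    (hSamplerMixed M γ μ st.cur st.prev).bind fun x => PMF.pure (q, x)

variable (M : MDP S A) (γ : Set.Ico (0 : ℝ) 1) (lam : ℝ) (μ : PMF S) (η : unitInterval)
  (erm : Dataset S A → Policy S A) (π₁ : Policy S A)

theorem lexpect_runLaw_succ (T : ℕ) (f : List (Sample S A) → ℝ≥0∞) :
    lexpect (runLaw M γ μ η lam erm π₁ (T + 1)) f =
      lexpect (runLaw M γ μ η lam erm π₁ T) fun h =>
        lexpect (stepLaw M γ μ (stateAfter M γ η lam erm π₁ h)) fun o => f (o :: h) := by
  simp only [runLaw, stepLaw, lexpect_bind, lexpect_pure]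

theorem length_of_mem_support {T : ℕ} {h : List (Sample S A)}
    (hh : h ∈ (runLaw M γ μ η lam erm π₁ T).support) : h.length = T := by
  induction T generalizing h with
  | zero =>
    rw [runLaw, PMF.mem_support_pure_iff] at hh
    rw [hh, List.length_nil]
  | succ T ih =>
    simp only [runLaw, PMF.mem_support_bind_iff, PMF.mem_support_pure_iff] at hh
    obtain ⟨k, hk, q, -, x, -, rfl⟩ := hh
    rw [List.length_cons, ih hk]

-- The Q-part contributes one unit `λ A / (1 - γ)²`, the H-part half a unit by the step size
-- condition.
omit [Fintype S] in
theorem abs_increment_le {lam : ℝ} (hl : lam ∈ Set.Icc (0 : ℝ) 1)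
    (hm : 4 * (γ : ℝ) * Fintype.card A * η ≤ lam * (1 - (γ : ℝ))) (st : State S A)
    (hst : ∀ s a, |st.cur.1 s a - st.prev.1 s a| ≤ η) (o : Sample S A) {v : S → A → ℝ}
    (hv : ∀ s a, |v s a| ≤ 1) :
    |increment M γ lam st o v| ≤ 3 / 2 * (lam * Fintype.card A / (1 - (γ : ℝ)) ^ 2) := by
  have h0 : 0 < 1 - (γ : ℝ) := sub_pos.2 γ.2.2
  have hγ := γ.2.1
  have hl0 := hl.1
  have hl1 : 0 ≤ 1 - lam := sub_nonneg.2 hl.2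
  have e1 := o.1.abs_pairing_le (M := M) (γ := γ) hv
  have e2 := o.2.abs_pairing_le (M := M) (γ := γ) (u := st.cur.1 - st.prev.1) hst hv
  have e3 : (γ : ℝ) * (1 - lam) / (1 - (γ : ℝ)) ^ 2 ≤ (γ : ℝ) / (1 - (γ : ℝ)) ^ 2 := by
    gcongr
    exact mul_le_of_le_one_right hγ (by linarith)
  rw [increment]
  refine (abs_add_le _ _).trans ?_
  rw [abs_mul, abs_mul, abs_of_nonneg (div_nonneg hl0 h0.le),
    abs_of_nonneg (div_nonneg (mul_nonneg hγ hl1) (pow_nonneg h0.le 2))]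
  have e4 := mul_le_mul_of_nonneg_left e1 (div_nonneg hl0 h0.le)
  have e5 := mul_le_mul e3 e2 (abs_nonneg _) (by positivity)
  have e6 : (γ : ℝ) / (1 - (γ : ℝ)) ^ 2 *
      (2 * η * 1 * ((Fintype.card A : ℝ) ^ 2 * (1 / (1 - (γ : ℝ))))) ≤
      1 / 2 * (lam * Fintype.card A / (1 - (γ : ℝ)) ^ 2) := by
    calc _ = (4 * (γ : ℝ) * Fintype.card A * η) * (Fintype.card A / (2 * (1 - (γ : ℝ)) ^ 3)) := by
          field_simp; ring
      _ ≤ (lam * (1 - (γ : ℝ))) * (Fintype.card A / (2 * (1 - (γ : ℝ)) ^ 3)) := by gcongr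
      _ = _ := by field_simp
  have e7 : lam / (1 - (γ : ℝ)) * (1 * (Fintype.card A * (1 / (1 - (γ : ℝ))))) =
      lam * Fintype.card A / (1 - (γ : ℝ)) ^ 2 := by field_simp
  linarith

/-- The conditional mean is exactly what carries `(1 - λ)` times the old gradient to the new one, so
the old error is only damped. -/
theorem expect_increment (st : State S A) (v : S → A → ℝ) :
    expect (stepLaw M γ μ st) (fun o => increment M γ lam st o v) =
      lam * gradient M γ μ st.cur.1 v +
        (1 - lam) * (gradient M γ μ st.cur.1 v - gradient M γ μ st.prev.1 v) := by
  have h0 : 1 - (γ : ℝ) ≠ 0 := (sub_pos.2 γ.2.2).ne'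
  have hq := fun q : QSample S A => q.abs_pairing_le (M := M) (γ := γ) (abs_apply_le_norm v)
  have hx := fun x : HSample S A => x.abs_pairing_le (M := M) (γ := γ)
    (abs_apply_le_norm (st.cur.1 - st.prev.1)) (abs_apply_le_norm v)
  have hmul : ∀ {α : Type _} (c : ℝ) {f : α → ℝ} {B : ℝ}, (∀ a, |f a| ≤ B) →
      ∀ a, |c * f a| ≤ |c| * B := fun c f B hf a => by
    rw [abs_mul]; exact mul_le_mul_of_nonneg_left (hf a) (abs_nonneg c)
  have hadd : ∀ o : Sample S A, |increment M γ lam st o v| ≤ _ := fun o =>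
    (abs_add_le _ _).trans (add_le_add (hmul (lam / (1 - (γ : ℝ))) hq o.1)
      (hmul ((γ : ℝ) * (1 - lam) / (1 - (γ : ℝ)) ^ 2) hx o.2))
  simp only [stepLaw, expect_bind _ _ hadd, expect_pure]
  simp only [increment]
  have e1 : ∀ q : QSample S A, expect (hSamplerMixed M γ μ st.cur st.prev) (fun x =>
      lam / (1 - (γ : ℝ)) * q.pairing M γ v + (γ : ℝ) * (1 - lam) / (1 - (γ : ℝ)) ^ 2 *
        x.pairing M γ (st.cur.1 - st.prev.1) v) = lam / (1 - (γ : ℝ)) * q.pairing M γ v +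
      (1 - lam) * (gradient M γ μ st.cur.1 v - gradient M γ μ st.prev.1 v) := fun q => by
    rw [expect_add _ (fun _ => le_rfl) (hmul _ hx), expect_const, expect_const_mul]
    congr 1
    have := expect_hSamplerMixed_pairing M γ μ st.cur st.prev v
    rw [mul_div_assoc, mul_comm (γ : ℝ), mul_assoc, this]
    field_simp
  simp only [e1]
  rw [expect_add _ (hmul _ hq) (fun _ => le_rfl), expect_const, expect_const_mul, expect_qSampler]
  congr 1
  field_simp

/-- The martingale part of the gradient error. -/
def errorMartingale (h : List (Sample S A)) (v : S → A → ℝ) : ℝ :=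
  gradError M γ lam μ η erm π₁ h v - (1 - lam) ^ h.length * gradError M γ lam μ η erm π₁ [] v

/-- Subtracting `(1 - λ)^t e_0` removes the bias of the empty initial dataset, leaving a damped sum
of centred increments. -/
theorem errorMartingale_cons (o : Sample S A) (h : List (Sample S A)) (v : S → A → ℝ) :
    errorMartingale M γ lam μ η erm π₁ (o :: h) v =
      (1 - lam) * errorMartingale M γ lam μ η erm π₁ h v +
        (increment M γ lam (stateAfter M γ η lam erm π₁ h) o v -
          expect (stepLaw M γ μ (stateAfter M γ η lam erm π₁ h))
            fun o => increment M γ lam (stateAfter M γ η lam erm π₁ h) o v) := by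
  rw [expect_increment]
  have e : gradError M γ lam μ η erm π₁ (o :: h) v =
      pairData (newData M γ lam (stateAfter M γ η lam erm π₁ h) o) v -
        gradient M γ μ (stateAfter M γ η lam erm π₁ h).cur.1 v := rfl
  have e' : gradError M γ lam μ η erm π₁ h v =
      pairData (stateAfter M γ η lam erm π₁ h).data v -
        gradient M γ μ (stateAfter M γ η lam erm π₁ h).prev.1 v := rfl
  rw [errorMartingale, errorMartingale, e, e', pairData_newData, List.length_cons, pow_succ]
  ring

variable {lam}

/-- The variance proxy `σ` is preserved by `σ ↦ c² + (1 - λ)² σ`, up to inequality. The claim is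
made for all `θ`, since the damping replaces `θ` by `θ (1 - λ)` in the induction. -/
theorem lexpect_exp_errorMartingale_le (hl : lam ∈ Set.Icc (0 : ℝ) 1)
    (hm : 4 * (γ : ℝ) * Fintype.card A * η ≤ lam * (1 - (γ : ℝ))) {v : S → A → ℝ}
    (hv : ∀ s a, |v s a| ≤ 1) {σ : ℝ} (hσ0 : 0 ≤ σ)
    (hσ : (3 * (lam * Fintype.card A / (1 - (γ : ℝ)) ^ 2)) ^ 2 + (1 - lam) ^ 2 * σ ≤ σ) (T : ℕ) :
    ∀ θ : ℝ, lexpect (runLaw M γ μ η lam erm π₁ T) (fun h =>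
        ENNReal.ofReal (Real.exp (θ * errorMartingale M γ lam μ η erm π₁ h v))) ≤
      ENNReal.ofReal (Real.exp (θ ^ 2 * σ / 2)) := by
  induction T with
  | zero =>
    intro θ
    rw [runLaw, lexpect_pure]
    refine ENNReal.ofReal_le_ofReal (Real.exp_le_exp.2 ?_)
    simp only [errorMartingale, List.length_nil, pow_zero, one_mul, sub_self, mul_zero]
    positivity
  | succ T ih =>
    intro θ
    rw [lexpect_runLaw_succ]
    set c := 3 * (lam * Fintype.card A / (1 - (γ : ℝ)) ^ 2) with hc
    have h0 : 0 < 1 - (γ : ℝ) := sub_pos.2 γ.2.2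
    have hl0 := hl.1
    have hc0 : 0 ≤ c := by positivity
    have hstep : ∀ h, lexpect (stepLaw M γ μ (stateAfter M γ η lam erm π₁ h)) (fun o =>
        ENNReal.ofReal (Real.exp (θ * errorMartingale M γ lam μ η erm π₁ (o :: h) v))) ≤
        ENNReal.ofReal (Real.exp (θ ^ 2 * c ^ 2 / 2)) * ENNReal.ofReal
          (Real.exp (θ * (1 - lam) * errorMartingale M γ lam μ η erm π₁ h v)) := by
      -- Given the past, the centred increment has range `[-c, c]`, so Hoeffding's lemma applies to
      -- one step.
      intro h
      set st := stateAfter M γ η lam erm π₁ h with hst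
      set m := expect (stepLaw M γ μ st) fun o => increment M γ lam st o v with hm'
      have hb := fun o => abs_increment_le M γ η hl hm st
        (abs_cur_sub_prev_le M γ lam η erm π₁ h) o hv
      have hmb : |m| ≤ _ := abs_expect_le (stepLaw M γ μ st) hb
      have hd : ∀ o, |increment M γ lam st o v - m| ≤ c := fun o => by
        refine (abs_sub _ _).trans ?_
        linarith [hb o]
      have hexp : ∀ o, |Real.exp (θ * (increment M γ lam st o v - m))| ≤ Real.exp (|θ| * c) :=
        fun o => by
          rw [abs_of_pos (Real.exp_pos _)]
          refine Real.exp_le_exp.2 ((le_abs_self _).trans ?_)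
          rw [abs_mul]
          exact mul_le_mul_of_nonneg_left (hd o) (abs_nonneg θ)
      have e1 : ∀ o, ENNReal.ofReal
          (Real.exp (θ * errorMartingale M γ lam μ η erm π₁ (o :: h) v)) =
          ENNReal.ofReal (Real.exp (θ * (1 - lam) * errorMartingale M γ lam μ η erm π₁ h v)) *
            ENNReal.ofReal (Real.exp (θ * (increment M γ lam st o v - m))) := fun o => by
        rw [← ENNReal.ofReal_mul (Real.exp_pos _).le, ← Real.exp_add, errorMartingale_cons]
        congr 2
        ring
      simp only [e1]
      rw [lexpect_const_mul, mul_comm, lexpect_ofReal _ hexp fun o => (Real.exp_pos _).le]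
      refine mul_le_mul_left (ENNReal.ofReal_le_ofReal (expect_exp_le _ hc0 hd ?_ θ)) _
      rw [expect_sub_const _ hb, sub_self]
    refine (lexpect_mono _ hstep).trans ?_
    rw [lexpect_const_mul]
    refine (mul_le_mul_right (ih (θ * (1 - lam))) _).trans ?_
    rw [← ENNReal.ofReal_mul (Real.exp_pos _).le, ← Real.exp_add]
    refine ENNReal.ofReal_le_ofReal (Real.exp_le_exp.2 ?_)
    have := mul_le_mul_of_nonneg_left hσ (sq_nonneg θ)
    nlinarith

/-- Chernoff's bound for both signs, with the optimal exponent `θ = x / σ`. -/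
theorem lexpect_abs_errorMartingale_ge_le (hl : lam ∈ Set.Icc (0 : ℝ) 1)
    (hm : 4 * (γ : ℝ) * Fintype.card A * η ≤ lam * (1 - (γ : ℝ))) {v : S → A → ℝ}
    (hv : ∀ s a, |v s a| ≤ 1) {σ : ℝ} (hσ0 : 0 < σ)
    (hσ : (3 * (lam * Fintype.card A / (1 - (γ : ℝ)) ^ 2)) ^ 2 + (1 - lam) ^ 2 * σ ≤ σ) (T : ℕ)
    {x : ℝ} (hx : 0 ≤ x) :
    lexpect (runLaw M γ μ η lam erm π₁ T)
        ({h | x ≤ |errorMartingale M γ lam μ η erm π₁ h v|}.indicator 1) ≤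
      ENNReal.ofReal (2 * Real.exp (-(x ^ 2 / (2 * σ)))) := by
  set m := fun h => errorMartingale M γ lam μ η erm π₁ h v with hmdef
  set θ := x / σ with hθ
  have hθ0 : 0 ≤ θ := div_nonneg hx hσ0.le
  have hle : ∀ h, ({h | x ≤ |m h|}.indicator 1 h : ℝ≥0∞) ≤
      ENNReal.ofReal (Real.exp (-(θ * x))) * (ENNReal.ofReal (Real.exp (θ * m h)) +
        ENNReal.ofReal (Real.exp (-θ * m h))) := by
    intro h
    by_cases hh : x ≤ |m h|
    · rw [Set.indicator_of_mem (show h ∈ {h | x ≤ |m h|} from hh), Pi.one_apply,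
        ← ENNReal.ofReal_add (Real.exp_pos _).le (Real.exp_pos _).le,
        ← ENNReal.ofReal_mul (Real.exp_pos _).le, mul_add, ← Real.exp_add, ← Real.exp_add,
        ← ENNReal.ofReal_one]
      refine ENNReal.ofReal_le_ofReal ?_
      rcases le_abs.1 hh with h1 | h1
      · have h2 := mul_le_mul_of_nonneg_left h1 hθ0
        have h3 : 1 ≤ Real.exp (-(θ * x) + θ * m h) := Real.one_le_exp (by linarith)
        linarith [Real.exp_pos (-(θ * x) + -θ * m h)]
      · have h2 := mul_le_mul_of_nonneg_left h1 hθ0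
        have h3 : 1 ≤ Real.exp (-(θ * x) + -θ * m h) := Real.one_le_exp (by linarith)
        linarith [Real.exp_pos (-(θ * x) + θ * m h)]
    · rw [Set.indicator_of_notMem (by simpa using hh)]
      exact zero_le
  refine (lexpect_mono _ hle).trans ?_
  rw [lexpect_const_mul, lexpect_add]
  have e1 := lexpect_exp_errorMartingale_le M γ μ η erm π₁ hl hm hv hσ0.le hσ T θ
  have e2 := lexpect_exp_errorMartingale_le M γ μ η erm π₁ hl hm hv hσ0.le hσ T (-θ)
  refine (mul_le_mul_right (add_le_add e1 e2) _).trans ?_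
  rw [neg_sq, ← ENNReal.ofReal_add (Real.exp_pos _).le (Real.exp_pos _).le,
    ← ENNReal.ofReal_mul (Real.exp_pos _).le, ← two_mul, mul_left_comm, ← Real.exp_add]
  refine ENNReal.ofReal_le_ofReal (mul_le_mul_of_nonneg_left (Real.exp_le_exp.2 ?_) zero_le_two)
  rw [hθ]
  refine le_of_eq ?_
  field_simp
  ring

/-- The runs in which the martingale part of the gradient error is large at some time for some
policy in a finite family. -/
def largeDeviation (M : MDP S A) (γ : Set.Ico (0 : ℝ) 1) (lam : ℝ) (μ : PMF S) (η : unitInterval)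
    (erm : Dataset S A → Policy S A) (π₁ : Policy S A) (F : Finset (Policy S A)) (x : ℝ) :
    Set (List (Sample S A)) :=
  {h | ∃ k, k <:+ h ∧ k ≠ [] ∧ ∃ π ∈ F, x ≤ |errorMartingale M γ lam μ η erm π₁ k π.1|}

/-- Union bound over times and policies. A new sample either inherits the failure of its past, whose
probability does not change, or fails at the new time. -/
theorem lexpect_largeDeviation_le (hl : lam ∈ Set.Icc (0 : ℝ) 1)
    (hm : 4 * (γ : ℝ) * Fintype.card A * η ≤ lam * (1 - (γ : ℝ))) {σ : ℝ} (hσ0 : 0 < σ)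
    (hσ : (3 * (lam * Fintype.card A / (1 - (γ : ℝ)) ^ 2)) ^ 2 + (1 - lam) ^ 2 * σ ≤ σ)
    (F : Finset (Policy S A)) {x : ℝ} (hx : 0 ≤ x) (T : ℕ) :
    lexpect (runLaw M γ μ η lam erm π₁ T)
        ((largeDeviation M γ lam μ η erm π₁ F x).indicator 1) ≤
      T * (F.card * ENNReal.ofReal (2 * Real.exp (-(x ^ 2 / (2 * σ))))) := by
  set bad := largeDeviation M γ lam μ η erm π₁ F x with hbad
  induction T with
  | zero =>
    rw [runLaw, lexpect_pure, Set.indicator_of_notMem]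
    · exact zero_le
    · rintro ⟨k, hk, hk', -⟩
      exact hk' (List.suffix_nil.1 hk)
  | succ T ih =>
    set now : Policy S A → Set (List (Sample S A)) :=
      fun π => {h | x ≤ |errorMartingale M γ lam μ η erm π₁ h π.1|} with hnow
    have hle : ∀ h o, (bad.indicator 1 (o :: h) : ℝ≥0∞) ≤
        bad.indicator 1 h + ∑ π ∈ F, (now π).indicator 1 (o :: h) := by
      intro h o
      by_cases hh : o :: h ∈ bad
      · rw [Set.indicator_of_mem hh, Pi.one_apply]
        obtain ⟨k, hk, hk', π, hπ, hπx⟩ := hh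
        rcases List.suffix_cons_iff.1 hk with rfl | hk
        · refine le_add_left (le_trans ?_ (Finset.single_le_sum
            (f := fun π => ((now π).indicator 1 (o :: h) : ℝ≥0∞)) (fun _ _ => zero_le) hπ))
          rw [Set.indicator_of_mem (show o :: h ∈ now π from hπx), Pi.one_apply]
        · refine le_add_right ?_
          rw [Set.indicator_of_mem (show h ∈ bad from ⟨k, hk, hk', π, hπ, hπx⟩), Pi.one_apply]
      · rw [Set.indicator_of_notMem hh]
        exact zero_le
    have e1 : lexpect (runLaw M γ μ η lam erm π₁ (T + 1)) (bad.indicator 1) ≤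
        lexpect (runLaw M γ μ η lam erm π₁ T) (bad.indicator 1) +
          ∑ π ∈ F, lexpect (runLaw M γ μ η lam erm π₁ (T + 1)) ((now π).indicator 1) := by
      simp only [lexpect_runLaw_succ]
      refine (lexpect_mono _ fun h => lexpect_mono _ fun o => hle h o).trans ?_
      simp only [lexpect_add, lexpect_const, lexpect_finset_sum]
      exact le_rfl
    refine e1.trans ?_
    have e2 : ∑ π ∈ F, lexpect (runLaw M γ μ η lam erm π₁ (T + 1)) ((now π).indicator 1) ≤
        F.card * ENNReal.ofReal (2 * Real.exp (-(x ^ 2 / (2 * σ)))) := by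
      refine (Finset.sum_le_card_nsmul _ _ _ fun π _ => lexpect_abs_errorMartingale_ge_le
        M γ μ η erm π₁ hl hm (abs_policy_le π) hσ0 hσ (T + 1) hx).trans ?_
      rw [nsmul_eq_mul]
    refine (add_le_add ih e2).trans ?_
    rw [Nat.cast_add, Nat.cast_one, add_mul, one_mul]

end Concentration

/-! ### Covering numbers -/

section Covering

variable {S A : Type*} [Fintype S] [Fintype A]

theorem exists_finite_cover (Pol : Set (Policy S A)) {ε : ℝ} (hε : 0 < ε) :
    ∃ F : Finset (Policy S A), ∀ π ∈ Pol, ∃ π' ∈ F, normInfOne (π.1 - π'.1) ≤ ε := by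
  classical
  have hK : IsCompact (Set.univ.pi fun _ : S => stdSimplex ℝ A) :=
    isCompact_univ_pi fun _ => isCompact_stdSimplex ℝ A
  -- The sum over actions costs a factor `|A|`; the added one keeps the radius positive when there
  -- are no actions.
  have he : 0 < ε / (Fintype.card A + 1) := by positivity
  obtain ⟨t, htK, htf, hcov⟩ := hK.finite_cover_balls he
  have hinj : Set.InjOn (Subtype.val : Policy S A → S → A → ℝ) (Subtype.val ⁻¹' t) :=
    Subtype.val_injective.injOn
  refine ⟨(htf.preimage hinj).toFinset, fun π _ => ?_⟩
  have hπ : π.1 ∈ Set.univ.pi fun _ : S => stdSimplex ℝ A := fun s _ => π.2 s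
  obtain ⟨x, hx, hxπ⟩ := Set.mem_iUnion₂.1 (hcov hπ)
  refine ⟨⟨x, fun s => htK hx s trivial⟩, (Set.Finite.mem_toFinset _).2 hx, ?_⟩
  refine normInfOne_le hε.le fun s => ?_
  rw [mem_ball_iff_norm] at hxπ
  calc ∑ a, |(π.1 - x) s a| ≤ ∑ _a : A, ε / (Fintype.card A + 1) :=
        Finset.sum_le_sum fun a _ => (abs_apply_le_norm (π.1 - x) s a).trans hxπ.le
    _ = Fintype.card A / (Fintype.card A + 1) * ε := by
        rw [Finset.sum_const, Finset.card_univ, nsmul_eq_mul]; ring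
    _ ≤ ε := mul_le_of_le_one_left hε.le
        ((div_le_one (by positivity)).2 (by linarith))

theorem exists_minimal_cover (Pol : Set (Policy S A)) {ε : ℝ} (hε : 0 < ε) :
    ∃ F : Finset (Policy S A), F.card = coveringNumber Pol ε ∧
      ∀ π ∈ Pol, ∃ π' ∈ F, normInfOne (π.1 - π'.1) ≤ ε := by
  obtain ⟨F, hF⟩ := exists_finite_cover Pol hε
  exact Nat.sInf_mem (s := {n | ∃ F : Finset (Policy S A), F.card = n ∧
    ∀ π ∈ Pol, ∃ π' ∈ F, normInfOne (π.1 - π'.1) ≤ ε}) ⟨F.card, F, rfl, hF⟩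

theorem one_le_coveringNumber {Pol : Set (Policy S A)} (hne : Pol.Nonempty) {ε : ℝ}
    (hε : 0 < ε) : 1 ≤ coveringNumber Pol ε := by
  obtain ⟨F, hF, hcov⟩ := exists_minimal_cover Pol hε
  obtain ⟨π, hπ⟩ := hne
  obtain ⟨π', hπ', -⟩ := hcov π hπ
  exact hF ▸ Finset.card_pos.2 ⟨π', hπ'⟩

end Covering

/-! ### The guarantee -/

section Guarantee

variable {S A : Type*} [Fintype S] [Fintype A] [Nonempty A] (M : MDP S A) (γ : Set.Ico (0 : ℝ) 1)
  (μ : PMF S) {Pol : Set (Policy S A)} (η : unitInterval) {lam : ℝ} {T : ℕ}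
  {erm : Dataset S A → Policy S A} {π₁ : Policy S A} {ε δ : ℝ}

/-- Differentiability and the existence of an output hold on every run, so only the gradient
inequality off the bad set is needed; lists outside the support carry no mass. -/
theorem succeeds_of_unlikely (hT : 1 ≤ T) (hδ : 0 ≤ δ)
    (bad : Set (List (Sample S A)))
    (hbad : lexpect (runLaw M γ μ η lam erm π₁ T) (bad.indicator 1) ≤ ENNReal.ofReal δ)
    (h : ∀ h : List (Sample S A), h.length = T → h ∉ bad →
      ∀ π, IsOutput T (stateAfter M γ η lam erm π₁ h).log π →
        ∀ π' ∈ Pol, gradient M γ μ π.1 (π'.1 - π.1) ≤ ε) :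
    Succeeds M γ μ Pol η lam T erm π₁ ε δ := by
  rw [Succeeds, ENNReal.ofReal_sub _ hδ, ENNReal.ofReal_one]
  refine tsub_le_iff_right.2 (le_trans ?_ (add_le_add le_rfl hbad))
  rw [toOuterMeasure_eq_lexpect, ← lexpect_add]
  rw [← lexpect_const (runLaw M γ μ η lam erm π₁ T) 1]
  refine ENNReal.tsum_le_tsum fun k => ?_
  by_cases hk : k ∈ (runLaw M γ μ η lam erm π₁ T).support
  · refine mul_le_mul_right ?_ _
    beta_reduce
    have hlen := length_of_mem_support M γ lam μ η erm π₁ hk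
    by_cases hb : k ∈ bad
    · rw [Set.indicator_of_mem hb]; exact le_add_self
    · rw [Set.indicator_of_mem]
      · exact le_self_add
      · refine ⟨?_, fun π hπ => ⟨differentiableAt_value M γ μ π, fun π' hπ' => ?_⟩⟩
        · rw [← hlen]
          exact exists_isOutput M γ lam η erm π₁ k (hlen ▸ hT)
        · rw [fderiv_value]
          exact h k hlen hb π hπ π' hπ'
  · rw [(PMF.apply_eq_zero_iff _ k).2 hk, zero_mul, zero_mul]

theorem succeeds_of_one_le (hT : 1 ≤ T) (hδ : 0 ≤ δ)
    (hε : 1 ≤ ε * (1 - (γ : ℝ)) ^ 2) : Succeeds M γ μ Pol η lam T erm π₁ ε δ := by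
  have h0 : 0 < 1 - (γ : ℝ) := sub_pos.2 γ.2.2
  refine succeeds_of_unlikely M γ μ η hT hδ ∅ ?_ fun k _ _ π _ π' _ => ?_
  · rw [Set.indicator_empty, lexpect_const]
    exact zero_le
  · refine (gradient_sub_policy_le M γ μ π π').trans ?_
    rwa [div_le_iff₀ (by positivity)]

/-- The momentum is only bounded below by its nominal value. This freedom is needed for small `γ`,
where the nominal value may forget the initial bias too slowly. -/
theorem succeeds_of_conditions (hε : 0 < ε) (hδ : 0 < δ) (hδ1 : δ < 1) (hT : 1 ≤ T)
    (hη : 0 < (η : ℝ)) (hl : lam ∈ Set.Ioc (0 : ℝ) 1)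
    (hm : 4 * (γ : ℝ) * Fintype.card A * η ≤ lam * (1 - (γ : ℝ)))
    (hstep : 40 * (γ : ℝ) * η ≤ ε * (1 - (γ : ℝ)) ^ 3)
    (hburn : 2 * Real.log (20 / (ε * (1 - (γ : ℝ)) ^ 2)) ≤ lam * T)
    (hnoise : 2 / ((1 - (γ : ℝ)) * (η * T)) + 20 * (√lam * (Fintype.card A / (1 - (γ : ℝ)) ^ 2) *
      √(Real.log (2 * T * coveringNumber Pol (coverScale A γ ε) / δ))) ≤ 3 * ε / 10)
    (herm : IsERMOracle Pol (ermTolerance A γ ε) erm) (hπ₁ : π₁ ∈ Pol) :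
    Succeeds M γ μ Pol η lam T erm π₁ ε δ := by
  have h0 : 0 < 1 - (γ : ℝ) := sub_pos.2 γ.2.2
  have hA : 0 < (Fintype.card A : ℝ) := Nat.cast_pos.2 Fintype.card_pos
  have hA1 : 1 ≤ (Fintype.card A : ℝ) := Nat.one_le_cast.2 Fintype.card_pos
  have hl' : lam ∈ Set.Icc (0 : ℝ) 1 := Set.Ioc_subset_Icc_self hl
  have hl0 := hl.1
  have hT0 : (0 : ℝ) < T := by exact_mod_cast hT
  have hscale : 0 < coverScale A γ ε := by rw [coverScale]; positivity
  obtain ⟨F, hF, hcov⟩ := exists_minimal_cover Pol hscale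
  have hN1 := one_le_coveringNumber ⟨π₁, hπ₁⟩ hscale
  set N := coveringNumber Pol (coverScale A γ ε) with hN
  have hN0 : (0 : ℝ) < N := by exact_mod_cast hN1
  set L := Real.log (2 * T * N / δ) with hL
  have hLarg : 1 ≤ 2 * T * N / δ := by
    rw [le_div_iff₀ hδ]
    have e1 : (1 : ℝ) ≤ T := by exact_mod_cast hT
    have e2 : (1 : ℝ) ≤ N := by exact_mod_cast hN1
    nlinarith
  have hL0 : 0 ≤ L := Real.log_nonneg hLarg
  set y := √lam * (Fintype.card A / (1 - (γ : ℝ)) ^ 2) * √L with hy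
  have hy0 : 0 ≤ y := by positivity
  -- With this `σ` the squared increment bound equals `λ σ`, and `λ + (1 - λ)² ≤ 1` gives
  -- invariance.
  set σ := 9 * lam * (Fintype.card A / (1 - (γ : ℝ)) ^ 2) ^ 2 with hσdef
  have hσ0 : 0 < σ := by positivity
  have hσ : (3 * (lam * Fintype.card A / (1 - (γ : ℝ)) ^ 2)) ^ 2 + (1 - lam) ^ 2 * σ ≤ σ := by
    have e : (3 * (lam * Fintype.card A / (1 - (γ : ℝ)) ^ 2)) ^ 2 = lam * σ := by
      rw [hσdef]; field_simp; ring
    rw [e]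
    have : lam + (1 - lam) ^ 2 ≤ 1 := by nlinarith [hl.2]
    nlinarith
  -- At this threshold the Chernoff exponent is `L`, so the union bound is exactly `δ`.
  set x := √(2 * σ * L) with hx
  have hx0 : 0 ≤ x := Real.sqrt_nonneg _
  have hxsq : x ^ 2 = 2 * σ * L := Real.sq_sqrt (by positivity)
  have hxy : x ≤ 5 * y := by
    refine abs_le_of_sq_le_sq' ?_ (by positivity) |>.2
    have : y ^ 2 = lam * (Fintype.card A / (1 - (γ : ℝ)) ^ 2) ^ 2 * L := by
      rw [hy, mul_pow, mul_pow, Real.sq_sqrt hl0.le, Real.sq_sqrt hL0]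
    rw [hxsq, mul_pow, this, hσdef]
    have : 0 ≤ lam * (Fintype.card A / (1 - (γ : ℝ)) ^ 2) ^ 2 * L := by positivity
    nlinarith
  have hprob : lexpect (runLaw M γ μ η lam erm π₁ T)
      ((largeDeviation M γ lam μ η erm π₁ F x).indicator 1) ≤ ENNReal.ofReal δ := by
    refine (lexpect_largeDeviation_le M γ μ η erm π₁ hl' hm hσ0 hσ F hx0 T).trans ?_
    have e1 : x ^ 2 / (2 * σ) = L := by rw [hxsq]; field_simp
    rw [e1, hF, hL, Real.exp_neg, Real.exp_log (by linarith), ← ENNReal.ofReal_natCast N,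
      ← ENNReal.ofReal_natCast T, ← ENNReal.ofReal_mul hN0.le, ← ENNReal.ofReal_mul hT0.le]
    refine ENNReal.ofReal_le_ofReal (le_of_eq ?_)
    field_simp
  refine succeeds_of_unlikely M γ μ η hT hδ.le _ hprob fun h hlen hh π hπ π' hπ' => ?_
  subst hlen
  set W := 3 / 2 * (Fintype.card A / (1 - (γ : ℝ)) ^ 2) with hW
  have hWb := lossNorm_data_le M γ lam η erm π₁ hl' hm
  -- The three parts are the passage to the cover, with `3/160 + 1/80 = 1/32`, the martingale part,
  -- and the damped initial error.
  have hB : ∀ k, k <:+ h → h.length ≤ 2 * k.length → ∀ π ∈ Pol,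
      |gradError M γ lam μ η erm π₁ k π.1| ≤ ε / 32 + x + ε / 20 := by
    intro k hk hkT σ hσ
    obtain ⟨f, hf, hfσ⟩ := hcov σ hσ
    have hkne : k ≠ [] := by
      rintro rfl
      simp only [List.length_nil] at hkT
      omega
    have e1 : |errorMartingale M γ lam μ η erm π₁ k f.1| ≤ x := by
      by_contra hcon
      exact hh ⟨k, hk, hkne, f, hf, (not_le.1 hcon).le⟩
    have e2 : |gradError M γ lam μ η erm π₁ k (σ.1 - f.1)| ≤ ε / 32 := by
      have e3 := (abs_pairData_le (stateAfter M γ η lam erm π₁ k).data (σ.1 - f.1)).trans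
        (mul_le_mul (hWb k) hfσ (normInfOne_nonneg _) (by positivity))
      have e4 := (abs_gradient_le M γ μ (stateAfter M γ η lam erm π₁ k).prev (σ.1 - f.1)).trans
        (div_le_div_of_nonneg_right hfσ (by positivity))
      have e5 : coverScale A γ ε / (1 - (γ : ℝ)) ^ 2 ≤ ε / 80 := by
        rw [coverScale, div_le_iff₀ (by positivity)]
        calc ε * (1 - (γ : ℝ)) ^ 2 / (80 * Fintype.card A) ≤ ε * (1 - (γ : ℝ)) ^ 2 / (80 * 1) := by
              gcongr
          _ = _ := by ring
      have e6 : 3 / 2 * (Fintype.card A / (1 - (γ : ℝ)) ^ 2) * coverScale A γ ε =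
          3 / 160 * ε := by
        rw [coverScale]; field_simp; norm_num
      refine (abs_sub _ _).trans ?_
      linarith
    have e3 : |(1 - lam) ^ k.length * gradError M γ lam μ η erm π₁ [] f.1| ≤ ε / 20 := by
      have e4 : gradError M γ lam μ η erm π₁ [] f.1 = -gradient M γ μ π₁.1 f.1 := by
        simp [gradError, pairData, stateAfter, initialState]
      have e5 : |gradError M γ lam μ η erm π₁ [] f.1| ≤ 1 / (1 - (γ : ℝ)) ^ 2 := by
        rw [e4, abs_neg]
        exact (abs_gradient_le M γ μ π₁ f.1).trans
          (div_le_div_of_nonneg_right (normInfOne_policy f) (by positivity))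
      -- Times in the window are at least `T / 2`, hence the factor 2 in the burn-in condition.
      have e6 : (1 - lam) ^ k.length ≤ ε * (1 - (γ : ℝ)) ^ 2 / 20 := by
        have e7 : 1 - lam ≤ Real.exp (-lam) := by linarith [Real.add_one_le_exp (-lam)]
        have e8 := pow_le_pow_left₀ (sub_nonneg.2 hl.2) e7 k.length
        have e9 : (h.length : ℝ) ≤ 2 * k.length := by exact_mod_cast hkT
        have e10 := mul_le_mul_of_nonneg_left e9 hl0.le
        refine e8.trans ?_
        rw [← Real.exp_nat_mul, ← Real.le_log_iff_exp_le (by positivity)]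
        have e11 : Real.log (ε * (1 - (γ : ℝ)) ^ 2 / 20) =
            -Real.log (20 / (ε * (1 - (γ : ℝ)) ^ 2)) := by
          rw [← Real.log_inv, inv_div]
        rw [e11]
        linarith
      rw [abs_mul, abs_of_nonneg (pow_nonneg (sub_nonneg.2 hl.2) _)]
      refine (mul_le_mul e6 e5 (abs_nonneg _) (by positivity)).trans (le_of_eq ?_)
      field_simp
    have e4 : gradError M γ lam μ η erm π₁ k σ.1 = gradError M γ lam μ η erm π₁ k (σ.1 - f.1) +
        errorMartingale M γ lam μ η erm π₁ k f.1 +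
          (1 - lam) ^ k.length * gradError M γ lam μ η erm π₁ [] f.1 := by
      have := gradError_combine M γ lam μ η erm π₁ k 1 1 (σ.1 - f.1) f.1
      rw [one_smul, one_smul, sub_add_cancel] at this
      rw [errorMartingale, this]
      ring
    rw [e4]
    refine (abs_add_three _ _ _).trans ?_
    linarith
  have htol : 0 ≤ ermTolerance A γ ε := by rw [ermTolerance]; positivity
  -- The fixed costs are `ε/10 + ε/8 + ε/5 + ε/40 = 9ε/20`; the rest, at most `2 / ((1 - γ) η T) +
  -- 20 y`, is within `3ε/10`.
  have key := gradient_output_le M γ lam μ η erm π₁ htol herm hπ₁ hη hstep h hT hWb hB hπ hπ'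
  have e1 : ermTolerance A γ ε * (3 / 2 * (Fintype.card A / (1 - (γ : ℝ)) ^ 2)) = ε / 40 := by
    rw [ermTolerance]; field_simp; norm_num
  rw [e1] at key
  linarith

end Guarantee

/-! ### The guarantee for admissible parameters -/

section Admissible

variable {S A : Type*} [Fintype S] [Fintype A] [Nonempty A] (γ : Set.Ico (0 : ℝ) 1)
  {Pol : Set (Policy S A)} (η : unitInterval) {T : ℕ} {ε δ : ℝ}

theorem momentum_nonneg : 0 ≤ momentum A γ η := by
  have h0 : 0 < 1 - (γ : ℝ) := sub_pos.2 γ.2.2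
  have h1 := γ.2.1
  have h2 := η.2.1
  rw [momentum]
  positivity

omit [Fintype S] in
theorem noiseConst_mul_sqrt :
    noiseConst γ Pol ε δ T * √(η : ℝ) =
      4 * (√(momentum A γ η) * (Fintype.card A / (1 - (γ : ℝ)) ^ 2) *
        √(Real.log (2 * T * coveringNumber Pol (coverScale A γ ε) / δ))) := by
  have h0 : 0 < 1 - (γ : ℝ) := sub_pos.2 γ.2.2
  have h1 := γ.2.1
  have h2 := η.2.1
  have hA : 0 < (Fintype.card A : ℝ) := Nat.cast_pos.2 Fintype.card_pos
  have e1 : (Fintype.card A : ℝ) ^ (3 / 2 : ℝ) = Fintype.card A * √(Fintype.card A : ℝ) := by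
    rw [show (3 / 2 : ℝ) = 1 + 1 / 2 by norm_num, Real.rpow_add hA, Real.rpow_one,
      Real.sqrt_eq_rpow]
  have e2 : (1 - (γ : ℝ)) ^ (5 / 2 : ℝ) = (1 - (γ : ℝ)) ^ 2 * √(1 - (γ : ℝ)) := by
    rw [show (5 / 2 : ℝ) = (2 : ℕ) + 1 / 2 by norm_num, Real.rpow_add h0, Real.rpow_natCast,
      Real.sqrt_eq_rpow]
  have e3 : √(momentum A γ η) = 2 * √(η : ℝ) * √(Fintype.card A : ℝ) * √(γ : ℝ) /
      √(1 - (γ : ℝ)) := by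
    rw [momentum, Real.sqrt_div (by positivity), Real.sqrt_mul (by positivity),
      Real.sqrt_mul (by positivity), Real.sqrt_mul (by positivity),
      show (4 : ℝ) = 2 ^ 2 by norm_num, Real.sqrt_sq (by norm_num)]
  have h3 : 0 < √(1 - (γ : ℝ)) := Real.sqrt_pos.2 h0
  rw [noiseConst, e1, e2, e3, Real.sqrt_mul h1]
  field_simp
  ring

theorem succeeds_of_paramConditions (hε : 0 < ε) (hδ : 0 < δ) (hδ1 : δ < 1)
    (hp : ParamConditions γ Pol ε δ η T) (M : MDP S A) (μ : PMF S)
    {erm : Dataset S A → Policy S A} (herm : IsERMOracle Pol (ermTolerance A γ ε) erm)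
    {π₁ : Policy S A} (hπ₁ : π₁ ∈ Pol) :
    Succeeds M γ μ Pol η (momentum A γ η) T erm π₁ ε δ := by
  have h0 : 0 < 1 - (γ : ℝ) := sub_pos.2 γ.2.2
  have hA1 : 1 ≤ (Fintype.card A : ℝ) := Nat.one_le_cast.2 Fintype.card_pos
  have hT := hp.T_pos
  have hη := hp.eta_pos
  rcases le_or_gt 1 (ε * (1 - (γ : ℝ)) ^ 2) with hbig | hsmall
  · exact succeeds_of_one_le M γ μ η hT hδ.le hbig
  -- At `γ = 0` the burn-in condition would force a positive logarithm to be at most zero.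
  have hγ0 : 0 < (γ : ℝ) := by
    by_contra hcon
    have e : (γ : ℝ) = 0 := le_antisymm (not_lt.1 hcon) γ.2.1
    have h1 := hp.burnIn
    rw [e] at h1
    rw [e] at hsmall
    have h2 : 0 < Real.log (20 / (ε * (1 - 0) ^ 2)) := by
      refine Real.log_pos ?_
      rw [lt_div_iff₀ (by positivity)]
      linarith
    linarith
  have hnoise := hp.noise
  rw [mul_assoc, noiseConst_mul_sqrt] at hnoise
  set N := coveringNumber Pol (coverScale A γ ε) with hN
  have hN1 : 1 ≤ N := one_le_coveringNumber ⟨π₁, hπ₁⟩ (by rw [coverScale]; positivity)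
  set L := Real.log (2 * T * N / δ) with hL
  have hL1 : 1 / 2 ≤ L := by
    have e1 : (1 : ℝ) ≤ T := by exact_mod_cast hT
    have e2 : (1 : ℝ) ≤ N := by exact_mod_cast hN1
    have e3 : (2 : ℝ) ≤ 2 * T * N / δ := by
      rw [le_div_iff₀ hδ]
      nlinarith
    have e4 := Real.log_le_log two_pos e3
    linarith [Real.log_two_gt_d9]
  have hm0 : 0 < momentum A γ η := by rw [momentum]; positivity
  set lam := momentum A γ η with hlam
  set y := √lam * (Fintype.card A / (1 - (γ : ℝ)) ^ 2) * √L with hy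
  have hT0 : (0 : ℝ) < T := by exact_mod_cast hT
  -- Admissibility of the momentum is not assumed: the noise condition gives `λ A² L ≤ (9/40000) (ε
  -- (1 - γ)²)²`, and `L ≥ 1/2`.
  have hm1 : lam ≤ 1 := by
    have e1 : y ≤ 3 * ε / 200 := by
      have : 0 ≤ 2 / ((1 - (γ : ℝ)) * (η * T)) := by positivity
      linarith
    have e2 : y ^ 2 ≤ (3 * ε / 200) ^ 2 := pow_le_pow_left₀ (by positivity) e1 2
    have e3 : y ^ 2 = lam * (Fintype.card A / (1 - (γ : ℝ)) ^ 2) ^ 2 * L := by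
      rw [hy, mul_pow, mul_pow, Real.sq_sqrt hm0.le, Real.sq_sqrt (by linarith)]
    have e4 : (lam * (Fintype.card A : ℝ) ^ 2 * L) = y ^ 2 * (1 - (γ : ℝ)) ^ 4 := by
      rw [e3]; field_simp
    have e5 : y ^ 2 * (1 - (γ : ℝ)) ^ 4 ≤ 9 / 40000 * (ε * (1 - (γ : ℝ)) ^ 2) ^ 2 := by
      have := mul_le_mul_of_nonneg_right e2 (pow_nonneg h0.le 4)
      linarith
    have e6 : (ε * (1 - (γ : ℝ)) ^ 2) ^ 2 ≤ 1 := pow_le_one₀ (by positivity) hsmall.le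
    have e7 : lam * 1 ^ 2 * (1 / 2) ≤ lam * (Fintype.card A : ℝ) ^ 2 * L := by gcongr
    linarith
  have e1 : lam * (1 - (γ : ℝ)) = 4 * η * Fintype.card A * γ := by
    rw [hlam, momentum, div_mul_cancel₀ _ h0.ne']
  refine succeeds_of_conditions M γ μ η hε hδ hδ1 hT hη ⟨hm0, hm1⟩ ?_ hp.step ?_ ?_ herm hπ₁
  · rw [e1]; exact le_of_eq (by ring)
  · have := hp.burnIn
    rw [← mul_le_mul_iff_of_pos_right h0]
    calc _ = 2 * ((1 - (γ : ℝ)) * Real.log (20 / (ε * (1 - (γ : ℝ)) ^ 2))) := by ring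
      _ ≤ 2 * (2 * (γ : ℝ) * Fintype.card A * (η * T)) := by linarith
      _ = lam * (1 - (γ : ℝ)) * T := by rw [e1]; ring
      _ = _ := by ring
  · linarith

end Admissible

/-! ### Episode lengths -/

section Lengths

variable {S A : Type*} [Fintype S] [Fintype A] [Nonempty A] (M : MDP S A)
  (γ : Set.Ico (0 : ℝ) 1) (μ : PMF S)

theorem lexpect_loopLength_le :
    lexpect (loopLength γ) (fun k => (k : ℝ≥0∞)) ≤ ENNReal.ofReal (1 / (1 - (γ : ℝ))) := by
  have h0 : 0 < 1 - (γ : ℝ) := sub_pos.2 γ.2.2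
  have hn : ‖(γ : ℝ)‖ < 1 := by rw [Real.norm_eq_abs, abs_of_nonneg γ.2.1]; exact γ.2.2
  have h1 := (hasSum_coe_mul_geometric_of_norm_lt_one hn).mul_right (1 - (γ : ℝ))
  have e : lexpect (loopLength γ) (fun k => (k : ℝ≥0∞)) =
      ENNReal.ofReal ((γ : ℝ) / (1 - γ) ^ 2 * (1 - (γ : ℝ))) := by
    rw [← h1.tsum_eq, ENNReal.ofReal_tsum_of_nonneg _ h1.summable]
    · refine tsum_congr fun k => ?_
      change ENNReal.ofReal ((γ : ℝ) ^ k * (1 - (γ : ℝ))) * (k : ℝ≥0∞) = _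
      rw [← ENNReal.ofReal_natCast, ← ENNReal.ofReal_mul
        (mul_nonneg (pow_nonneg γ.2.1 k) h0.le)]
      congr 1
      ring
    · exact fun k => mul_nonneg (mul_nonneg (Nat.cast_nonneg k) (pow_nonneg γ.2.1 k)) h0.le
  rw [e]
  refine ENNReal.ofReal_le_ofReal ?_
  have e2 : (γ : ℝ) / (1 - γ) ^ 2 * (1 - (γ : ℝ)) = γ / (1 - γ) := by field_simp
  rw [e2]
  exact div_le_div_of_nonneg_right γ.2.2.le h0.le

theorem one_le_ofReal_horizon : 1 ≤ ENNReal.ofReal (1 / (1 - (γ : ℝ))) := by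
  have h0 : 0 < 1 - (γ : ℝ) := sub_pos.2 γ.2.2
  rw [← ENNReal.ofReal_one]
  refine ENNReal.ofReal_le_ofReal ?_
  rw [le_div_iff₀ h0]
  linarith [γ.2.1]

theorem five_mul_ofReal_horizon :
    5 * ENNReal.ofReal (1 / (1 - (γ : ℝ))) = ENNReal.ofReal (5 / (1 - (γ : ℝ))) := by
  rw [show (5 : ℝ≥0∞) = ENNReal.ofReal 5 by norm_num, ← ENNReal.ofReal_mul (by norm_num),
    mul_one_div]

omit [Fintype S] in
theorem lexpect_qSampler_length_le (π : Policy S A) :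
    lexpect (qSampler M γ μ π) (fun q => (q.length : ℝ≥0∞)) ≤
      ENNReal.ofReal (5 / (1 - (γ : ℝ))) := by
  have h1 := lexpect_loopLength_le γ
  have h2 := one_le_ofReal_horizon γ
  rw [← five_mul_ofReal_horizon]
  set m := ENNReal.ofReal (1 / (1 - (γ : ℝ)))
  simp only [qSampler, lexpect_bind, lexpect_pure, Nat.cast_add, Nat.cast_one, lexpect_add,
    lexpect_const]
  calc _ ≤ m + m + m := by gcongr
    _ = 3 * m := by ring
    _ ≤ 5 * m := by gcongr; norm_num

-- Three loops and two uniform actions, each accounting for at most one horizon `1 / (1 - γ)`.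
omit [Fintype S] in
theorem lexpect_hSampler_length_le (π : Policy S A) :
    lexpect (hSampler M γ μ π) (fun h => (h.length : ℝ≥0∞)) ≤
      ENNReal.ofReal (5 / (1 - (γ : ℝ))) := by
  have h1 := lexpect_loopLength_le γ
  have h2 := one_le_ofReal_horizon γ
  rw [← five_mul_ofReal_horizon]
  set m := ENNReal.ofReal (1 / (1 - (γ : ℝ)))
  simp only [hSampler, lexpect_bind, lexpect_pure, Nat.cast_add, Nat.cast_one, lexpect_add,
    lexpect_const]
  calc _ ≤ m + m + m + m + m := by gcongr
    _ = 5 * m := by ring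

theorem lexpect_hSamplerMixed (π π' : Policy S A) (f : HSample S A → ℝ≥0∞) :
    lexpect (hSamplerMixed M γ μ π π') f =
      ∫⁻ b : unitInterval, lexpect (hSampler M γ μ (mix b π π')) f := by
  have hm := measurable_hSampler_mix M γ μ π π'
  simp only [lexpect]
  rw [MeasureTheory.lintegral_tsum fun h => ((hm h).mul_const _).aemeasurable]
  refine tsum_congr fun h => ?_
  rw [MeasureTheory.lintegral_mul_const _ (hm h)]
  rfl

theorem lexpect_hSamplerMixed_length_le (π π' : Policy S A) :
    lexpect (hSamplerMixed M γ μ π π') (fun h => (h.length : ℝ≥0∞)) ≤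
      ENNReal.ofReal (5 / (1 - (γ : ℝ))) := by
  rw [lexpect_hSamplerMixed]
  refine (MeasureTheory.lintegral_mono fun b =>
    lexpect_hSampler_length_le M γ μ (mix b π π')).trans ?_
  simp

variable (η : unitInterval) (lam : ℝ) (erm : Dataset S A → Policy S A) (π₁ : Policy S A)

omit [Fintype S] [Fintype A] [Nonempty A] in
theorem length_episodeLengths (h : List (Sample S A)) :
    (episodeLengths h).length = 2 * h.length := by
  induction h with
  | nil => rfl
  | cons o h ih =>
    rw [episodeLengths, List.flatMap_cons, List.length_append, ← episodeLengths, ih]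
    simp only [List.length_cons, List.length_nil]
    ring

theorem lexpect_episodeLengths_le (T : ℕ) : ∀ i : ℕ,
    lexpect (runLaw M γ μ η lam erm π₁ T)
        (fun h => (((episodeLengths h).getD i 0 : ℕ) : ℝ≥0∞)) ≤
      ENNReal.ofReal (5 / (1 - (γ : ℝ))) := by
  induction T with
  | zero => intro i; simp [runLaw, lexpect_pure, episodeLengths]
  | succ T ih =>
    intro i
    have e : ∀ (o : Sample S A) h, episodeLengths (o :: h) =
        o.1.length :: o.2.length :: episodeLengths h := fun o h => rfl
    simp only [lexpect_runLaw_succ, e]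
    match i with
    | 0 =>
      refine (lexpect_mono _ (g := fun _ => ENNReal.ofReal (5 / (1 - (γ : ℝ)))) fun h => ?_).trans
        (lexpect_const _ _).le
      simp only [List.getD_cons_zero, stepLaw, lexpect_bind, lexpect_pure, lexpect_const]
      exact lexpect_qSampler_length_le M γ μ _
    | 1 =>
      refine (lexpect_mono _ (g := fun _ => ENNReal.ofReal (5 / (1 - (γ : ℝ)))) fun h => ?_).trans
        (lexpect_const _ _).le
      simp only [List.getD_cons_succ, List.getD_cons_zero, stepLaw, lexpect_bind, lexpect_pure,
        lexpect_const]
      exact lexpect_hSamplerMixed_length_le M γ μ _ _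
    | i + 2 =>
      simp only [List.getD_cons_succ, lexpect_const]
      exact ih i

end Lengths

/-! ### Choice of the parameters -/

section Parameters

theorem log_two_pow_le (k : ℕ) : Real.log (2 ^ k) ≤ k * 0.6932 := by
  rw [Real.log_pow]
  exact mul_le_mul_of_nonneg_left (by linarith [Real.log_two_lt_d9]) (Nat.cast_nonneg k)

theorem one_le_log_of_three_le {x : ℝ} (hx : 3 ≤ x) : 1 ≤ Real.log x := by
  rw [Real.le_log_iff_exp_le (by linarith)]
  linarith [Real.exp_one_lt_d9]

set_option maxHeartbeats 1000000 in
/-- Step size, momentum and number of iterations for which all the error terms are small. -/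
theorem exists_parameters {γ A ε δ N : ℝ} (hγ : γ ∈ Set.Ico (0 : ℝ) 1) (hA : 1 ≤ A) (hε : 0 < ε)
    (hδ : 0 < δ) (hδ1 : δ < 1) (hN : 1 ≤ N) (hsmall : ε * (1 - γ) ^ 2 < 1) :
    ∃ (η : unitInterval) (lam : ℝ) (T : ℕ), 0 < (η : ℝ) ∧ lam ∈ Set.Ioc (0 : ℝ) 1 ∧
      4 * γ * A * η ≤ lam * (1 - γ) ∧ 1 ≤ T ∧
      40 * γ * η ≤ ε * (1 - γ) ^ 3 ∧
      2 * Real.log (20 / (ε * (1 - γ) ^ 2)) ≤ lam * T ∧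
      (ε ^ 3 ≤ γ → (1 - γ) * Real.log (20 / (ε * (1 - γ) ^ 2)) ≤ 2 * γ * A * (η * T)) ∧
      2 / ((1 - γ) * (η * T)) ≤ 3 * ε / 20 ∧
      20 * (√lam * (A / (1 - γ) ^ 2) * √(Real.log (2 * T * N / δ))) ≤ 3 * ε / 20 ∧
      2 * (T : ℝ) ≤ 4 * 10 ^ 8 * (A ^ 3 / ((1 - γ) ^ 6 * ε ^ 3)) * (1 + Real.log N) *
        Real.log (2 + A / ((1 - γ) * δ) + 1 / ε) ^ 2 := by
  obtain ⟨hγ0, hγ1⟩ := hγ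
  obtain ⟨g, hg⟩ : ∃ g, g = 1 - γ := ⟨_, rfl⟩
  have hg0 : 0 < g := by linarith
  have hg1 : g ≤ 1 := by linarith
  rw [← hg] at hsmall ⊢
  have hA0 : 0 < A := by linarith
  set X := 2 + A / (g * δ) + 1 / ε with hX
  have hAg : A / g ≤ A / (g * δ) := by
    refine div_le_div_of_nonneg_left hA0.le (by positivity) ?_
    exact mul_le_of_le_one_right hg0.le hδ1.le
  have hgg : 1 / g ≤ A / g := div_le_div_of_nonneg_right hA hg0.le
  have h1g : 1 ≤ 1 / g := by rwa [le_div_iff₀ hg0, one_mul]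
  have hεi : 0 < 1 / ε := by positivity
  have hX3 : 3 ≤ X := by linarith
  have hX0 : 0 < X := by linarith
  have hXA : A / g ≤ X := by linarith
  have hXg : 1 / g ≤ X := by linarith
  have hXε : 1 / ε ≤ X := by linarith
  have hXδ : 1 / δ ≤ X := by
    have : 1 / δ ≤ A / (g * δ) := by
      rw [div_le_div_iff₀ hδ (by positivity)]
      linarith only [mul_nonneg hδ.le (show 0 ≤ A - g by linarith)]
    linarith
  set Λ := Real.log X with hΛ
  have hΛ1 : 1 ≤ Λ := one_le_log_of_three_le hX3
  have hXexp : Real.exp Λ = X := Real.exp_log hX0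
  have hΛX : Λ ≤ X := by rw [← hXexp]; linarith [Real.add_one_le_exp Λ]
  set n := 1 + Real.log N with hn
  have hn1 : 1 ≤ n := by linarith [Real.log_nonneg hN]
  have hNexp : N ≤ Real.exp n := by
    rw [← Real.log_le_iff_le_exp (by linarith)]; linarith
  have hnexp : n ≤ Real.exp n := by linarith [Real.add_one_le_exp n]
  -- All orders of magnitude are powers of `ρ`: `T ≈ ρ³` and `λ ≈ ρ⁻²`, up to `n` and `Λ`.
  set ρ := A / (g ^ 2 * ε) with hρ
  have hρA : 1 / (g ^ 2 * ε) ≤ ρ := div_le_div_of_nonneg_right hA (by positivity)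
  have hρ1 : 1 ≤ ρ := by
    refine le_trans ?_ hρA
    rw [le_div_iff₀ (by positivity)]
    linarith
  have hρε : 1 / ε ≤ ρ := by
    refine le_trans ?_ hρA
    refine div_le_div_of_nonneg_left zero_le_one (by positivity) ?_
    exact mul_le_of_le_one_left hε.le (pow_le_one₀ hg0.le hg1)
  have hρX : ρ ≤ X ^ 3 := by
    calc ρ = (A / g) * (1 / g) * (1 / ε) := by rw [hρ]; field_simp
      _ ≤ X * X * X := by gcongr
      _ = X ^ 3 := by ring
  have hρ3 : A ^ 3 / (g ^ 6 * ε ^ 3) = ρ ^ 3 := by rw [hρ]; field_simp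
  rw [hρ3]
  clear_value X Λ n ρ
  set T := ⌈10 ^ 8 * ρ ^ 3 * n * Λ ^ 2⌉₊ with hT
  have hbase : 1 ≤ ρ ^ 3 * n * Λ ^ 2 := by
    have e1 : 1 ≤ ρ ^ 3 := one_le_pow₀ hρ1
    have e2 : 1 ≤ Λ ^ 2 := one_le_pow₀ hΛ1
    exact one_le_mul_of_one_le_of_one_le (one_le_mul_of_one_le_of_one_le e1 hn1) e2
  have hTge : 10 ^ 8 * ρ ^ 3 * n * Λ ^ 2 ≤ T := Nat.le_ceil _
  have hTle : (T : ℝ) ≤ 2 * 10 ^ 8 * ρ ^ 3 * n * Λ ^ 2 := by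
    have := (Nat.ceil_lt_add_one (a := 10 ^ 8 * ρ ^ 3 * n * Λ ^ 2) (by positivity)).le
    rw [← hT] at this
    linarith
  have hT1 : (1 : ℝ) ≤ T := by linarith
  clear_value T
  -- The exponent 12 of `X` is nine from `ρ³`, two from `Λ²`, one from `1 / δ`; then `26 + 12 Λ + 2
  -- n ≤ 40 n Λ`. The circular dependence on `T` costs only this constant.
  have hL : Real.log (2 * T * N / δ) ≤ 40 * (n * Λ) := by
    have e1 : 2 * T * N / δ ≤ 4 * 10 ^ 8 * X ^ 12 * Real.exp (2 * n) := by
      calc 2 * T * N / δ = 2 * T * N * (1 / δ) := by ring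
        _ ≤ 2 * (2 * 10 ^ 8 * (X ^ 3) ^ 3 * Real.exp n * X ^ 2) * Real.exp n * X := by
          gcongr
          refine hTle.trans ?_
          gcongr
        _ = 4 * 10 ^ 8 * X ^ 12 * (Real.exp n * Real.exp n) := by ring
        _ = _ := by rw [← Real.exp_add, two_mul n]
    have e2 := Real.log_le_log (by positivity) e1
    rw [Real.log_mul (by positivity) (Real.exp_pos _).ne', Real.log_exp,
      Real.log_mul (by norm_num) (by positivity), Real.log_pow, ← hΛ] at e2
    have e3 : Real.log (4 * 10 ^ 8) ≤ 26 := by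
      refine (Real.log_le_log (by norm_num) (show (4 * 10 ^ 8 : ℝ) ≤ 2 ^ 29 by norm_num)).trans
        ((log_two_pow_le 29).trans ?_)
      norm_num
    have e4 : n ≤ n * Λ := le_mul_of_one_le_right (by linarith) hΛ1
    have e5 : Λ ≤ n * Λ := le_mul_of_one_le_left (by linarith) hn1
    have e6 : 1 ≤ n * Λ := hn1.trans e4
    rw [Nat.cast_ofNat] at e2
    generalize Real.log (4 * 10 ^ 8) = c at e2 e3
    refine e2.trans ?_
    linarith only [e3, e4, e5, e6]
  -- Chosen so that `40 a = (3 / 400)²`, which makes the noise inequality an identity after `L ≤ 40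
  -- n Λ`.
  obtain ⟨a, ha⟩ : ∃ a : ℝ, a = 9 / 6400000 := ⟨_, rfl⟩
  have ha0 : 0 < a := by rw [ha]; norm_num
  set lam := a / (ρ ^ 2 * n * Λ) with hlam
  have hlam0 : 0 < lam := by positivity
  have hden : 1 ≤ n * Λ := one_le_mul_of_one_le_of_one_le hn1 hΛ1
  have hlamρ : lam ≤ a / ρ ^ 2 := by
    refine div_le_div_of_nonneg_left ha0.le (by positivity) ?_
    rw [mul_assoc]
    exact le_mul_of_one_le_right (by positivity) hden
  clear_value lam
  have hlam1 : lam ≤ 1 := by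
    refine hlamρ.trans ?_
    rw [div_le_one (by positivity)]
    have : 1 ≤ ρ ^ 2 := one_le_pow₀ hρ1
    rw [ha]; linarith
  have hlamT : 140 * Λ ≤ lam * T := by
    calc 140 * Λ ≤ a * 10 ^ 8 * 1 * Λ := by rw [ha]; linarith only [hΛ1]
      _ ≤ a * 10 ^ 8 * ρ * Λ := by gcongr
      _ = lam * (10 ^ 8 * ρ ^ 3 * n * Λ ^ 2) := by rw [hlam]; field_simp
      _ ≤ lam * T := by gcongr
  have hlog : Real.log (20 / (ε * g ^ 2)) ≤ 7 * Λ := by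
    have e1 : 20 / (ε * g ^ 2) ≤ 2 ^ 5 * X ^ 3 := by
      calc 20 / (ε * g ^ 2) = 20 * ((1 / ε) * (1 / g) * (1 / g)) := by field_simp
        _ ≤ 2 ^ 5 * (X * X * X) := by gcongr; norm_num
        _ = _ := by ring
    have e2 := Real.log_le_log (by positivity) e1
    rw [Real.log_mul (by norm_num) (by positivity), Real.log_pow X, ← hΛ] at e2
    have e3 := log_two_pow_le 5
    push_cast at e2 e3
    linarith
  -- The step size is the largest one allowed by the momentum, capped at one when `γ` is very small.
  have hη : ∃ η : unitInterval, 0 < (η : ℝ) ∧ 4 * γ * A * η ≤ lam * g ∧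
      ((η : ℝ) = 1 ∨ 4 * γ * A * η = lam * g) := by
    rcases le_or_gt (4 * γ * A) (lam * g) with h | h
    · exact ⟨1, by simp, by simpa using h, Or.inl rfl⟩
    · have hpos : 0 < 4 * γ * A := lt_trans (by positivity) h
      have e : 4 * γ * A * (lam * g / (4 * γ * A)) = lam * g := mul_div_cancel₀ _ hpos.ne'
      exact ⟨⟨lam * g / (4 * γ * A), by positivity, ((div_lt_one hpos).2 h).le⟩,
        by positivity, e.le, Or.inr e⟩
  obtain ⟨η, hη0, hηle, hηcase⟩ := hη
  refine ⟨η, lam, T, hη0, ⟨hlam0, hlam1⟩, hηle, by exact_mod_cast hT1, ?_, ?_, ?_, ?_, ?_, ?_⟩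
  · have e1 : 4 * γ * 1 * η ≤ 4 * γ * A * η := by gcongr
    have e2 : lam * g ≤ a / ρ ^ 2 * g := by gcongr
    have e3 : a / ρ ^ 2 * g = a * (ε * g ^ 2) * (ε * g ^ 3) / A ^ 2 := by
      rw [hρ]; field_simp
    have e4 : a * (ε * g ^ 2) * (ε * g ^ 3) / A ^ 2 ≤ a * 1 * (ε * g ^ 3) / 1 ^ 2 := by gcongr
    have e5 : 0 < ε * g ^ 3 := by positivity
    have e6 : a * 1 * (ε * g ^ 3) / 1 ^ 2 ≤ 1 / 10 * (ε * g ^ 3) := by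
      rw [ha]; linarith
    linarith
  · linarith
  · intro hεγ
    -- In the capped case `ε³ ≤ γ` is used: the factor `ε³` cancels the `ε⁻³` in `T`, so `γ T` stays
    -- bounded below.
    rcases hηcase with h | h
    · rw [h, one_mul]
      have e1 : 7 * Λ ≤ 2 * γ * A * T := by
        calc 7 * Λ ≤ 2 * (10 ^ 8 * 1 * 1) * 1 * Λ := by linarith
          _ ≤ 2 * (10 ^ 8 * (A ^ 3 / g ^ 6) * n) * A * Λ ^ 2 := by
            have e1 : 1 ≤ A ^ 3 / g ^ 6 := by
              rw [one_le_div (by positivity)]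
              exact (pow_le_one₀ hg0.le hg1).trans (one_le_pow₀ hA)
            gcongr
            exact le_self_pow₀ hΛ1 two_ne_zero
          _ = 2 * ε ^ 3 * A * (10 ^ 8 * ρ ^ 3 * n * Λ ^ 2) := by rw [hρ]; field_simp
          _ ≤ 2 * γ * A * T := by gcongr
      have e2 : g * Real.log (20 / (ε * g ^ 2)) ≤ 1 * (7 * Λ) := by
        have : 0 ≤ 7 * Λ := by linarith
        calc _ ≤ g * (7 * Λ) := by gcongr
          _ ≤ _ := by gcongr
      linarith
    · have e1 : 2 * γ * A * (η * T) = g * (lam * T / 2) := by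
        have : 2 * γ * A * (η * T) = (4 * γ * A * η) * T / 2 := by ring
        rw [this, h]; ring
      rw [e1]
      refine mul_le_mul_of_nonneg_left ?_ hg0.le
      linarith
  -- The constant 35 is just below `a * 10 ^ 8 / 4`, and `35 * 3 / 20` exceeds the required 2.
  · have e1 : 35 / ε ≤ g * (η * T) := by
      rcases hηcase with h | h
      · rw [h, one_mul]
        calc 35 / ε ≤ g * (35 * (1 / (g ^ 2 * ε)) * 1 * 1) := by
              rw [mul_one, mul_one, mul_one_div, ← mul_div_assoc,
                div_le_div_iff₀ hε (by positivity)]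
              nlinarith only [mul_nonneg (mul_nonneg hε.le hg0.le) (sub_nonneg.2 hg1)]
          _ ≤ g * (10 ^ 8 * ρ ^ 3 * n * Λ ^ 2) := by
              have e2 : ρ ≤ ρ ^ 3 := le_self_pow₀ hρ1 (by norm_num)
              have e3 : 1 ≤ Λ ^ 2 := one_le_pow₀ hΛ1
              have e4 : 35 * (1 / (g ^ 2 * ε)) ≤ 10 ^ 8 * ρ ^ 3 := by linarith only [hρA, e2, hρ1]
              gcongr
          _ ≤ g * T := by gcongr
      · have hγA : 0 < γ := by
          rcases hγ0.eq_or_lt with h' | h'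
          · rw [← h'] at h
            have : 0 < lam * g := by positivity
            linarith
          · exact h'
        have e2 : (η : ℝ) = lam * g / (4 * γ * A) := by
          rw [eq_div_iff (by positivity)]; linarith
        rw [e2]
        calc 35 / ε ≤ a * 10 ^ 8 * Λ / (4 * 1 * ε) := by
              rw [div_le_div_iff₀ hε (by positivity), ha]
              linarith only [mul_le_mul_of_nonneg_left hΛ1 hε.le, hε]
          _ ≤ a * 10 ^ 8 * Λ / (4 * γ * ε) := by gcongr
          _ = g * (lam * g / (4 * γ * A) * (10 ^ 8 * ρ ^ 3 * n * Λ ^ 2)) := by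
              rw [hlam, hρ]; field_simp
          _ ≤ _ := by gcongr
    rw [div_le_iff₀ (by positivity)]
    have e2 : 3 * ε / 20 * (35 / ε) ≤ 3 * ε / 20 * (g * (η * T)) := by gcongr
    have e3 : 3 * ε / 20 * (35 / ε) = 21 / 4 := by field_simp; norm_num
    linarith
  · set L := Real.log (2 * T * N / δ) with hLdef
    have hL0 : 0 ≤ L := by
      refine Real.log_nonneg ?_
      rw [le_div_iff₀ hδ]
      linarith only [one_le_mul_of_one_le_of_one_le hT1 hN, hδ1]
    rw [← le_div_iff₀' (by norm_num)]
    refine abs_le_of_sq_le_sq' ?_ (by positivity) |>.2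
    rw [mul_pow, mul_pow, Real.sq_sqrt hlam0.le, Real.sq_sqrt hL0]
    calc lam * (A / g ^ 2) ^ 2 * L ≤ lam * (A / g ^ 2) ^ 2 * (40 * (n * Λ)) := by gcongr
      _ = 40 * a * ε ^ 2 := by rw [hlam, hρ]; field_simp
      _ = _ := by rw [ha]; ring
  · linarith

theorem one_le_logFactor {A : Type*} [Fintype A] [Nonempty A] (γ : Set.Ico (0 : ℝ) 1) {ε δ : ℝ}
    (hε : 0 < ε) (hδ : 0 < δ) (hδ1 : δ < 1) : 1 ≤ logFactor A γ ε δ := by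
  have h0 : 0 < 1 - (γ : ℝ) := sub_pos.2 γ.2.2
  have hA1 : 1 ≤ (Fintype.card A : ℝ) := Nat.one_le_cast.2 Fintype.card_pos
  have e1 : 1 ≤ Fintype.card A / ((1 - (γ : ℝ)) * δ) := by
    rw [one_le_div (by positivity)]
    have := γ.2.1
    exact (mul_le_one₀ (by linarith) hδ.le hδ1.le).trans hA1
  have e2 : 0 < 1 / ε := by positivity
  exact one_le_log_of_three_le (by linarith)

/-- For `γ ≥ ε³` the momentum may be lowered to its nominal value: noise only decreases, and burn-in
is guaranteed separately. For smaller `γ` the larger momentum is kept. -/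
theorem exists_sample_efficient_parameters {S A : Type*} [Fintype S] [Fintype A] [Nonempty A]
    (γ : Set.Ico (0 : ℝ) 1) (Pol : Set (Policy S A)) {ε δ : ℝ} (hPol : Pol.Nonempty) (hε : 0 < ε)
    (hδ : 0 < δ) (hδ1 : δ < 1) :
    ∃ (η : unitInterval) (lam : ℝ) (T : ℕ), lam ∈ Set.Icc (0 : ℝ) 1 ∧
      (∀ (M : MDP S A) (μ : PMF S) (erm : Dataset S A → Policy S A),
        IsERMOracle Pol (ermTolerance A γ ε) erm → ∀ π₁ ∈ Pol,
          Succeeds M γ μ Pol η lam T erm π₁ ε δ) ∧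
      (ε ^ 3 ≤ (γ : ℝ) → lam = momentum A γ η ∧ ParamConditions γ Pol ε δ η T) ∧
      2 * (T : ℝ) ≤ 4 * 10 ^ 8 * (1 + Real.log (coveringNumber Pol (coverScale A γ ε))) *
        leadingRate A γ ε * logFactor A γ ε δ ^ 2 := by
  have h0 : 0 < 1 - (γ : ℝ) := sub_pos.2 γ.2.2
  have hA1 : 1 ≤ (Fintype.card A : ℝ) := Nat.one_le_cast.2 Fintype.card_pos
  have hΛ := one_le_logFactor (A := A) γ hε hδ hδ1
  have hrate : 1 ≤ leadingRate A γ ε := le_max_left _ _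
  set N := coveringNumber Pol (coverScale A γ ε) with hNdef
  have hN1 : (1 : ℝ) ≤ N := by
    exact_mod_cast one_le_coveringNumber hPol (by rw [coverScale]; positivity)
  have hn1 : 1 ≤ 1 + Real.log N := by linarith [Real.log_nonneg hN1]
  rcases le_or_gt 1 (ε * (1 - (γ : ℝ)) ^ 2) with hbig | hsmall
  · refine ⟨1, 0, 1, by simp, fun M μ erm _ π₁ _ =>
      succeeds_of_one_le M γ μ 1 le_rfl hδ.le hbig, fun h => ?_, ?_⟩
    -- A large accuracy with `ε (1 - γ)² ≥ 1` forces `ε ≥ 1 > γ`, so `ε³ ≤ γ` is impossible.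
    · exfalso
      have e1 : 1 ≤ ε := by
        by_contra hcon
        have e2 : (1 - (γ : ℝ)) ^ 2 ≤ 1 := pow_le_one₀ h0.le (by linarith [γ.2.1])
        nlinarith
      have e2 : 1 ≤ ε ^ 3 := one_le_pow₀ e1
      linarith [γ.2.2]
    · have e1 : 1 ≤ logFactor A γ ε δ ^ 2 := one_le_pow₀ hΛ
      have e2 := one_le_mul_of_one_le_of_one_le (one_le_mul_of_one_le_of_one_le hn1 hrate) e1
      push_cast
      linarith
  obtain ⟨η, lam, T, hη, hlam, hm, hT, hstep, hburn, hburn', hopt, hnoise, hTle⟩ :=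
    exists_parameters γ.2 hA1 hε hδ hδ1 hN1 hsmall
  have hbound : 2 * (T : ℝ) ≤ 4 * 10 ^ 8 * (1 + Real.log N) * leadingRate A γ ε *
      logFactor A γ ε δ ^ 2 := by
    refine hTle.trans ?_
    have e1 : (Fintype.card A : ℝ) ^ 3 / ((1 - (γ : ℝ)) ^ 6 * ε ^ 3) ≤ leadingRate A γ ε :=
      le_max_right _ _
    rw [mul_right_comm (4 * 10 ^ 8 : ℝ)]
    change _ * logFactor A γ ε δ ^ 2 ≤ _
    gcongr
  by_cases hγε : ε ^ 3 ≤ (γ : ℝ)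
  · have hmle : momentum A γ η ≤ lam := by
      rw [momentum, div_le_iff₀ h0]
      linarith
    have hp : ParamConditions γ Pol ε δ η T := by
      refine ⟨hη, hT, hstep, hburn' hγε, ?_⟩
      rw [mul_assoc, noiseConst_mul_sqrt]
      have e1 : √(momentum A γ η) * (Fintype.card A / (1 - (γ : ℝ)) ^ 2) *
          √(Real.log (2 * T * N / δ)) ≤ √lam * (Fintype.card A / (1 - (γ : ℝ)) ^ 2) *
          √(Real.log (2 * T * N / δ)) := by gcongr
      linarith
    exact ⟨η, momentum A γ η, T, ⟨momentum_nonneg γ η, hmle.trans hlam.2⟩,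
      fun M μ erm herm π₁ hπ₁ => succeeds_of_paramConditions γ η hε hδ hδ1 hp M μ herm hπ₁,
      fun _ => ⟨rfl, hp⟩, hbound⟩
  · exact ⟨η, lam, T, Set.Ioc_subset_Icc_self hlam, fun M μ erm herm π₁ hπ₁ =>
      succeeds_of_conditions M γ μ η hε hδ hδ1 hT hη hlam hm hstep hburn (by linarith) herm hπ₁,
      fun h => absurd h hγε, hbound⟩

/-- The ratio of scales is `80 A / (1 - γ)²`, polynomial in the argument of the logarithmic factor,
so changing scale costs one more such factor. -/
theorem log_coveringNumber_le_of_scaling {A : Type*} [Fintype A] [Nonempty A]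
    (γ : Set.Ico (0 : ℝ) 1) {ε δ κ n N' : ℝ} (hε : 0 < ε) (hδ : 0 < δ) (hδ1 : δ < 1) (hκ : 1 ≤ κ)
    (hN' : 1 ≤ N') (h : n ≤ κ * N' * (1 + Real.log (ε / coverScale A γ ε))) :
    1 + n ≤ 9 * κ * N' * logFactor A γ ε δ := by
  have h0 : 0 < 1 - (γ : ℝ) := sub_pos.2 γ.2.2
  have hA1 : 1 ≤ (Fintype.card A : ℝ) := Nat.one_le_cast.2 Fintype.card_pos
  have hA0 : 0 < (Fintype.card A : ℝ) := by linarith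
  set X := 2 + Fintype.card A / ((1 - (γ : ℝ)) * δ) + 1 / ε with hX
  have hAg : Fintype.card A / (1 - (γ : ℝ)) ≤ Fintype.card A / ((1 - (γ : ℝ)) * δ) :=
    div_le_div_of_nonneg_left hA0.le (by positivity) (mul_le_of_le_one_right h0.le hδ1.le)
  have hgg : 1 / (1 - (γ : ℝ)) ≤ Fintype.card A / (1 - (γ : ℝ)) :=
    div_le_div_of_nonneg_right hA1 h0.le
  have h1g : 1 ≤ 1 / (1 - (γ : ℝ)) := by
    rw [le_div_iff₀ h0]; linarith [γ.2.1]
  have hεi : 0 < 1 / ε := by positivity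
  have hX3 : 3 ≤ X := by linarith
  have hΛ1 : 1 ≤ logFactor A γ ε δ := one_le_log_of_three_le hX3
  have e1 : ε / coverScale A γ ε ≤ 2 ^ 7 * X ^ 2 := by
    calc ε / coverScale A γ ε
        = 80 * ((Fintype.card A / (1 - (γ : ℝ))) * (1 / (1 - (γ : ℝ)))) := by
          rw [coverScale]; field_simp
      _ ≤ 2 ^ 7 * (X * X) := by
          gcongr
          · norm_num
          · linarith
          · linarith
      _ = _ := by ring
  have e2 := Real.log_le_log (by rw [coverScale]; positivity) e1
  rw [Real.log_mul (by norm_num) (by positivity), Real.log_pow X] at e2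
  have e3 := log_two_pow_le 7
  change _ ≤ _ + _ * logFactor A γ ε δ at e2
  push_cast at e2 e3
  have e4 : 1 + Real.log (ε / coverScale A γ ε) ≤ 8 * logFactor A γ ε δ := by linarith
  have e5 : 1 ≤ κ * N' := one_le_mul_of_one_le_of_one_le hκ hN'
  have e6 := mul_le_mul_of_nonneg_left e4 (zero_le_one.trans e5)
  have e7 : 1 ≤ κ * N' * logFactor A γ ε δ := one_le_mul_of_one_le_of_one_le e5 hΛ1
  linarith

end Parameters

end VRCPI

end

theorem theorem1 :
    -- guarantee for all admissible parameters
    (∀ (S A : Type) [Fintype S] [Fintype A] [Nonempty A] (γ : Set.Ico (0 : ℝ) 1)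
      (Pol : Set (VRCPI.Policy S A)) (ε δ : ℝ) (η : unitInterval) (T : ℕ),
      0 < ε → 0 < δ → δ < 1 → VRCPI.ParamConditions γ Pol ε δ η T →
      ∀ (M : VRCPI.MDP S A) (μ : PMF S) (erm : VRCPI.Dataset S A → VRCPI.Policy S A),
        VRCPI.IsERMOracle Pol (VRCPI.ermTolerance A γ ε) erm → ∀ π₁ ∈ Pol,
        VRCPI.Succeeds M γ μ Pol η (VRCPI.momentum A γ η) T erm π₁ ε δ) ∧
    -- number of episodes sufficient for the guarantee
    (∃ (C : ℝ) (k : ℕ), 0 < C ∧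
      ∀ (S A : Type) [Fintype S] [Fintype A] [Nonempty A] (γ : Set.Ico (0 : ℝ) 1)
        (Pol : Set (VRCPI.Policy S A)) (ε δ : ℝ), Pol.Nonempty → 0 < ε → 0 < δ → δ < 1 →
        ∃ (η : unitInterval) (lam : ℝ) (T : ℕ), lam ∈ Set.Icc (0 : ℝ) 1 ∧
          (∀ (M : VRCPI.MDP S A) (μ : PMF S) (erm : VRCPI.Dataset S A → VRCPI.Policy S A),
            VRCPI.IsERMOracle Pol (VRCPI.ermTolerance A γ ε) erm → ∀ π₁ ∈ Pol,
            VRCPI.Succeeds M γ μ Pol η lam T erm π₁ ε δ) ∧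
          (ε ^ 3 ≤ (γ : ℝ) →
            lam = VRCPI.momentum A γ η ∧ VRCPI.ParamConditions γ Pol ε δ η T) ∧
          2 * (T : ℝ) ≤
            C * (1 + Real.log (VRCPI.coveringNumber Pol (VRCPI.coverScale A γ ε))) *
              VRCPI.leadingRate A γ ε * VRCPI.logFactor A γ ε δ ^ k ∧
          ∀ κ : ℝ, 1 ≤ κ →
            Real.log (VRCPI.coveringNumber Pol (VRCPI.coverScale A γ ε)) ≤
              κ * (1 + Real.log (VRCPI.coveringNumber Pol ε)) *
                (1 + Real.log (ε / VRCPI.coverScale A γ ε)) →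
            2 * (T : ℝ) ≤ C * κ * (1 + Real.log (VRCPI.coveringNumber Pol ε)) *
              VRCPI.leadingRate A γ ε * VRCPI.logFactor A γ ε δ ^ k) ∧
    -- a run of `T` iterations draws `2 T` episodes, each of expected length at most `5 / (1 - γ)`
    (∀ (S A : Type) [Fintype S] [Fintype A] [Nonempty A] (γ : Set.Ico (0 : ℝ) 1)
      (η : unitInterval) (lam : ℝ) (T : ℕ) (M : VRCPI.MDP S A) (μ : PMF S)
      (erm : VRCPI.Dataset S A → VRCPI.Policy S A) (π₁ : VRCPI.Policy S A),
      (∀ h ∈ (VRCPI.runLaw M γ μ η lam erm π₁ T).support,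
        (VRCPI.episodeLengths h).length = 2 * T) ∧
      ∀ i : ℕ,
        ∑' h, VRCPI.runLaw M γ μ η lam erm π₁ T h *
            (((VRCPI.episodeLengths h).getD i 0 : ℕ) : ℝ≥0∞) ≤
          ENNReal.ofReal (5 / (1 - (γ : ℝ)))) := by
  refine ⟨?_, ?_, ?_⟩
  · intro S A _ _ _ γ Pol ε δ η T hε hδ hδ1 hp M μ erm herm π₁ hπ₁
    exact VRCPI.succeeds_of_paramConditions γ η hε hδ hδ1 hp M μ herm hπ₁
  -- The constant `4 * 10 ^ 8` and exponent 2 are enlarged by the factor 9 and the extra logarithm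
  -- of the scaling bound, so that one pair serves both estimates.
  · refine ⟨36 * 10 ^ 8, 3, by norm_num, ?_⟩
    intro S A _ _ _ γ Pol ε δ hPol hε hδ hδ1
    obtain ⟨η, lam, T, hlam, hsucc, hcond, hT⟩ :=
      VRCPI.exists_sample_efficient_parameters γ Pol hPol hε hδ hδ1
    have hΛ := VRCPI.one_le_logFactor (A := A) γ hε hδ hδ1
    have hrate : 1 ≤ VRCPI.leadingRate A γ ε := le_max_left _ _
    have hn := Real.log_natCast_nonneg (VRCPI.coveringNumber Pol (VRCPI.coverScale A γ ε))
    have hn' := Real.log_natCast_nonneg (VRCPI.coveringNumber Pol ε)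
    refine ⟨η, lam, T, hlam, hsucc, hcond, hT.trans ?_, fun κ hκ hscale => hT.trans ?_⟩
    · gcongr
      · norm_num
      · norm_num
    · have h := VRCPI.log_coveringNumber_le_of_scaling γ hε hδ hδ1 hκ (by linarith) hscale
      calc _ ≤ 4 * 10 ^ 8 * (9 * κ * (1 + Real.log (VRCPI.coveringNumber Pol ε)) *
            VRCPI.logFactor A γ ε δ) * VRCPI.leadingRate A γ ε *
              VRCPI.logFactor A γ ε δ ^ 2 := by gcongr
        _ = _ := by ring
  · intro S A _ _ _ γ η lam T M μ erm π₁
    refine ⟨fun h hh => ?_, VRCPI.lexpect_episodeLengths_le M γ μ η lam erm π₁ T⟩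
    rw [VRCPI.length_episodeLengths, VRCPI.length_of_mem_support M γ lam μ η erm π₁ hh]
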